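/- **Setting.** Let $p$ be a prime, $\mathbf F_q$ a finite field of characteristic $p$, and $f_1,\dots,f_r\in\mathbf F_q[x_0,\dots,x_n]$ nonconstant homogeneous polynomials of degrees $d_1,\dots,d_r$ such that $f_1=\dots=f_r=0$ defines a smooth complete intersection of codimension $r$ in $\mathbf P^n$. Let $b$ be a rational number with $1/(p-1)<b<p/(p-1)$, and $M$ a positive integer such that $Mb/(p(p-1))$ and $M/(p-1)$ are integers. Let $\zeta_p\in\mathbf C_p$ be a primitive $p$-th root of unity and $\pi\in\mathbf C_p$ with $\pi^M=p$. Let $K$ be the unramified extension of $\mathbf Q_p$ with residue field $\mathbf F_q$, put $\tilde\Lambda_0=K(\zeta_p,\pi)$, and let $\mathcal O$ be its ring of integers. Let $\gamma\in\mathbf Q_p(\zeta_p)$ be a zero of $\sum_{i\ge0}t^{p^i}/p^i$ with $\operatorname{ord}_p\gamma=1/(p-1)$, and put $\gamma_l=\sum_{i=0}^{l}\gamma^{p^i}/p^i$. Let $\hat f_j\in K[x]$ be the Teichmüller lifting of $f_j$, let $\tau$ be the Frobenius automorphism of $K/\mathbf Q_p$, acting on the coefficients of polynomials, and put $$H=\sum_{l\ge0}\gamma_l\sum_{j=1}^r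 y_j^{p^l}\,\hat f_j^{\tau^l}(x_0^{p^l},\dots,x_n^{p^l}).$$ For $s\in\mathbf Z$ let $F^s\Omega^k_{b,0}$ be the $\mathcal O$-module of $k$-forms that are sums of terms $\xi\,dx_{i_1}\cdots dx_{i_l}\,dy_{j_1}\cdots dy_{j_m}$ with $l+m=k$, $i_1<\dots<i_l$, $j_1<\dots<j_m$ and $$\xi=\sum_{u,v}A_{u,v}\,\pi^{Mb(|v|+m)}x^uy^v,\qquad A_{u,v}\in\pi^s\mathcal O,\quad A_{u,v}\to0\ \text{as}\ (u,v)\to\infty,$$ where $|v|=v_1+\dots+v_r$ and $A_{u,v}=0$ unless $\sum_iu_i+l-\sum_jv_jd_j-d_{j_1}-\dots-d_{j_m}=0$. The boundary operator is $D\omega=\pi^{Mb}\gamma^{-1}(d\omega+dH\wedge\omega)$. Let $\theta$ be contraction with the vector field $\sum_ix_i\,\partial/\partial x_i-\sum_jd_jy_j\,\partial/\partial y_j$; it lowers the degree of a form by one and anticommutes with $D$ on these forms. Define complexes * $F^s\widetilde\Omega^k_{b,0}=\theta(F^s\Omega^{k+1}_{b,0})$ for $k\ge0$, with boundary map $D$;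 * $F^s\widehat\Omega^0_{b,0}=\pi^s\mathcal O$ and $F^s\widehat\Omega^k_{b,0}=F^s\widetilde\Omega^{k-1}_{b,0}$ for $k\ge1$, with boundary map $0$ in degree $0$ and $-D$ in positive degrees. They fit into a short exact sequence of complexes $0\to F^s\widetilde\Omega^\bullet_{b,0}\to F^s\Omega^\bullet_{b,0}\to F^s\widehat\Omega^\bullet_{b,0}\to0$, whose second map is the constant term in degree $0$ and $\theta$ in positive degrees. Let $\delta:H^k(F^s\widehat\Omega^\bullet_{b,0})\to H^{k+1}(F^s\widetilde\Omega^\bullet_{b,0})$ be its connecting homomorphism. Let $\eta_0=1\in F^0\widehat\Omega^0_{b,0}$ and, for $i\ge1$, let $\eta_i\in F^0\widetilde\Omega^{2i-1}_{b,0}=F^0\widehat\Omega^{2i}_{b,0}$ be such that $[\eta_i]=\delta([\eta_{i-1}])$. **Statement.** Let $s\in\mathbf Z$ and $2r\le k<n+r$. Then $H^k(F^s\widetilde\Omega^\bullet_{b,0})=H^{k+1}(F^s\widehat\Omega^\bullet_{b,0})$ (the class of $\omega$ on the left corresponding to the class of $\omega$ on the right), and the following hold. (a) If $p\nmid d_1\cdots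 d_r$, then $H^k(F^s\widetilde\Omega^\bullet_{b,0})=H^{k+1}(F^s\widehat\Omega^\bullet_{b,0})=0$. (b) If $p\mid d_1\cdots d_r$, then, as $\mathcal O$-modules, $$H^k(F^s\widetilde\Omega^\bullet_{b,0})=H^{k+1}(F^s\widehat\Omega^\bullet_{b,0})\cong\begin{cases}\mathcal O/(d_1\cdots d_r)\mathcal O&\text{if $k$ is odd,}\\0&\text{if $k$ is even.}\end{cases}$$ Moreover, if $k$ is odd, a sequence $(\eta_i)$ as above exists, and for every such sequence the class $[\pi^s\eta_{(k+1)/2}]$ generates this torsion module. -/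

import Mathlib

open scoped Topology

noncomputable section

namespace DworkCI

/-! ### Polynomials and smooth complete intersections -/

/-- The variables `x_0, …, x_n` (left summand) and `y_1, …, y_r` (right summand). -/
abbrev Var (n r : ℕ) : Type := Fin (n + 1) ⊕ Fin r

/-- The homogeneous polynomials `f_1, …, f_r` in `x_0, …, x_n` define a smooth complete intersection
of codimension `r` in projective `n`-space (projective Jacobian criterion): at each geometric point
of the common zero set the gradients of `f_1, …, f_r` are linearly independent. -/
def IsSmoothCompleteIntersection {F : Type*} [Field F] {n r : ℕ}
    (f : Fin r → MvPolynomial (Fin (n + 1)) F) : Prop :=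
  ∀ x : Fin (n + 1) → AlgebraicClosure F, x ≠ 0 →
    (∀ j, MvPolynomial.aeval x (f j) = 0) →
    LinearIndependent (AlgebraicClosure F)
      (fun (j : Fin r) (i : Fin (n + 1)) => MvPolynomial.aeval x (MvPolynomial.pderiv i (f j)))

/-- `F(x, y) = y_1 f_1(x) + ⋯ + y_r f_r(x)`. -/
def totalPoly {F : Type*} [Field F] {n r : ℕ} (f : Fin r → MvPolynomial (Fin (n + 1)) F) :
    MvPolynomial (Var n r) F :=
  ∑ j, MvPolynomial.X (Sum.inr j) * MvPolynomial.rename Sum.inl (f j)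

/-! ### Differential forms with power series coefficients

The free module on `dx_{i_1} ⋯ dx_{i_l} dy_{j_1} ⋯ dy_{j_m}` with `i_1 < ⋯ < i_l` and
`j_1 < ⋯ < j_m`; the index of such a product is the finite set of the variables in it. -/

/-- Differential forms (of all degrees) with coefficients formal power series in `x` and `y`:
`ω S` is the coefficient of the product of the `dz`, `z ∈ S`, in increasing order, where
`x_0 < ⋯ < x_n < y_1 < ⋯ < y_r`. -/
abbrev Form (n r : ℕ) (E : Type*) : Type _ := Finset (Var n r) → MvPowerSeries (Var n r) E

/-- `(-1)` to the number of elements of `S` that come before `i`. -/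
def sgn {n r : ℕ} (S : Finset (Var n r)) (i : Var n r) : ℤ :=
  (-1) ^ (S.filter (fun j => toLex j < toLex i)).card

/-- Exterior multiplication on the left by the 1-form `∑ i, α i dz_i`. -/
def wedge {n r : ℕ} {E : Type*} [Field E] (α : Var n r → MvPowerSeries (Var n r) E) :
    Form n r E →ₗ[E] Form n r E where
  toFun ω S := ∑ i ∈ S, sgn S i • (α i * ω (S.erase i))
  map_add' ω ω' := by
    funext S
    simp only [Pi.add_apply, mul_add, smul_add, Finset.sum_add_distrib]
  map_smul' a ω := by
    funext S
    simp only [Pi.smul_apply, RingHom.id_apply, Finset.smul_sum, mul_smul_comm]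
    exact Finset.sum_congr rfl fun i _ => smul_comm _ _ _

/-- The exterior derivative `d`. -/
def extDeriv {n r : ℕ} {E : Type*} [Field E] : Form n r E →ₗ[E] Form n r E where
  toFun ω S := ∑ i ∈ S, sgn S i • MvPowerSeries.pderiv E i (ω (S.erase i))
  map_add' ω ω' := by
    funext S
    simp only [Pi.add_apply, map_add, smul_add, Finset.sum_add_distrib]
  map_smul' a ω := by
    funext S
    simp only [Pi.smul_apply, RingHom.id_apply, Finset.smul_sum, Derivation.map_smul]
    exact Finset.sum_congr rfl fun i _ => smul_comm _ _ _

/-- The weight of a variable and of its differential: `1` for `x_i`, and `-d_j` for `y_j`. -/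
def wt {n r : ℕ} (d : Fin r → ℕ) : Var n r → ℤ :=
  Sum.elim (fun _ => 1) (fun j => -(d j : ℤ))

/-- The map `θ`, contraction with the vector field `∑ x_i ∂/∂x_i - ∑ d_j y_j ∂/∂y_j`. -/
def theta {n r : ℕ} {E : Type*} [Field E] (d : Fin r → ℕ) : Form n r E →ₗ[E] Form n r E where
  toFun ω S := ∑ i ∈ Sᶜ, sgn S i • wt d i • (MvPowerSeries.X i * ω (insert i S))
  map_add' ω ω' := by
    funext S
    simp only [Pi.add_apply, mul_add, smul_add, Finset.sum_add_distrib]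
  map_smul' a ω := by
    funext S
    simp only [Pi.smul_apply, RingHom.id_apply, Finset.smul_sum, mul_smul_comm]
    refine Finset.sum_congr rfl fun i _ => ?_
    rw [smul_comm a (sgn S i), smul_comm a (wt d i)]

/-- `|v|`, the total degree in `y` of the monomial `x^u y^v`. -/
def ydeg {n r : ℕ} (m : Var n r →₀ ℕ) : ℕ := ∑ j : Fin r, m (Sum.inr j)

/-- The number of the `dy_j` in the product of differentials indexed by `S`. -/
def dyCount {n r : ℕ} (S : Finset (Var n r)) : ℕ := (S.filter (fun i => i.isRight = true)).card

/-- The weight of `x^u y^v dx_{i_1} ⋯ dx_{i_l} dy_{j_1} ⋯ dy_{j_m}`, which is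
`∑ u_i + l - ∑ v_j d_j - d_{j_1} - ⋯ - d_{j_m}`. -/
def formWt {n r : ℕ} (d : Fin r → ℕ) (m : Var n r →₀ ℕ) (S : Finset (Var n r)) : ℤ :=
  ∑ i, (m i : ℤ) * wt d i + ∑ i ∈ S, wt d i

/-! ### Cohomology of a sequence of submodules stable under a differential -/

/-- Cocycles of degree `k` of the complex `C 0 → C 1 → ⋯`, all of whose terms are submodules of one
module `V` and whose boundary maps are the restrictions of `δ`. -/
def cocycles {R V : Type*} [Ring R] [AddCommGroup V] [Module R V] (δ : V →ₗ[R] V)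
    (C : ℕ → Submodule R V) (k : ℕ) : Submodule R V :=
  C k ⊓ LinearMap.ker δ

/-- Coboundaries of degree `k`. -/
def coboundaries {R V : Type*} [Ring R] [AddCommGroup V] [Module R V] (δ : V →ₗ[R] V)
    (C : ℕ → Submodule R V) : ℕ → Submodule R V
  | 0 => ⊥
  | k + 1 => (C k).map δ

/-- The cohomology module in degree `k`: cocycles modulo coboundaries. -/
abbrev Cohomology {R V : Type*} [Ring R] [AddCommGroup V] [Module R V] (δ : V →ₗ[R] V)
    (C : ℕ → Submodule R V) (k : ℕ) : Type _ :=
  ↥(cocycles δ C k) ⧸ (coboundaries δ C k).submoduleOf (cocycles δ C k)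

/-- The cohomology class of a cocycle. -/
def cls {R V : Type*} [Ring R] [AddCommGroup V] [Module R V] (δ : V →ₗ[R] V)
    (C : ℕ → Submodule R V) (k : ℕ) (ω : V) (h : ω ∈ cocycles δ C k) : Cohomology δ C k :=
  Submodule.Quotient.mk ⟨ω, h⟩

/-! ### The `p`-adic constants -/

/-- The `p`-adic choices on which Dwork's complex over the finite field `F` depends. -/
structure Constants (p : ℕ) [Fact p.Prime] (F : Type*) [Field F] where
  /-- the rational number `b`, with `1/(p-1) < b < p/(p-1)` -/
  b : ℚ
  lt_b : 1 / ((p : ℚ) - 1) < b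
  b_lt : b < (p : ℚ) / ((p : ℚ) - 1)
  /-- the positive integer `M` -/
  M : ℕ
  M_pos : 0 < M
  dvd_M : (p - 1) ∣ M
  /-- the integer `M b`, a multiple of `p (p - 1)` -/
  Mb : ℕ
  Mb_eq : (Mb : ℚ) = (M : ℚ) * b
  dvd_Mb : p * (p - 1) ∣ Mb
  /-- a primitive `p`-th root of unity -/
  ζ : ℂ_[p]
  isPrimitiveRoot : IsPrimitiveRoot ζ p
  /-- an `M`-th root of `p` -/
  π : ℂ_[p]
  π_pow : π ^ M = (p : ℂ_[p])
  /-- a zero in `ℚ_p(ζ)` of `∑ t^(p^i) / p^i` with `ord γ = 1/(p-1)` -/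
  γ : ℂ_[p]
  γ_mem : γ ∈ IntermediateField.adjoin ℚ_[p] ({ζ} : Set ℂ_[p])
  γ_root : HasSum (fun i : ℕ => γ ^ p ^ i / (p : ℂ_[p]) ^ i) 0
  γ_norm : ‖γ‖ ^ (p - 1) = ‖(p : ℂ_[p])‖
  /-- the Teichmüller lifting of `F` into `ℂ_p`: it is multiplicative, and additive modulo the
  maximal ideal, i.e. a multiplicative lift of an embedding of `F` in the residue field -/
  T : F →*₀ ℂ_[p]
  T_add : ∀ x y, ‖T (x + y) - (T x + T y)‖ < 1

namespace Constants

variable {p : ℕ} [Fact p.Prime] {F : Type*} [Field F]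

/-- The field `K(ζ, π)`, where `K` is the unramified extension of `ℚ_p` with residue field `F`,
i.e. the field generated over `ℚ_p` by the Teichmüller representatives. -/
def coeffField (c : Constants p F) : IntermediateField ℚ_[p] ℂ_[p] :=
  IntermediateField.adjoin ℚ_[p] (Set.range c.T ∪ {c.ζ, c.π})

/-- The ring of integers of `K(ζ, π)`. -/
def integers (c : Constants p F) : Subring ℂ_[p] where
  carrier := {x | x ∈ c.coeffField ∧ ‖x‖ ≤ 1}
  zero_mem' := ⟨zero_mem _, by simp⟩
  one_mem' := ⟨one_mem _, by simp⟩
  add_mem' := fun {x y} hx hy => ⟨add_mem hx.1 hy.1,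
    (IsUltrametricDist.norm_add_le_max x y).trans (max_le hx.2 hy.2)⟩
  neg_mem' := fun {x} hx => ⟨neg_mem hx.1, by simpa using hx.2⟩
  mul_mem' := fun {x y} hx hy => ⟨mul_mem hx.1 hy.1, by
    rw [norm_mul]; exact mul_le_one₀ hx.2 (norm_nonneg _) hy.2⟩

/-- `γ_l = ∑_{i ≤ l} γ^(p^i) / p^i`. -/
def gammaTrunc (c : Constants p F) (l : ℕ) : ℂ_[p] :=
  ∑ i ∈ Finset.range (l + 1), c.γ ^ p ^ i / (p : ℂ_[p]) ^ i

variable {n r : ℕ}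

/-- `G^{τ^l}(x^{p^l}, y^{p^l})` for the Teichmüller lifting `G` of `F(x, y) = ∑ y_j f_j`. The
lift `τ` of Frobenius sends the Teichmüller representative `T a` to `T (a ^ p) = (T a) ^ p`. -/
def twistedLift (c : Constants p F) (f : Fin r → MvPolynomial (Fin (n + 1)) F) (l : ℕ) :
    MvPolynomial (Var n r) ℂ_[p] :=
  ∑ m ∈ (totalPoly f).support,
    MvPolynomial.monomial (p ^ l • m) (c.T (MvPolynomial.coeff m (totalPoly f)) ^ p ^ l)

/-- The series `H = ∑_l γ_l G^{τ^l}(x^{p^l}, y^{p^l})`. The `l`-th term is homogeneous of degree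
`p^l` in `y`, so each coefficient of `H` has a contribution from at most one `l`. -/
def hSeries (c : Constants p F) (f : Fin r → MvPolynomial (Fin (n + 1)) F) :
    MvPowerSeries (Var n r) ℂ_[p] :=
  fun m => ∑ᶠ l : ℕ, c.gammaTrunc l * MvPolynomial.coeff m (c.twistedLift f l)

/-- A `ℂ_p`-linear map as a map of modules over the ring of integers. -/
def restrict (c : Constants p F) (φ : Form n r ℂ_[p] →ₗ[ℂ_[p]] Form n r ℂ_[p]) :
    Form n r ℂ_[p] →ₗ[c.integers] Form n r ℂ_[p] where
  toFun := φ
  map_add' := φ.map_add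
  map_smul' := fun a ω => φ.map_smul (a : ℂ_[p]) ω

/-- The boundary operator `D ω = π^{Mb} γ^{-1} (dω + dH ∧ ω)`. -/
def D (c : Constants p F) (f : Fin r → MvPolynomial (Fin (n + 1)) F) :
    Form n r ℂ_[p] →ₗ[c.integers] Form n r ℂ_[p] :=
  c.restrict ((c.π ^ c.Mb * c.γ⁻¹) •
    (extDeriv + wedge (fun i => MvPowerSeries.pderiv ℂ_[p] i (c.hSeries f))))

/-- The map `θ` as a map of modules over the ring of integers. -/
def thetaInt (c : Constants p F) (d : Fin r → ℕ) :
    Form n r ℂ_[p] →ₗ[c.integers] Form n r ℂ_[p] :=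
  c.restrict (theta d)

/-- `F^s Ω^k_{b,0}`: the `k`-forms whose coefficient of `dx_{i_1} ⋯ dx_{i_l} dy_{j_1} ⋯ dy_{j_m}`
is `∑ A_{u,v} π^{Mb (|v| + m)} x^u y^v` with `A_{u,v}` in `π^s` times the ring of integers,
`A_{u,v} → 0` as `(u, v) → ∞`, and all of whose monomials have weight `0`. -/
def filt (c : Constants p F) (n : ℕ) (d : Fin r → ℕ) (s : ℤ) (k : ℕ) :
    Submodule c.integers (Form n r ℂ_[p]) where
  carrier := {ω | ∀ S : Finset (Var n r),
    (S.card ≠ k → ω S = 0) ∧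
    (∀ m, ∃ a ∈ c.integers, MvPowerSeries.coeff m (ω S) =
      a * c.π ^ s * c.π ^ (c.Mb * (ydeg m + dyCount S))) ∧
    Filter.Tendsto
      (fun m => MvPowerSeries.coeff m (ω S) / c.π ^ (c.Mb * (ydeg m + dyCount S)))
      Filter.cofinite (𝓝 0) ∧
    (∀ m, MvPowerSeries.coeff m (ω S) ≠ 0 → formWt d m S = 0)}
  zero_mem' := fun S => ⟨fun _ => rfl, fun m => ⟨0, zero_mem _, by simp⟩, by simp, by simp⟩
  add_mem' := fun {ω ω'} h h' S => by
    obtain ⟨h1, h2, h3, h4⟩ := h S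
    obtain ⟨h1', h2', h3', h4'⟩ := h' S
    refine ⟨fun hS => by simp [h1 hS, h1' hS], fun m => ?_, ?_, fun m hm => ?_⟩
    · obtain ⟨a, ha, e⟩ := h2 m
      obtain ⟨a', ha', e'⟩ := h2' m
      exact ⟨a + a', add_mem ha ha', by rw [Pi.add_apply, map_add, e, e']; ring⟩
    · simpa [add_div] using h3.add h3'
    · by_cases h0 : MvPowerSeries.coeff m (ω S) = 0
      · exact h4' m fun h0' => hm (by simp [h0, h0'])
      · exact h4 m h0
  smul_mem' := fun a ω h S => by
    obtain ⟨h1, h2, h3, h4⟩ := h S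
    have key : ∀ m, MvPowerSeries.coeff m ((a • ω) S) =
        (a : ℂ_[p]) * MvPowerSeries.coeff m (ω S) := fun m => rfl
    refine ⟨fun hS => by simp [h1 hS], fun m => ?_, ?_, fun m hm => ?_⟩
    · obtain ⟨a', ha', e⟩ := h2 m
      exact ⟨a * a', mul_mem a.2 ha', by rw [key, e]; ring⟩
    · simp only [key, mul_div_assoc]
      simpa only [mul_zero] using h3.const_mul (a : ℂ_[p])
    · exact h4 m fun h0 => hm (by rw [key, h0, mul_zero])

/-- The complex with terms `θ(F^s Ω^{k+1}_{b,0})`, `k = 0, 1, …`, and boundary map `D`. -/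
def tilde (c : Constants p F) (n : ℕ) (d : Fin r → ℕ) (s : ℤ) (k : ℕ) :
    Submodule c.integers (Form n r ℂ_[p]) :=
  (c.filt n d s (k + 1)).map (c.thetaInt d)

/-- The complex with term `π^s` times the ring of integers in degree `0`, and in degree `k + 1`
the `k`-th term of the complex `tilde`. Both are placed in one module `ℂ_p × forms`. -/
def hat (c : Constants p F) (n : ℕ) (d : Fin r → ℕ) (s : ℤ) :
    ℕ → Submodule c.integers (ℂ_[p] × Form n r ℂ_[p])
  | 0 => (Submodule.span c.integers {c.π ^ s}).map
      (LinearMap.inl c.integers ℂ_[p] (Form n r ℂ_[p]))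
  | k + 1 => (c.tilde n d s k).map (LinearMap.inr c.integers ℂ_[p] (Form n r ℂ_[p]))

/-- The boundary map of the complex `hat`: zero in degree `0`, and `-D` in positive degrees. -/
def hatD (c : Constants p F) (f : Fin r → MvPolynomial (Fin (n + 1)) F) :
    (ℂ_[p] × Form n r ℂ_[p]) →ₗ[c.integers] (ℂ_[p] × Form n r ℂ_[p]) :=
  (LinearMap.inr c.integers ℂ_[p] (Form n r ℂ_[p])).comp
    ((-(c.D f)).comp (LinearMap.snd c.integers ℂ_[p] (Form n r ℂ_[p])))

/-- The cohomology of `tilde` in degree `k`. -/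
abbrev HTilde (c : Constants p F) (f : Fin r → MvPolynomial (Fin (n + 1)) F) (d : Fin r → ℕ)
    (s : ℤ) (k : ℕ) : Type _ :=
  Cohomology (c.D f) (c.tilde n d s) k

/-- The cohomology of `hat` in degree `k`. -/
abbrev HHat (c : Constants p F) (f : Fin r → MvPolynomial (Fin (n + 1)) F) (d : Fin r → ℕ)
    (s : ℤ) (k : ℕ) : Type _ :=
  Cohomology (c.hatD f) (c.hat n d s) k

/-- The map of complexes from `F^s Ω_{b,0}` to `hat`: the constant term in degree `0`, and `θ` in
positive degrees. -/
def toHat (c : Constants p F) (n : ℕ) (d : Fin r → ℕ) (k : ℕ) (τ : Form n r ℂ_[p]) :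
    ℂ_[p] × Form n r ℂ_[p] :=
  if k = 0 then (MvPowerSeries.constantCoeff (τ ∅), 0) else (0, c.thetaInt d τ)

/-- The connecting homomorphism of `0 → tilde → F^s Ω_{b,0} → hat → 0` sends the class of the
`k`-cocycle `z` of `hat` to the class of the element `w` of `tilde`: for a lift `τ` of `z` to
`F^s Ω^k_{b,0}`, the forms `w` and `D τ` differ by a coboundary of `tilde`. -/
def IsConnecting (c : Constants p F) (f : Fin r → MvPolynomial (Fin (n + 1)) F) (d : Fin r → ℕ)
    (s : ℤ) (k : ℕ) (z : ℂ_[p] × Form n r ℂ_[p]) (w : Form n r ℂ_[p]) : Prop :=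
  w ∈ c.tilde n d s (k + 1) ∧
  ∃ τ ∈ c.filt n d s k, c.toHat n d k τ = z ∧
    w - c.D f τ ∈ coboundaries (c.D f) (c.tilde n d s) (k + 1)

/-- Sequences `η_0, η_1, …` with `η_i` in the term of degree `2 i` of `hat` for `s = 0`, such that
`η_0 = 1` and the connecting homomorphism sends `[η_i]` to `[η_{i+1}]`. -/
def IsEtaSeq (c : Constants p F) (f : Fin r → MvPolynomial (Fin (n + 1)) F) (d : Fin r → ℕ)
    (η : ℕ → ℂ_[p] × Form n r ℂ_[p]) : Prop :=
  η 0 = (1, 0) ∧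
  ∀ i, (η (i + 1)).1 = 0 ∧ c.IsConnecting f d 0 (2 * i) (η i) (η (i + 1)).2

end Constants

end DworkCI

end

open DworkCI

set_option linter.unusedSectionVars false

noncomputable section

/-! After the substitution `y ↦ π^(Mb) y`, Dwork's complex of level zero becomes a complex of weight
zero forms whose coefficients are restricted power series over the ring of integers, with boundary
`c d + ψ ∧`. Here `c = π^(Mb)/γ` is divisible by `π` because `b > 1/(p-1)`. The form `ψ` is integral
and restricted because `b < p/(p-1)`, and modulo `π` it is the gradient of `∑ y_j f_j`. Reduction
modulo `π` thus gives the weight zero part of a Koszul complex.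

The Koszul complex. By smoothness and the Nullstellensatz the partial derivatives of `∑ y_j f_j`
generate the unit ideal once `x_i y_j` is inverted, so the complex is exact over `{x ≠ 0} ∩ {y ≠
0}`. A Mayer–Vietoris argument leaves the local cohomology along `x = 0`, along `y = 0` and at the
origin, where certain exponents are all negative. Weight zero is so restrictive that the first lives
in total degree at least `2(n+1)` and the second only in degree `2r`, where it is spanned by `∏
y_j⁻¹ dy_j`. The third lives in degree at least `n+1+r` for lack of room. Hence below degree `n+r`
only degree `2r` has cohomology, generated by `∏ df_j dy_j` (`exists_poly_primitive`). Successive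
approximation in powers of `π` carries this to the integers (`exists_restricted_primitive`,
`exists_tateForms_primitive`).

The forms `B_m`. Every monomial of `H` contains exactly one of the `y_j`, so `dH` is a sum of forms
`κ_j = y_j β_j + H_j dy_j`, for which `θ(β_j dy_j) = d_j κ_j` and `κ_j β_j dy_j = 0`. If `B_m` is
the coefficient of `T^m` in `∏ (d_j + T β_j dy_j)`, then `D B_m = θ B_{m+1}` (`twistedD_bSeq`), with
`B_0 = ∏ d_j`, `B_{r+1} = 0` and `B_r` a lift of `∏ df_j dy_j`.

The long exact sequence. On weight zero forms `θ` is exact apart from constants, because the `x_i`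
have weight `1`. As `hat` is the shift of `tilde` in positive degrees, the connecting homomorphism
raises degree by two on the cohomology of `hat`, and the relation above says that the image of `B_m`
represents `(∏ d_j) η_m`. Up to `η_r` there is no torsion. In passing degree `2r` the class `B_r`
imposes exactly the relation `∏ d_j = 0`, and after that nothing changes below the bound. In even
degrees `tilde` has no cohomology. This is the abstract argument of `ShiftedSequence`.
Multiplication by `π^s` reduces every level to level zero, and `p ∤ ∏ d_j` makes the product a unit.
-/

namespace DworkCI

/-! ### Exterior algebra in coordinates -/

section Exterior

variable {ι R : Type*} [DecidableEq ι] [CommRing R] (rk : ι → ℕ)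

/-- `(-1)` to the number of elements of `S` of rank less than that of `i`. -/
def esgn (S : Finset ι) (i : ι) : ℤ := (-1) ^ (S.filter (fun j => rk j < rk i)).card

/-- `-1` if `i` precedes `j`, and `1` otherwise. -/
def osgn (i j : ι) : ℤ := if rk i < rk j then -1 else 1

variable {rk}

theorem esgn_mul_self (S : Finset ι) (i : ι) : esgn rk S i * esgn rk S i = 1 := by
  unfold esgn; rw [← mul_pow]; simp

theorem esgn_insert {S : Finset ι} {i : ι} (h : i ∉ S) (j : ι) :
    esgn rk (insert i S) j = osgn rk i j * esgn rk S j := by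
  unfold esgn osgn
  rw [Finset.filter_insert]
  split_ifs with h1
  · rw [Finset.card_insert_of_notMem (by simp [h]), pow_succ]; ring
  · ring

theorem esgn_erase {S : Finset ι} {i : ι} (h : i ∈ S) (j : ι) :
    esgn rk (S.erase i) j = osgn rk i j * esgn rk S j := by
  have := esgn_insert (rk := rk) (Finset.notMem_erase i S) j
  rw [Finset.insert_erase h] at this
  rw [this, ← mul_assoc]
  have : osgn rk i j * osgn rk i j = 1 := by unfold osgn; split_ifs <;> simp
  rw [this, one_mul]

theorem osgn_mul_swap (hrk : Function.Injective rk) {i j : ι} (h : i ≠ j) :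
    osgn rk i j * osgn rk j i = -1 := by
  unfold osgn
  rcases lt_trichotomy (rk i) (rk j) with h1 | h1 | h1
  · simp [h1, h1.not_gt]
  · exact absurd (hrk h1) h
  · simp [h1, h1.not_gt]

theorem osgn_self (i : ι) : osgn rk i i = 1 := by simp [osgn]

variable (rk)

/-- Left multiplication by the `i`-th generator. -/
def crea (i : ι) : (Finset ι → R) →ₗ[R] (Finset ι → R) where
  toFun ω S := if i ∈ S then esgn rk S i • ω (S.erase i) else 0
  map_add' ω ω' := by
    funext S; simp only [Pi.add_apply]; split_ifs <;> simp
  map_smul' a ω := by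
    funext S; simp only [Pi.smul_apply, RingHom.id_apply]; split_ifs
    · rw [smul_comm]
    · simp

/-- Contraction with the dual of the `i`-th generator. -/
def anni (i : ι) : (Finset ι → R) →ₗ[R] (Finset ι → R) where
  toFun ω S := if i ∈ S then 0 else esgn rk S i • ω (insert i S)
  map_add' ω ω' := by
    funext S; simp only [Pi.add_apply]; split_ifs <;> simp
  map_smul' a ω := by
    funext S; simp only [Pi.smul_apply, RingHom.id_apply]; split_ifs
    · simp
    · rw [smul_comm]

variable {rk}

theorem crea_apply (i : ι) (ω : Finset ι → R) (S : Finset ι) :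
    crea rk i ω S = if i ∈ S then esgn rk S i • ω (S.erase i) else 0 := rfl

theorem anni_apply (i : ι) (ω : Finset ι → R) (S : Finset ι) :
    anni rk i ω S = if i ∈ S then 0 else esgn rk S i • ω (insert i S) := rfl

theorem crea_crea_self (i : ι) (ω : Finset ι → R) : crea rk i (crea rk i ω) = 0 := by
  funext S; simp [crea_apply]

theorem anni_anni_self (i : ι) (ω : Finset ι → R) : anni rk i (anni rk i ω) = 0 := by
  funext S; simp [anni_apply]

theorem crea_crea (hrk : Function.Injective rk) {i j : ι} (h : i ≠ j) (ω : Finset ι → R) :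
    crea rk i (crea rk j ω) = -crea rk j (crea rk i ω) := by
  funext S
  simp only [crea_apply, Pi.neg_apply, Finset.mem_erase]
  by_cases hi : i ∈ S <;> by_cases hj : j ∈ S <;> simp only [hi, hj, h, h.symm, ne_eq, not_false_eq_true, and_self, and_false, if_true, if_false, smul_zero, neg_zero]
  rw [esgn_erase hi, esgn_erase hj, smul_smul, smul_smul, Finset.erase_right_comm, ← neg_smul]
  congr 1
  have := osgn_mul_swap hrk h
  have h2 : osgn rk j i * osgn rk j i = 1 := by unfold osgn; split_ifs <;> simp
  have h3 : osgn rk i j = - osgn rk j i := by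
    calc osgn rk i j = osgn rk i j * osgn rk j i * osgn rk j i := by rw [mul_assoc, h2, mul_one]
      _ = _ := by rw [this]; ring
  rw [h3]; ring

theorem anni_anni (hrk : Function.Injective rk) {i j : ι} (h : i ≠ j) (ω : Finset ι → R) :
    anni rk i (anni rk j ω) = -anni rk j (anni rk i ω) := by
  funext S
  simp only [anni_apply, Pi.neg_apply, Finset.mem_insert]
  by_cases hi : i ∈ S <;> by_cases hj : j ∈ S <;> simp only [hi, hj, h, h.symm, or_self, or_true, if_true, if_false, smul_zero, neg_zero]
  rw [esgn_insert hi, esgn_insert hj, smul_smul, smul_smul, Finset.insert_comm, ← neg_smul]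
  congr 1
  have := osgn_mul_swap hrk h
  have h2 : osgn rk j i * osgn rk j i = 1 := by unfold osgn; split_ifs <;> simp
  have h3 : osgn rk i j = - osgn rk j i := by
    calc osgn rk i j = osgn rk i j * osgn rk j i * osgn rk j i := by rw [mul_assoc, h2, mul_one]
      _ = _ := by rw [this]; ring
  rw [h3]; ring

theorem crea_anni_self (i : ι) (ω : Finset ι → R) :
    crea rk i (anni rk i ω) + anni rk i (crea rk i ω) = ω := by
  funext S
  simp only [crea_apply, anni_apply, Pi.add_apply]
  by_cases hi : i ∈ S
  · simp only [hi, if_true, Finset.notMem_erase, if_false, smul_smul, esgn_erase hi, osgn_self,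
      one_mul, esgn_mul_self, Finset.insert_erase, one_smul, add_zero]
  · simp only [hi, if_false, Finset.mem_insert_self, if_true, smul_smul, esgn_insert hi, osgn_self,
      one_mul, esgn_mul_self, Finset.erase_insert hi, one_smul, zero_add]

theorem crea_anni (hrk : Function.Injective rk) {i j : ι} (h : i ≠ j) (ω : Finset ι → R) :
    crea rk i (anni rk j ω) = -anni rk j (crea rk i ω) := by
  funext S
  simp only [crea_apply, anni_apply, Pi.neg_apply, Finset.mem_insert, Finset.mem_erase]
  by_cases hi : i ∈ S <;> by_cases hj : j ∈ S <;> simp only [hi, hj, h, h.symm, ne_eq, not_false_eq_true, or_true, or_false, and_true, and_false, if_true, if_false, smul_zero, neg_zero]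
  rw [esgn_erase hi, esgn_insert hj, smul_smul, smul_smul, Finset.erase_insert_of_ne h.symm,
    ← neg_smul]
  congr 1
  have := osgn_mul_swap hrk h
  have h2 : osgn rk j i * osgn rk j i = 1 := by unfold osgn; split_ifs <;> simp
  have h3 : osgn rk i j = - osgn rk j i := by
    calc osgn rk i j = osgn rk i j * osgn rk j i * osgn rk j i := by rw [mul_assoc, h2, mul_one]
      _ = _ := by rw [this]; ring
  rw [h3]; ring

variable [Fintype ι]

variable (rk) in
/-- Left multiplication by `∑ i, α i e_i`. -/
def extMul (α : ι → R) : (Finset ι → R) →ₗ[R] (Finset ι → R) := ∑ i, α i • crea rk i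

variable (rk) in
/-- Contraction with `∑ i, β i e_i^*`. -/
def extContr (β : ι → R) : (Finset ι → R) →ₗ[R] (Finset ι → R) := ∑ i, β i • anni rk i

theorem extMul_eq (α : ι → R) (ω : Finset ι → R) :
    extMul rk α ω = ∑ i, α i • crea rk i ω := by simp [extMul]

theorem extContr_eq (β : ι → R) (ω : Finset ι → R) :
    extContr rk β ω = ∑ i, β i • anni rk i ω := by simp [extContr]

theorem extMul_apply (α : ι → R) (ω : Finset ι → R) (S : Finset ι) :
    extMul rk α ω S = ∑ i ∈ S, esgn rk S i • (α i * ω (S.erase i)) := by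
  rw [extMul_eq, Finset.sum_apply]
  simp only [Pi.smul_apply, crea_apply, smul_eq_mul, mul_ite, mul_zero, mul_smul_comm]
  rw [Finset.sum_ite_mem, Finset.univ_inter]

theorem extContr_apply (α : ι → R) (ω : Finset ι → R) (S : Finset ι) :
    extContr rk α ω S = ∑ i ∈ Sᶜ, esgn rk S i • (α i * ω (insert i S)) := by
  rw [extContr_eq, Finset.sum_apply]
  simp only [Pi.smul_apply, anni_apply, smul_eq_mul, mul_ite, mul_zero, mul_smul_comm]
  rw [← Finset.sum_subset (Finset.subset_univ Sᶜ)]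
  · exact Finset.sum_congr rfl fun i hi => if_neg (by simpa using hi)
  · intro i _ hi; exact if_pos (by simpa using hi)

theorem extMul_add (α β : ι → R) (ω : Finset ι → R) :
    extMul rk (α + β) ω = extMul rk α ω + extMul rk β ω := by
  simp [extMul_eq, add_smul, Finset.sum_add_distrib]

theorem extMul_smul (a : R) (β : ι → R) (ω : Finset ι → R) :
    extMul rk (a • β) ω = a • extMul rk β ω := by
  simp [extMul_eq, Finset.smul_sum, smul_smul]

theorem extMul_zero (ω : Finset ι → R) : extMul rk (0 : ι → R) ω = 0 := by simp [extMul_eq]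

theorem extMul_single (i : ι) (ω : Finset ι → R) :
    extMul rk (Pi.single i 1) ω = crea rk i ω := by
  rw [extMul_eq, Finset.sum_eq_single i]
  · simp
  · intro j _ h; simp [h]
  · simp

/-- The pairs `(i, j)` and `(j, i)` cancel. The diagonal is a separate hypothesis, since `a i i = -a
i i` need not force vanishing. -/
theorem sum_sum_alternating {M κ : Type*} [AddCommGroup M] [Fintype κ] (a : κ → κ → M)
    (h : ∀ i, a i i = 0) (h' : ∀ i j, i ≠ j → a i j = -a j i) : ∑ i, ∑ j, a i j = 0 := by
  classical
  rw [← Finset.sum_product']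
  refine Finset.sum_involution (fun x _ => x.swap) ?_ ?_ ?_ ?_
  · rintro ⟨i, j⟩ _
    by_cases hij : i = j
    · subst hij; simp [h]
    · simp [h' i j hij]
  · rintro ⟨i, j⟩ _ h1 h2
    simp only [Prod.swap_prod_mk, Prod.mk.injEq] at h2
    rw [h2.1] at h1
    exact h1 (h _)
  · simp
  · simp

theorem extMul_extMul_self (hrk : Function.Injective rk) (α : ι → R) (ω : Finset ι → R) :
    extMul rk α (extMul rk α ω) = 0 := by
  simp only [extMul_eq, map_sum, Finset.smul_sum, map_smul, smul_smul]
  refine sum_sum_alternating _ (fun i => ?_) fun i j h => ?_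
  · rw [crea_crea_self, smul_zero]
  · rw [crea_crea hrk h.symm, smul_neg, mul_comm]

theorem extMul_extMul (hrk : Function.Injective rk) (α β : ι → R) (ω : Finset ι → R) :
    extMul rk α (extMul rk β ω) = -extMul rk β (extMul rk α ω) := by
  have := extMul_extMul_self hrk (α + β) ω
  simp only [extMul_add, map_add, extMul_extMul_self hrk, zero_add, add_zero] at this
  exact eq_neg_of_add_eq_zero_right this

theorem extContr_extContr_self (hrk : Function.Injective rk) (α : ι → R) (ω : Finset ι → R) :
    extContr rk α (extContr rk α ω) = 0 := by
  simp only [extContr_eq, map_sum, Finset.smul_sum, map_smul, smul_smul]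
  refine sum_sum_alternating _ (fun i => ?_) fun i j h => ?_
  · rw [anni_anni_self, smul_zero]
  · rw [anni_anni hrk h.symm, smul_neg, mul_comm]

/-- The homotopy formula behind every exactness statement below: as soon as the pairing `∑ α i * β
i` is `1`, contraction with `β` is a homotopy for multiplication by `α`, and conversely. -/
theorem extMul_extContr (hrk : Function.Injective rk) (α β : ι → R) (ω : Finset ι → R) :
    extMul rk α (extContr rk β ω) + extContr rk β (extMul rk α ω) = (∑ i, α i * β i) • ω := by
  simp only [extMul_eq, extContr_eq, map_sum, Finset.smul_sum, map_smul, smul_smul]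
  rw [Finset.sum_comm (f := fun i j => (α i * β j) • anni rk j (crea rk i ω)),
    ← Finset.sum_add_distrib, Finset.sum_smul]
  refine Finset.sum_congr rfl fun i _ => ?_
  rw [← Finset.sum_add_distrib, Finset.sum_eq_single i]
  · rw [mul_comm (β i), ← smul_add, crea_anni_self]
  · intro j _ h; rw [crea_anni hrk h, mul_comm (α j), smul_neg, neg_add_cancel]
  · simp

theorem map_extMul {R' : Type*} [CommRing R'] (φ : R →+* R') (α : ι → R) (ω : Finset ι → R)
    (S : Finset ι) :
    φ (extMul rk α ω S) = extMul rk (fun i => φ (α i)) (fun U => φ (ω U)) S := by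
  simp only [extMul_apply, map_sum, map_zsmul, map_mul]

/-- The form is homogeneous of degree `k`. -/
def HasDeg {R : Type*} [Zero R] (k : ℕ) (ω : Finset ι → R) : Prop := ∀ S, S.card ≠ k → ω S = 0

theorem HasDeg.extMul {k : ℕ} {ω : Finset ι → R} (h : HasDeg k ω) (α : ι → R) :
    HasDeg (k + 1) (extMul rk α ω) := by
  intro S hS
  rw [extMul_apply]
  refine Finset.sum_eq_zero fun i hi => ?_
  rw [h _ (by rw [Finset.card_erase_of_mem hi]; have := Finset.card_pos.2 ⟨i, hi⟩; omega)]
  simp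

/-- The homogeneous part of degree `k - 1`. -/
def degPart {R : Type*} [Zero R] (k : ℕ) (ω : Finset ι → R) : Finset ι → R :=
  fun S => if S.card + 1 = k then ω S else 0

/-- Multiplication by a 1-form raises the degree by one, so only the part of degree `k - 1`
contributes. Together with `extMul_wtPart` this makes the primitives found by homotopies homogeneous
again. -/
theorem extMul_degPart {k : ℕ} {α : ι → R} {ω : Finset ι → R} (h : HasDeg k (extMul rk α ω)) :
    extMul rk α (degPart k ω) = extMul rk α ω := by
  funext S
  by_cases hS : S.card = k
  · rw [extMul_apply, extMul_apply]
    refine Finset.sum_congr rfl fun i hi => ?_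
    rw [degPart, if_pos]
    rw [Finset.card_erase_of_mem hi]; have := Finset.card_pos.2 ⟨i, hi⟩; omega
  · rw [h S hS, extMul_apply]
    refine Finset.sum_eq_zero fun i hi => ?_
    rw [degPart, if_neg]
    · simp
    · rw [Finset.card_erase_of_mem hi]; have := Finset.card_pos.2 ⟨i, hi⟩; omega

end Exterior

/-! ### Laurent polynomials and forms with Čech indices -/

section Laurent

variable {V A : Type*} [CommRing A]

/-- Laurent polynomials in the variables `V`. -/
abbrev Laurent (V A : Type*) [CommRing A] : Type _ := AddMonoidAlgebra A (V → ℤ)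

/-- Laurent polynomials all of whose exponents satisfy `P`. -/
def lsupp (A : Type*) [CommRing A] (P : (V → ℤ) → Prop) : Submodule A (Laurent V A) where
  carrier := {a | ∀ e, a.coeff e ≠ 0 → P e}
  zero_mem' := fun e h => absurd rfl h
  add_mem' := fun {a b} ha hb e h => by
    by_cases h0 : a.coeff e = 0
    · exact hb e fun h1 => h (by rw [AddMonoidAlgebra.coeff_add, Finsupp.add_apply, h0, h1, add_zero])
    · exact ha e h0
  smul_mem' := fun c a ha e h => ha e fun h1 => h (by
    rw [AddMonoidAlgebra.coeff_smul_apply, h1, smul_zero])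

theorem lsupp_mono {P Q : (V → ℤ) → Prop} (h : ∀ e, P e → Q e) : lsupp A P ≤ lsupp A Q :=
  fun _ ha e he => h e (ha e he)

theorem mul_mem_lsupp {P Q R : (V → ℤ) → Prop} {a b : Laurent V A} (ha : a ∈ lsupp A P)
    (hb : b ∈ lsupp A Q) (h : ∀ e e', P e → Q e' → R (e + e')) : a * b ∈ lsupp A R := by
  classical
  intro e he
  rw [AddMonoidAlgebra.coeff_mul, Finsupp.sum] at he
  obtain ⟨e1, h1, h2⟩ := Finset.exists_ne_zero_of_sum_ne_zero he
  obtain ⟨e2, h3, h4⟩ := Finset.exists_ne_zero_of_sum_ne_zero h2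
  have h5 : e1 + e2 = e := by by_contra h6; exact h4 (if_neg h6)
  rw [← h5]
  exact h _ _ (ha _ (Finsupp.mem_support_iff.1 h1)) (hb _ (Finsupp.mem_support_iff.1 h3))

theorem single_mem_lsupp {P : (V → ℤ) → Prop} {e : V → ℤ} (h : P e) (a : A) :
    (AddMonoidAlgebra.single e a : Laurent V A) ∈ lsupp A P := by
  classical
  intro e' he
  rw [AddMonoidAlgebra.coeff_single, Finsupp.single_apply] at he
  by_cases h' : e = e'
  · rwa [← h']
  · exact absurd (if_neg h') he

/-- The part of a Laurent polynomial with exponents in `P`. -/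
def lfilter (P : (V → ℤ) → Prop) [DecidablePred P] : Laurent V A →ₗ[A] Laurent V A where
  toFun a := .ofCoeff (a.coeff.filter P)
  map_add' a b := by
    ext e; simp [Finsupp.filter_apply]
  map_smul' c a := by
    ext e; simp [Finsupp.filter_apply]

theorem coeff_lfilter (P : (V → ℤ) → Prop) [DecidablePred P] (a : Laurent V A) (e : V → ℤ) :
    (lfilter P a).coeff e = if P e then a.coeff e else 0 := by
  simp [lfilter, AddMonoidAlgebra.coeff_ofCoeff, Finsupp.filter_apply]

theorem lfilter_mem (P : (V → ℤ) → Prop) [DecidablePred P] (a : Laurent V A) :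
    lfilter P a ∈ lsupp A P := by
  intro e he
  rw [coeff_lfilter] at he
  by_contra h; exact he (if_neg h)

theorem lfilter_eq_self {P : (V → ℤ) → Prop} [DecidablePred P] {a : Laurent V A}
    (h : a ∈ lsupp A P) : lfilter P a = a := by
  ext e
  rw [coeff_lfilter]
  split_ifs with h1
  · rfl
  · by_contra h2; exact h1 (h e (Ne.symm h2))

theorem lfilter_eq_zero {P : (V → ℤ) → Prop} [DecidablePred P] {a : Laurent V A}
    (h : a ∈ lsupp A (fun e => ¬ P e)) : lfilter P a = 0 := by
  ext e
  rw [coeff_lfilter]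
  split_ifs with h1
  · by_contra h2; exact h e h2 h1
  · rfl

theorem lfilter_mem_of_mem {P Q : (V → ℤ) → Prop} [DecidablePred P] {a : Laurent V A}
    (h : a ∈ lsupp A Q) : lfilter P a ∈ lsupp A Q := by
  intro e he
  rw [coeff_lfilter] at he
  exact h e fun h1 => he (by rw [h1, ite_self])

theorem lfilter_mul {P Q R : (V → ℤ) → Prop} [DecidablePred P] [DecidablePred R]
    {a : Laurent V A} (ha : a ∈ lsupp A Q) (h : ∀ e e', Q e → (R (e + e') ↔ P e'))
    (b : Laurent V A) : lfilter R (a * b) = a * lfilter P b := by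
  have hb : b = lfilter P b + (b - lfilter P b) := by ring
  have h2 : b - lfilter P b ∈ lsupp A (fun e => ¬ P e) := by
    intro e he hP
    apply he
    rw [AddMonoidAlgebra.coeff_sub, Finsupp.sub_apply, coeff_lfilter, if_pos hP, sub_self]
  conv_lhs => rw [hb, mul_add, map_add]
  rw [lfilter_eq_self (mul_mem_lsupp ha (lfilter_mem P b) fun e e' h3 h4 => (h e e' h3).2 h4),
    lfilter_eq_zero (mul_mem_lsupp ha h2 fun e e' h3 h4 h5 => h4 ((h e e' h3).1 h5)), add_zero]

/-- Laurent polynomials in which only the variables in `Z` have negative exponents. -/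
def lneg (A : Type*) [CommRing A] (Z : Finset V) : Submodule A (Laurent V A) :=
  lsupp A (fun e => ∀ z, e z < 0 → z ∈ Z)

theorem lneg_mono {Z Z' : Finset V} (h : Z ⊆ Z') : lneg A Z ≤ lneg A Z' :=
  lsupp_mono fun _ he z hz => h (he z hz)

theorem mul_mem_lneg {Z Z' W : Finset V} {a b : Laurent V A} (ha : a ∈ lneg A Z)
    (hb : b ∈ lneg A Z') (h : Z ⊆ W) (h' : Z' ⊆ W) : a * b ∈ lneg A W :=
  mul_mem_lsupp ha hb fun e e' h1 h2 z hz => by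
    by_cases h3 : e z < 0
    · exact h (h1 z h3)
    · exact h' (h2 z (by rw [Pi.add_apply] at hz; omega))

theorem one_mem_lneg (Z : Finset V) : (1 : Laurent V A) ∈ lneg A Z := by
  rw [AddMonoidAlgebra.one_def]
  exact single_mem_lsupp (fun z hz => absurd hz (lt_irrefl _)) _

variable [Fintype V]

/-- Laurent polynomials which are homogeneous of weight `c` for the weights `w`. -/
def lwt (A : Type*) [CommRing A] (w : V → ℤ) (c : ℤ) : Submodule A (Laurent V A) :=
  lsupp A (fun e => ∑ z, e z * w z = c)

theorem mul_mem_lwt {w : V → ℤ} {c c' c'' : ℤ} {a b : Laurent V A} (ha : a ∈ lwt A w c)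
    (hb : b ∈ lwt A w c') (h : c + c' = c'') : a * b ∈ lwt A w c'' :=
  mul_mem_lsupp ha hb fun e e' h1 h2 => by
    simp only [Pi.add_apply, add_mul, Finset.sum_add_distrib, h1, h2, h]

theorem one_mem_lwt {w : V → ℤ} : (1 : Laurent V A) ∈ lwt A w 0 := by
  rw [AddMonoidAlgebra.one_def]
  exact single_mem_lsupp (by simp) _

end Laurent

/-! ### Čech complexes of forms, and exactness along rows and columns -/

section Cech

variable {V A : Type*} [CommRing A] [Fintype V] [DecidableEq V]

/-- Čech cochains (indexed by the left part) of forms (indexed by the right part). -/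
abbrev Cech (V A : Type*) [CommRing A] : Type _ := Finset (V ⊕ V) → Laurent V A

/-- The coefficients have negative exponents only in the variables inverted by the Čech index. -/
def LocalCond (t : Cech V A) : Prop := ∀ U, t U ∈ lneg A U.toLeft

theorem LocalCond.add {t t' : Cech V A} (h : LocalCond t) (h' : LocalCond t') :
    LocalCond (t + t') := fun U => add_mem (h U) (h' U)
theorem LocalCond.sub {t t' : Cech V A} (h : LocalCond t) (h' : LocalCond t') :
    LocalCond (t - t') := fun U => sub_mem (h U) (h' U)

variable {rk : V ⊕ V → ℕ}

theorem LocalCond.extMul {t : Cech V A} (h : LocalCond t) {α : V ⊕ V → Laurent V A}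
    (hα : ∀ i, α i ∈ lneg A ({i} : Finset (V ⊕ V)).toLeft) : LocalCond (extMul rk α t) := by
  intro U
  rw [extMul_apply]
  refine sum_mem fun i hi => zsmul_mem (mul_mem_lneg (hα i) (h _) ?_ ?_) _
  · exact Finset.toLeft_subset_toLeft (by simpa using hi)
  · exact Finset.toLeft_subset_toLeft (Finset.erase_subset _ _)

/-- The form has weight `c`, where `z` and `dz` have weight `w z`. -/
def WtCond (w : V → ℤ) (c : ℤ) (t : Cech V A) : Prop :=
  ∀ U, t U ∈ lwt A w (c - ∑ z ∈ U.toRight, w z)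

theorem WtCond.add {w : V → ℤ} {c : ℤ} {t t' : Cech V A} (h : WtCond w c t) (h' : WtCond w c t') :
    WtCond w c (t + t') := fun U => add_mem (h U) (h' U)
theorem WtCond.sub {w : V → ℤ} {c : ℤ} {t t' : Cech V A} (h : WtCond w c t) (h' : WtCond w c t') :
    WtCond w c (t - t') := fun U => sub_mem (h U) (h' U)

theorem sum_toRight (w : V → ℤ) (U : Finset (V ⊕ V)) :
    ∑ z ∈ U.toRight, w z = ∑ i ∈ U, Sum.elim (fun _ => 0) w i := by
  conv_rhs => rw [← Finset.toLeft_disjSum_toRight (u := U), Finset.sum_disjSum]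
  simp

theorem WtCond.extMul {w : V → ℤ} {c c' : ℤ} {t : Cech V A} (h : WtCond w c t)
    {α : V ⊕ V → Laurent V A} (hα : ∀ i, α i ∈ lwt A w (c' - Sum.elim (fun _ => 0) w i)) :
    WtCond w (c + c') (extMul rk α t) := by
  intro U
  rw [extMul_apply]
  refine sum_mem fun i hi => zsmul_mem (mul_mem_lwt (hα i) (h _) ?_) _
  rw [sum_toRight, sum_toRight, ← Finset.add_sum_erase U _ hi]
  ring

/-- The part of weight `0`. -/
def wtPart (w : V → ℤ) (t : Cech V A) : Cech V A :=
  fun U => lfilter (fun e => ∑ z, e z * w z = 0 - ∑ z ∈ U.toRight, w z) (t U)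

theorem wtCond_wtPart (w : V → ℤ) (t : Cech V A) : WtCond w 0 (wtPart w t) :=
  fun _ => lfilter_mem _ _

theorem wtPart_eq_self {w : V → ℤ} {t : Cech V A} (h : WtCond w 0 t) : wtPart w t = t :=
  funext fun U => lfilter_eq_self (h U)

theorem LocalCond.wtPart {w : V → ℤ} {t : Cech V A} (h : LocalCond t) : LocalCond (wtPart w t) :=
  fun U => lfilter_mem_of_mem (h U)

theorem extMul_wtPart {w : V → ℤ} {α : V ⊕ V → Laurent V A}
    (hα : ∀ i, α i ∈ lwt A w (0 - Sum.elim (fun _ => 0) w i)) (t : Cech V A) :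
    extMul rk α (wtPart w t) = wtPart w (extMul rk α t) := by
  funext U
  simp only [wtPart, extMul_apply, map_sum, map_zsmul]
  refine Finset.sum_congr rfl fun i hi => ?_
  congr 1
  refine (lfilter_mul (hα i) (fun e e' he => ?_) _).symm
  simp only [Pi.add_apply, add_mul, Finset.sum_add_distrib, he]
  rw [sum_toRight, sum_toRight, ← Finset.add_sum_erase U _ hi]
  constructor <;> intro h <;> linarith

/-- The 1-form `∑_{z ∈ B} ε_z + ∑ g_z dz`, where the `ε_z` are the Čech generators. -/
def cform (B : Finset V) (g : V → Laurent V A) : V ⊕ V → Laurent V A :=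
  Sum.elim (fun z => if z ∈ B then 1 else 0) g

/-- The components with Čech index contained in `B`. -/
def resTo (B : Finset V) (t : Cech V A) : Cech V A := fun U => if U.toLeft ⊆ B then t U else 0

theorem toLeft_erase_inl (U : Finset (V ⊕ V)) (z : V) :
    (U.erase (Sum.inl z)).toLeft = U.toLeft.erase z := by ext; simp
theorem toLeft_erase_inr (U : Finset (V ⊕ V)) (z : V) :
    (U.erase (Sum.inr z)).toLeft = U.toLeft := by ext; simp
theorem toLeft_insert_inr (U : Finset (V ⊕ V)) (z : V) :
    (insert (Sum.inr z) U).toLeft = U.toLeft := by ext; simp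
theorem toLeft_insert_inl (U : Finset (V ⊕ V)) (z : V) :
    (insert (Sum.inl z) U).toLeft = insert z U.toLeft := by ext; simp

/-- Multiplication only enlarges the Čech index, so discarding the indices not contained in `B`
commutes with it. Geometrically this is restriction to the part of the cover indexed by `B`. -/
theorem resTo_extMul (B : Finset V) {α α' : V ⊕ V → Laurent V A}
    (h : ∀ z ∈ B, α' (.inl z) = α (.inl z)) (h' : ∀ z ∉ B, α' (.inl z) = 0)
    (h'' : ∀ z, α' (.inr z) = α (.inr z)) (t : Cech V A) :
    resTo B (extMul rk α t) = extMul rk α' (resTo B t) := by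
  funext U
  simp only [resTo, extMul_apply]
  split_ifs with hU
  · refine Finset.sum_congr rfl fun i hi => ?_
    rw [if_pos ((Finset.toLeft_subset_toLeft (Finset.erase_subset _ _)).trans hU)]
    rcases i with z | z
    · rw [h z (hU (by simpa using hi))]
    · rw [h'']
  · refine (Finset.sum_eq_zero fun i hi => ?_).symm
    rcases i with z | z
    · by_cases hz : z ∈ B
      · rw [if_neg, mul_zero, smul_zero]
        rw [toLeft_erase_inl]
        intro h3
        refine hU fun x hx => ?_
        by_cases hxz : x = z
        · rwa [hxz]
        · exact h3 (Finset.mem_erase.2 ⟨hxz, hx⟩)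
      · rw [h' z hz, zero_mul, smul_zero]
    · rw [if_neg, mul_zero, smul_zero]
      rwa [toLeft_erase_inr]

theorem resTo_add (B : Finset V) (t t' : Cech V A) : resTo B (t + t') = resTo B t + resTo B t' := by
  funext U; simp only [resTo, Pi.add_apply]; split_ifs <;> simp

theorem resTo_sub (B : Finset V) (t t' : Cech V A) : resTo B (t - t') = resTo B t - resTo B t' := by
  funext U; simp only [resTo, Pi.sub_apply]; split_ifs <;> simp

theorem resTo_smul (B : Finset V) (a : Laurent V A) (t : Cech V A) :
    resTo B (a • t) = a • resTo B t := by
  funext U; simp only [resTo, Pi.smul_apply]; split_ifs <;> simp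

theorem LocalCond.resTo {t : Cech V A} (h : LocalCond t) (B : Finset V) : LocalCond (resTo B t) := by
  intro U
  unfold DworkCI.resTo
  split_ifs
  · exact h U
  · exact zero_mem _

theorem WtCond.resTo {w : V → ℤ} {c : ℤ} {t : Cech V A} (h : WtCond w c t) (B : Finset V) :
    WtCond w c (resTo B t) := by
  intro U
  unfold DworkCI.resTo
  split_ifs
  · exact h U
  · exact zero_mem _

theorem cform_mem_lneg (B : Finset V) {g : V → Laurent V A} (hg : ∀ z, g z ∈ lneg A ∅) (i : V ⊕ V) :
    cform B g i ∈ lneg A ({i} : Finset (V ⊕ V)).toLeft := by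
  rcases i with z | z
  · simp only [cform, Sum.elim_inl]
    split_ifs
    · exact one_mem_lneg _
    · exact zero_mem _
  · exact lneg_mono (Finset.empty_subset _) (hg z)

theorem cform_mem_lwt (B : Finset V) {w : V → ℤ} {g : V → Laurent V A}
    (hg : ∀ z, g z ∈ lwt A w (-w z)) (i : V ⊕ V) :
    cform B g i ∈ lwt A w (0 - Sum.elim (fun _ => 0) w i) := by
  rcases i with z | z
  · simp only [cform, Sum.elim_inl, sub_zero]
    split_ifs
    · exact one_mem_lwt
    · exact zero_mem _
  · simpa [cform] using hg z

/-- Exactness of the Čech direction. -/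
theorem exists_primitive_of_rows (hrk : Function.Injective rk) (B : Finset V) {g : V → Laurent V A}
    (hg : ∀ z, g z ∈ lneg A ∅) (t : Cech V A) (ht : LocalCond t) (htB : resTo B t = t)
    (hD : extMul rk (cform B g) t = 0)
    (hno : ∀ U e, U.toLeft = B → (t U).coeff e ≠ 0 → ∃ z ∈ B, 0 ≤ e z) :
    ∃ w : Cech V A, LocalCond w ∧ resTo B w = w ∧ extMul rk (cform B g) w = t := by
  classical
  let pick : (V → ℤ) → Option V := fun e =>
    if h : ∃ z ∈ B, 0 ≤ e z then some h.choose else none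
  have pick_spec : ∀ e z, pick e = some z → z ∈ B ∧ 0 ≤ e z := by
    intro e z h
    simp only [pick] at h
    split_ifs at h with h1
    · rw [Option.some.injEq] at h; rw [← h]; exact h1.choose_spec
  have pick_none : ∀ e, pick e = none → ¬ ∃ z ∈ B, 0 ≤ e z := by
    intro e h h1
    simp only [pick, dif_pos h1] at h
    exact absurd h (by simp)
  let part : V → Cech V A → Cech V A := fun z t U => lfilter (fun e => pick e = some z) (t U)
  have part_add : ∀ z t t', part z (t + t') = part z t + part z t' := by
    intro z t t'; funext U; simp [part]
  let s : Cech V A → Cech V A := fun t => ∑ z ∈ B, part z (anni rk (.inl z) t)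
  let ε : V ⊕ V → Laurent V A := cform B 0
  let γ : V ⊕ V → Laurent V A := Sum.elim 0 g
  have hform : cform B g = ε + γ := by
    funext i; rcases i with z | z <;> simp [cform, ε, γ]
  have hpart : ∀ z t, extMul rk ε (part z t) = part z (extMul rk ε t) := by
    intro z t
    funext U
    simp only [part, extMul_apply, map_sum, map_zsmul]
    refine Finset.sum_congr rfl fun i _ => ?_
    congr 1
    rcases i with x | x
    · simp only [ε, cform, Sum.elim_inl]; split_ifs <;> simp
    · simp [ε, cform]
  have hsε : ∀ t : Cech V A, (∀ U e, (t U).coeff e ≠ 0 → pick e ≠ none) →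
      extMul rk ε (s t) + s (extMul rk ε t) = t := by
    intro t hpk
    have h1 : ∀ z ∈ B, extMul rk ε (part z (anni rk (.inl z) t)) +
        part z (anni rk (.inl z) (extMul rk ε t)) = part z t := by
      intro z hz
      rw [hpart, ← part_add]
      congr 1
      have h2 := extMul_extContr hrk ε (Pi.single (Sum.inl z) 1) t
      have h3 : ∀ ω : Cech V A, extContr rk (Pi.single (Sum.inl z) 1) ω = anni rk (.inl z) ω := by
        intro ω
        rw [extContr_eq, Finset.sum_eq_single (Sum.inl z)]
        · simp
        · intro j _ h; simp [h]
        · simp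
      rw [h3, h3] at h2
      rw [h2, Finset.sum_eq_single (Sum.inl z)]
      · simp [ε, cform, hz]
      · intro j _ h; simp [h]
      · simp
    simp only [s, map_sum]
    rw [← Finset.sum_add_distrib, Finset.sum_congr rfl h1]
    funext U
    rw [Finset.sum_apply]
    ext e
    simp only [part, AddMonoidAlgebra.coeff_sum, Finsupp.finsetSum_apply, coeff_lfilter]
    by_cases h0 : (t U).coeff e = 0
    · simp [h0]
    · obtain ⟨z, hz⟩ := Option.ne_none_iff_exists'.1 (hpk U e h0)
      rw [Finset.sum_eq_single z]
      · simp [hz]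
      · intro x _ hx; rw [if_neg]; rw [hz]; simpa using hx.symm
      · intro h; exact absurd (pick_spec _ _ hz).1 h
  have s_coeff : ∀ t U e, (s t U).coeff e ≠ 0 → ∃ z ∈ B, 0 ≤ e z ∧ z ∉ U.toLeft ∧
      (t (insert (.inl z) U)).coeff e ≠ 0 := by
    intro t U e h
    simp only [s, part, Finset.sum_apply, AddMonoidAlgebra.coeff_sum, Finsupp.finsetSum_apply,
      coeff_lfilter] at h
    obtain ⟨z, hz, h1⟩ := Finset.exists_ne_zero_of_sum_ne_zero h
    have h2 : pick e = some z := by by_contra h3; exact h1 (if_neg h3)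
    rw [if_pos h2, anni_apply] at h1
    split_ifs at h1 with h3
    · exact absurd rfl h1
    · refine ⟨z, hz, (pick_spec _ _ h2).2, by simpa using h3, fun h4 => h1 ?_⟩
      have : ∀ (m : ℤ) (a : Laurent V A), a.coeff e = 0 → (m • a).coeff e = 0 := by
        intro m a ha
        rw [AddMonoidAlgebra.coeff_smul, Finsupp.smul_apply, ha, smul_zero]
      exact this _ _ h4
  have s_local : ∀ t, LocalCond t → LocalCond (s t) := by
    intro t ht U e he x hx
    obtain ⟨z, _, h1, h2, h3⟩ := s_coeff t U e he
    have := ht _ e h3 x hx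
    rw [toLeft_insert_inl, Finset.mem_insert] at this
    rcases this with h4 | h4
    · subst h4; omega
    · exact h4
  have res_iff : ∀ t : Cech V A, resTo B t = t ↔ ∀ U, ¬ U.toLeft ⊆ B → t U = 0 := by
    intro t
    constructor
    · intro h U hU; rw [← h]; exact if_neg hU
    · intro h; funext U; unfold resTo; split_ifs with h1
      · rfl
      · exact (h U h1).symm
  have s_zero : ∀ (t : Cech V A) (U), (∀ z ∈ B, z ∉ U.toLeft → t (insert (.inl z) U) = 0) →
      s t U = 0 := by
    intro t U h
    ext e
    by_contra h1
    obtain ⟨z, hz, _, h2, h3⟩ := s_coeff t U e h1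
    exact h3 (by rw [h z hz h2]; rfl)
  have s_res : ∀ t, resTo B t = t → resTo B (s t) = s t := by
    intro t ht
    rw [res_iff] at ht ⊢
    intro U hU
    refine s_zero t U fun z _ _ => ht _ fun h => hU ?_
    rw [toLeft_insert_inl] at h
    exact (Finset.subset_insert _ _).trans h
  have D_res : ∀ t : Cech V A, resTo B t = t →
      resTo B (extMul rk (cform B g) t) = extMul rk (cform B g) t := by
    intro t ht
    rw [resTo_extMul B (α' := cform B g) (fun _ _ => rfl) (fun z hz => by simp [cform, hz])
      (fun _ => rfl), ht]
  -- Induction on a bound for the Čech degree. The homotopy `s` is one for the Čech part `ε` alone,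
  -- and the remainder `t - D (s t) = -s (γ t) - γ (s t)` has smaller Čech degree, as `s` lowers it
  -- and `γ` preserves it.
  have key : ∀ m ≤ B.card + 1, ∀ t : Cech V A, LocalCond t → resTo B t = t →
      extMul rk (cform B g) t = 0 → (∀ U, m ≤ U.toLeft.card → t U = 0) →
      (∀ U e, U.toLeft = B → (t U).coeff e ≠ 0 → ∃ z ∈ B, 0 ≤ e z) →
      ∃ w : Cech V A, LocalCond w ∧ resTo B w = w ∧ extMul rk (cform B g) w = t := by
    intro m
    induction m with
    | zero =>
      intro _ t _ _ _ h0 _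
      refine ⟨0, fun U => zero_mem _, by funext U; simp [resTo], ?_⟩
      rw [map_zero]
      funext U; exact (h0 U (Nat.zero_le _)).symm
    | succ m ih =>
      intro hm t ht htB hD hsupp hno
      -- A monomial without chosen variable is negative along all of `B`. The local condition then
      -- forces the Čech index to be all of `B`, which `hno` excludes.
      have hpk : ∀ U e, (t U).coeff e ≠ 0 → pick e ≠ none := by
        intro U e h h1
        have h2 := pick_none e h1
        have h3 : B ⊆ U.toLeft := fun z hz => ht U e h z (by
          by_contra h4; exact h2 ⟨z, hz, by omega⟩)
        have h4 : U.toLeft ⊆ B := by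
          by_contra h5; exact h (by rw [(res_iff t).1 htB U h5]; rfl)
        exact h2 (hno U e (h4.antisymm h3) h)
      have e1 := hsε t hpk
      have hst : t - extMul rk (cform B g) (s t) = -(s (extMul rk γ t)) - extMul rk γ (s t) := by
        have h2 : extMul rk ε t = -extMul rk γ t := by
          rw [hform, extMul_add] at hD; exact eq_neg_of_add_eq_zero_left hD
        have hneg : s (-extMul rk γ t) = -s (extMul rk γ t) := by
          simp only [s, map_neg, ← Finset.sum_neg_distrib]
          refine Finset.sum_congr rfl fun z _ => ?_
          funext U; simp [part]
        rw [h2, hneg] at e1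
        rw [hform, extMul_add]
        nth_rewrite 1 [← e1]
        abel
      have hγ_supp : ∀ (t : Cech V A) (m : ℕ), (∀ U, m ≤ U.toLeft.card → t U = 0) →
          ∀ U, m ≤ U.toLeft.card → extMul rk γ t U = 0 := by
        intro t m h U hU
        rw [extMul_apply]
        refine Finset.sum_eq_zero fun i hi => ?_
        rcases i with z | z
        · simp [γ]
        · rw [h _ (by rwa [toLeft_erase_inr]), mul_zero, smul_zero]
      have hs_supp : ∀ (t : Cech V A) (m : ℕ), (∀ U, m + 1 ≤ U.toLeft.card → t U = 0) →
          ∀ U, m ≤ U.toLeft.card → s t U = 0 := by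
        intro t m h U hU
        refine s_zero t U fun z _ hz => h _ ?_
        rw [toLeft_insert_inl, Finset.card_insert_of_notMem hz]; omega
      have hsupp' : ∀ U, m ≤ U.toLeft.card → (t - extMul rk (cform B g) (s t)) U = 0 := by
        intro U hU
        rw [hst, Pi.sub_apply, Pi.neg_apply, hs_supp _ m (hγ_supp t _ hsupp) U hU,
          hγ_supp _ m (hs_supp t m hsupp) U hU]
        simp
      obtain ⟨w, hw1, hw2, hw3⟩ := ih (by omega) (t - extMul rk (cform B g) (s t))
        (ht.sub ((s_local t ht).extMul (cform_mem_lneg B hg)))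
        (by rw [resTo_sub, htB, D_res _ (s_res t htB)])
        (by rw [map_sub, hD, extMul_extMul_self hrk, sub_zero]) hsupp'
        (by
          intro U e hU h
          rw [hsupp' U (by rw [hU]; omega)] at h
          exact absurd rfl h)
      refine ⟨w + s t, hw1.add (s_local t ht), by rw [resTo_add, hw2, s_res t htB], ?_⟩
      rw [map_add, hw3]; abel
  refine key (B.card + 1) le_rfl t ht htB hD (fun U hU => ?_) hno
  by_contra h
  have : U.toLeft ⊆ B := by
    by_contra h5; exact h ((res_iff t).1 htB U h5)
  have := Finset.card_le_card this
  omega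

/-- Exactness of the de Rham direction on the part of the Čech complex where the coefficients of
the 1-form generate the unit ideal. -/
theorem exists_primitive_of_columns (hrk : Function.Injective rk) {g : V → Laurent V A}
    (hg : ∀ z, g z ∈ lneg A ∅) (P : Finset V → Prop) (hP : ∀ Z Z', Z ⊆ Z' → P Z → P Z')
    (hβ : ∀ Z, P Z → ∃ β : V → Laurent V A, (∀ z, β z ∈ lneg A Z) ∧ ∑ z, g z * β z = 1)
    (t : Cech V A) (ht : LocalCond t) (htP : ∀ U, ¬ P U.toLeft → t U = 0)
    (hD : extMul rk (cform Finset.univ g) t = 0) :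
    ∃ w : Cech V A, LocalCond w ∧ (∀ U, ¬ P U.toLeft → w U = 0) ∧
      extMul rk (cform Finset.univ g) w = t := by
  classical
  choose! β hβ1 hβ2 using hβ
  let b : Finset V → V ⊕ V → Laurent V A := fun Z => Sum.elim 0 (β Z)
  -- Contraction with the Bézout coefficients for the Čech index at hand. As these vary with the
  -- index, `h` is a homotopy for `γ` only and has no compatibility with `ε`.
  let h : Cech V A → Cech V A := fun t U => if P U.toLeft then extContr rk (b U.toLeft) t U else 0
  let ε : V ⊕ V → Laurent V A := cform Finset.univ 0
  let γ : V ⊕ V → Laurent V A := Sum.elim 0 g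
  have hform : cform Finset.univ g = ε + γ := by
    funext i; rcases i with z | z <;> simp [cform, ε, γ]
  have h_term : ∀ (Z : Finset V) (t : Cech V A) (U), extContr rk (b Z) t U =
      ∑ z, if Sum.inr z ∈ U then 0 else esgn rk U (.inr z) • (β Z z * t (insert (.inr z) U)) := by
    intro Z t U
    rw [extContr_eq, Finset.sum_apply, Fintype.sum_sum_type]
    simp only [b, Sum.elim_inl, Sum.elim_inr, Pi.zero_apply, Finset.sum_const_zero, zero_add,
      Pi.smul_apply, anni_apply, smul_eq_mul, mul_ite, mul_zero, mul_smul_comm, zero_mul, smul_zero,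
      ite_self]
  have h_supp : ∀ (t : Cech V A) (m : ℕ), (∀ U, U.toLeft.card < m → t U = 0) →
      ∀ U, U.toLeft.card < m → h t U = 0 := by
    intro t m ht U hU
    simp only [h]
    split_ifs
    · rw [h_term]
      refine Finset.sum_eq_zero fun z _ => ?_
      rw [ht _ (by rwa [toLeft_insert_inr])]; simp
    · rfl
  have ε_supp : ∀ (t : Cech V A) (m : ℕ), (∀ U, U.toLeft.card < m → t U = 0) →
      ∀ U, U.toLeft.card < m + 1 → extMul rk ε t U = 0 := by
    intro t m ht U hU
    rw [extMul_apply]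
    refine Finset.sum_eq_zero fun i hi => ?_
    rcases i with z | z
    · have hz : z ∈ U.toLeft := by simpa using hi
      rw [ht _ (by
        rw [toLeft_erase_inl, Finset.card_erase_of_mem hz]
        have := Finset.card_pos.2 ⟨z, hz⟩; omega), mul_zero, smul_zero]
    · simp [ε, cform]
  have h_local : ∀ t, LocalCond t → LocalCond (h t) := by
    intro t ht U
    simp only [h]
    split_ifs with hPU
    · rw [h_term]
      refine sum_mem fun z _ => ?_
      split_ifs
      · exact zero_mem _
      · have := ht (insert (.inr z) U)
        rw [toLeft_insert_inr] at this
        exact zsmul_mem (mul_mem_lneg (hβ1 _ hPU z) this subset_rfl subset_rfl) _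
    · exact zero_mem _
  have h_P : ∀ t U, ¬ P U.toLeft → h t U = 0 := fun t U hU => if_neg hU
  have D_P : ∀ t : Cech V A, (∀ U, ¬ P U.toLeft → t U = 0) → ∀ α : V ⊕ V → Laurent V A,
      ∀ U, ¬ P U.toLeft → extMul rk α t U = 0 := by
    intro t ht α U hU
    rw [extMul_apply]
    refine Finset.sum_eq_zero fun i _ => ?_
    rw [ht _ fun h3 => hU (hP _ _ (Finset.toLeft_subset_toLeft (Finset.erase_subset _ _)) h3),
      mul_zero, smul_zero]
  have hhom : ∀ t : Cech V A, (∀ U, ¬ P U.toLeft → t U = 0) →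
      extMul rk γ (h t) + h (extMul rk γ t) = t := by
    intro t htP
    funext U
    by_cases hPU : P U.toLeft
    · have h1 := congrFun (extMul_extContr hrk γ (b U.toLeft) t) U
      rw [Fintype.sum_sum_type] at h1
      simp only [γ, b, Sum.elim_inl, Sum.elim_inr, Pi.zero_apply, zero_mul, Finset.sum_const_zero,
        zero_add, hβ2 _ hPU, one_smul] at h1
      rw [← h1]
      simp only [Pi.add_apply]
      congr 1
      · rw [extMul_apply, extMul_apply]
        refine Finset.sum_congr rfl fun i _ => ?_
        rcases i with z | z
        · simp [γ]
        · simp only [h, toLeft_erase_inr, if_pos hPU, b, γ]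
      · simp only [h, if_pos hPU]; rfl
    · rw [htP U hPU, Pi.add_apply, h_P _ _ hPU, D_P _ (h_P t) _ _ hPU, add_zero]
  -- Here `t` lives in Čech degrees at least `j`. The remainder `t - D (h t) = -h (ε t) - ε (h t)`
  -- lives in degrees at least `j + 1`, and the process stops when `j` exceeds the number of
  -- variables.
  have key : ∀ m j, m + j = Fintype.card V + 1 → ∀ t : Cech V A, LocalCond t →
      (∀ U, ¬ P U.toLeft → t U = 0) → extMul rk (cform Finset.univ g) t = 0 →
      (∀ U, U.toLeft.card < j → t U = 0) →
      ∃ w : Cech V A, LocalCond w ∧ (∀ U, ¬ P U.toLeft → w U = 0) ∧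
        extMul rk (cform Finset.univ g) w = t := by
    intro m
    induction m with
    | zero =>
      intro j hj t _ _ _ h0
      refine ⟨0, fun U => zero_mem _, fun _ _ => rfl, ?_⟩
      rw [map_zero]
      funext U
      exact (h0 U (by have := Finset.card_le_univ U.toLeft; omega)).symm
    | succ m ih =>
      intro j hj t ht htP hD hsupp
      have hst : t - extMul rk (cform Finset.univ g) (h t) =
          -(h (extMul rk ε t)) - extMul rk ε (h t) := by
        have h2 : extMul rk γ t = -extMul rk ε t := by
          rw [hform, extMul_add] at hD; exact eq_neg_of_add_eq_zero_right hD
        have hneg : h (-extMul rk ε t) = -h (extMul rk ε t) := by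
          funext U; simp only [h, map_neg, Pi.neg_apply]; split_ifs <;> simp
        have e1 := hhom t htP
        rw [h2, hneg] at e1
        rw [hform, extMul_add]
        nth_rewrite 1 [← e1]
        abel
      have hsupp' : ∀ U, U.toLeft.card < j + 1 →
          (t - extMul rk (cform Finset.univ g) (h t)) U = 0 := by
        intro U hU
        rw [hst, Pi.sub_apply, Pi.neg_apply, h_supp _ _ (ε_supp t j hsupp) U hU,
          ε_supp _ _ (h_supp t j hsupp) U hU]
        simp
      obtain ⟨w, hw1, hw2, hw3⟩ := ih (j + 1) (by omega)
        (t - extMul rk (cform Finset.univ g) (h t))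
        (ht.sub ((h_local t ht).extMul (cform_mem_lneg _ hg)))
        (fun U hU => by rw [Pi.sub_apply, htP U hU, D_P _ (h_P t) _ _ hU, sub_zero])
        (by rw [map_sub, hD, extMul_extMul_self hrk, sub_zero]) hsupp'
      refine ⟨w + h t, hw1.add (h_local t ht), fun U hU => ?_, ?_⟩
      · rw [Pi.add_apply, hw2 U hU, h_P _ _ hU, add_zero]
      · rw [map_add, hw3]; abel
  exact key (Fintype.card V + 1) 0 rfl t ht htP hD (fun U hU => absurd hU (Nat.not_lt_zero _))

end Cech

/-! ### The weight zero part of the Koszul complex of `∑ y_j f_j` -/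

section Koszul

variable {n r : ℕ}

/-- The position of a variable in the order `x_0 < ⋯ < x_n < y_1 < ⋯ < y_r`. -/
def vrk : Var n r → ℕ := Sum.elim (fun i => i.val) (fun j => n + 1 + j.val)

theorem vrk_injective : Function.Injective (vrk : Var n r → ℕ) := by
  rintro (i | i) (j | j) h
  · exact congrArg _ (Fin.ext h)
  · have := i.2; simp [vrk] at h; omega
  · have := j.2; simp [vrk] at h; omega
  · simp only [vrk, Sum.elim_inr, Nat.add_left_cancel_iff] at h; exact congrArg _ (Fin.ext h)

theorem sgn_eq_esgn (S : Finset (Var n r)) (i : Var n r) : sgn S i = esgn vrk S i := by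
  unfold sgn esgn
  congr 2
  refine Finset.filter_congr fun j _ => ?_
  rcases i with i | i <;> rcases j with j | j
  · simp [vrk]
  · have := i.2; simp [vrk]; omega
  · have := j.2; simp [vrk]; omega
  · simp [vrk]

/-- Positions of the Čech generators and of the differentials. -/
def crk : Var n r ⊕ Var n r → ℕ := Sum.elim (fun z => 2 * vrk z) (fun z => 2 * vrk z + 1)

theorem crk_injective : Function.Injective (crk : Var n r ⊕ Var n r → ℕ) := by
  rintro (i | i) (j | j) h <;> simp only [crk, Sum.elim_inl, Sum.elim_inr] at h
  · exact congrArg _ (vrk_injective (by omega))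
  · omega
  · omega
  · exact congrArg _ (vrk_injective (by omega))

/-- The form `1`. -/
def unitForm {ι R : Type*} [DecidableEq ι] [CommRing R] : Finset ι → R :=
  fun S => if S = ∅ then 1 else 0

variable {A : Type*} [CommRing A]

/-- The components without Čech index. -/
def bottom (t : Cech (Var n r) A) : Finset (Var n r) → Laurent (Var n r) A :=
  fun S => t ((∅ : Finset (Var n r)).disjSum S)

/-- A form as a Čech cochain without Čech index. -/
def toCech (z : Finset (Var n r) → Laurent (Var n r) A) : Cech (Var n r) A :=
  fun U => if U.toLeft = ∅ then z U.toRight else 0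

theorem bottom_toCech (z : Finset (Var n r) → Laurent (Var n r) A) : bottom (toCech z) = z := by
  funext S; simp [bottom, toCech, -Finset.empty_disjSum]

theorem esgn_crk (S : Finset (Var n r)) (z : Var n r) :
    esgn crk ((∅ : Finset (Var n r)).disjSum S) (.inr z) = esgn vrk S z := by
  unfold esgn
  congr 1
  rw [Finset.empty_disjSum, Finset.filter_map, Finset.card_map]
  congr 1
  refine Finset.filter_congr fun j _ => ?_
  simp [crk]

theorem bottom_extMul (α : Var n r ⊕ Var n r → Laurent (Var n r) A) (t : Cech (Var n r) A) :
    bottom (extMul crk α t) = extMul vrk (fun z => α (.inr z)) (bottom t) := by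
  funext S
  unfold bottom
  rw [extMul_apply, extMul_apply, Finset.sum_disjSum, Finset.sum_empty, zero_add]
  refine Finset.sum_congr rfl fun z hz => ?_
  rw [esgn_crk]
  congr 3
  ext x
  rcases x with x | x <;> simp

theorem bottom_crea (z : Var n r) (t : Cech (Var n r) A) :
    bottom (crea crk (.inr z) t) = crea vrk z (bottom t) := by
  rw [← extMul_single, bottom_extMul, ← extMul_single]
  congr 2
  funext x
  by_cases h : x = z
  · subst h; simp
  · simp [h]

theorem extMul_toCech (a : Var n r → Laurent (Var n r) A)
    (z : Finset (Var n r) → Laurent (Var n r) A) :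
    extMul crk (Sum.elim 0 a) (toCech z) = toCech (extMul vrk a z) := by
  funext U
  by_cases hU : U.toLeft = ∅
  · have h1 := congrFun (bottom_extMul (Sum.elim 0 a) (toCech z)) U.toRight
    rw [bottom_toCech] at h1
    simp only [Sum.elim_inr] at h1
    rw [toCech, if_pos hU, ← h1]
    unfold bottom
    rw [← hU, Finset.toLeft_disjSum_toRight]
  · rw [extMul_apply]
    simp only [toCech]
    rw [if_neg hU]
    refine Finset.sum_eq_zero fun i _ => ?_
    rcases i with x | x
    · simp
    · rw [toLeft_erase_inr, if_neg hU, mul_zero, smul_zero]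

/-- The set of all `x_i`. -/
def xset : Finset (Var n r) := Finset.univ.disjSum ∅
/-- The set of all `y_j`. -/
def yset : Finset (Var n r) := (∅ : Finset (Fin (n + 1))).disjSum Finset.univ

/-- Weight zero with the contributions of `x` and of `y` on opposite sides. In the local cohomology
groups the two sides have opposite signs, hence both vanish. -/
theorem weight_relation {d : Fin r → ℕ} {t : Cech (Var n r) A} (ht : WtCond (wt d) 0 t)
    {U : Finset (Var n r ⊕ Var n r)} {e : Var n r → ℤ} (h : (t U).coeff e ≠ 0) :
    ∑ i, (e (.inl i) + if Sum.inr (Sum.inl i) ∈ U then 1 else 0) =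
      ∑ j, (d j : ℤ) * (e (.inr j) + if Sum.inr (Sum.inr j) ∈ U then 1 else 0) := by
  have h1 := ht U e h
  have h2 : ∑ z ∈ U.toRight, wt d z = ∑ z, (if Sum.inr z ∈ U then 1 else 0) * wt d z := by
    simp only [ite_mul, one_mul, zero_mul]
    rw [← Finset.sum_filter]
    refine Finset.sum_congr ?_ fun _ _ => rfl
    ext z; simp
  rw [h2, Fintype.sum_sum_type, Fintype.sum_sum_type] at h1
  simp only [wt, Sum.elim_inl, Sum.elim_inr, mul_one, mul_neg, Finset.sum_neg_distrib] at h1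
  simp only [mul_add, Finset.sum_add_distrib]
  simp only [mul_comm (d _ : ℤ)]
  linarith

variable (A) in
/-- The Laurent monomial `y_j`. -/
def yL (j : Fin r) : Laurent (Var n r) A := .single (Pi.single (Sum.inr j) 1) 1
variable (A) in
/-- The Laurent monomial `y_j⁻¹`. -/
def yInv (j : Fin r) : Laurent (Var n r) A := .single (Pi.single (Sum.inr j) (-1)) 1

theorem yL_mul_yInv (j : Fin r) : (yL A j : Laurent (Var n r) A) * yInv A j = 1 := by
  rw [yL, yInv, AddMonoidAlgebra.single_mul_single, ← Pi.single_add, AddMonoidAlgebra.one_def]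
  simp

variable (f : Fin r → Laurent (Var n r) A) (q : Fin r → Fin (n + 1) → Laurent (Var n r) A)

/-- The coefficients of `∑_j (f_j dy_j + y_j ∑_i q_{j,i} dx_i)`. -/
def kosForm : Var n r → Laurent (Var n r) A := Sum.elim (fun i => ∑ j, yL A j * q j i) f

/-- The form `∏_{j ∈ l} q_j dy_j`, for `q_j = ∑ i, q_{j,i} dx_i`. -/
def kosTop (l : List (Fin r)) : Finset (Var n r) → Laurent (Var n r) A :=
  l.foldr (fun j ω => extMul vrk (Sum.elim (q j) 0) (crea vrk (.inr j) ω)) unitForm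

/-- The 1-form `q_j + y_j⁻¹ ε_{y_j}`. -/
def kosMu (j : Fin r) : Var n r ⊕ Var n r → Laurent (Var n r) A :=
  Sum.elim (fun z => if z = .inr j then yInv A j else 0) (Sum.elim (q j) 0)

/-- A Čech cocycle with bottom component `kosTop`. -/
def kosCech (l : List (Fin r)) : Cech (Var n r) A :=
  l.foldr (fun j t => extMul crk (kosMu q j) (crea crk (.inr (.inr j)) t)) unitForm

theorem bottom_kosCech (l : List (Fin r)) : bottom (kosCech q l) = kosTop q l := by
  induction l with
  | nil => funext S; simp [kosCech, kosTop, unitForm, bottom]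
  | cons j l ih =>
    simp only [kosCech, kosTop, List.foldr_cons] at ih ⊢
    rw [bottom_extMul, bottom_crea, ih]
    rfl

theorem single_mem_lneg (Z : Finset (Var n r)) (z : Var n r) (c : ℤ) (h : c < 0 → z ∈ Z) (a : A) :
    (AddMonoidAlgebra.single (Pi.single z c) a : Laurent (Var n r) A) ∈ lneg A Z := by
  refine single_mem_lsupp (fun x hx => ?_) _
  by_cases hxz : x = z
  · subst hxz; exact h (by simpa using hx)
  · simp [hxz] at hx

theorem single_mem_lwt (w : Var n r → ℤ) (z : Var n r) (c : ℤ) (a : A) :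
    (AddMonoidAlgebra.single (Pi.single z c) a : Laurent (Var n r) A) ∈ lwt A w (c * w z) := by
  refine single_mem_lsupp ?_ _
  rw [Finset.sum_eq_single z]
  · simp
  · intro x _ hx; simp [hx]
  · simp

variable {f q} {d : Fin r → ℕ}

theorem kosMu_mem_lneg (hq : ∀ j i, q j i ∈ lneg A ∅) (j : Fin r) (i : Var n r ⊕ Var n r) :
    kosMu q j i ∈ lneg A ({i} : Finset (Var n r ⊕ Var n r)).toLeft := by
  rcases i with z | i | i
  · simp only [kosMu, Sum.elim_inl]
    split_ifs with h
    · subst h; exact single_mem_lneg _ _ _ (by simp) _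
    · exact zero_mem _
  · exact lneg_mono (Finset.empty_subset _) (hq j i)
  · exact zero_mem _

theorem kosMu_mem_lwt (hq : ∀ j i, q j i ∈ lwt A (wt d) (d j - 1)) (j : Fin r)
    (i : Var n r ⊕ Var n r) :
    kosMu q j i ∈ lwt A (wt d) (d j - Sum.elim (fun _ => 0) (wt d) i) := by
  rcases i with z | i | i
  · simp only [kosMu, Sum.elim_inl]
    split_ifs with h
    · have := single_mem_lwt (wt d) (.inr j : Var n r) (-1) (1 : A)
      simpa [wt, yInv] using this
    · exact zero_mem _
  · exact hq j i
  · exact zero_mem _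

theorem single_one_mem (i : Var n r ⊕ Var n r) (z : Var n r) :
    (Pi.single (.inr z) 1 : Var n r ⊕ Var n r → Laurent (Var n r) A) i ∈
      lneg A ({i} : Finset (Var n r ⊕ Var n r)).toLeft := by
  by_cases h : i = .inr z
  · subst h; simpa using one_mem_lneg _
  · simp [h]

theorem single_one_mem_lwt (w : Var n r → ℤ) (i : Var n r ⊕ Var n r) (z : Var n r) :
    (Pi.single (.inr z) 1 : Var n r ⊕ Var n r → Laurent (Var n r) A) i ∈
      lwt A w (w z - Sum.elim (fun _ => 0) w i) := by
  by_cases h : i = .inr z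
  · subst h; simpa using one_mem_lwt
  · simp [h]

theorem localCond_kosCech (hq : ∀ j i, q j i ∈ lneg A ∅) (l : List (Fin r)) :
    LocalCond (kosCech q l) := by
  induction l with
  | nil =>
    intro U
    simp only [kosCech, unitForm, List.foldr_nil]
    split_ifs
    · exact one_mem_lneg _
    · exact zero_mem _
  | cons j l ih =>
    simp only [kosCech, List.foldr_cons] at ih ⊢
    rw [← extMul_single]
    exact (ih.extMul fun i => single_one_mem i _).extMul (kosMu_mem_lneg hq j)

theorem wtCond_kosCech (hq : ∀ j i, q j i ∈ lwt A (wt d) (d j - 1)) (l : List (Fin r)) :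
    WtCond (wt d) 0 (kosCech q l) := by
  induction l with
  | nil =>
    intro U
    simp only [kosCech, unitForm, List.foldr_nil]
    split_ifs with h
    · subst h
      rw [show (∅ : Finset (Var n r ⊕ Var n r)).toRight = ∅ by ext; simp]
      simpa using one_mem_lwt
    · exact zero_mem _
  | cons j l ih =>
    simp only [kosCech, List.foldr_cons] at ih ⊢
    rw [← extMul_single]
    have := (ih.extMul (rk := crk) fun i => single_one_mem_lwt (wt d) i (.inr j)).extMul (rk := crk)
      (kosMu_mem_lwt hq j)
    simpa [wt] using this

theorem resTo_kosCech (l : List (Fin r)) : resTo yset (kosCech q l) = kosCech q l := by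
  induction l with
  | nil =>
    funext U
    simp only [kosCech, unitForm, List.foldr_nil, resTo]
    by_cases h : U = ∅
    · subst h
      rw [show (∅ : Finset (Var n r ⊕ Var n r)).toLeft = ∅ by ext; simp]
      simp
    · simp [h]
  | cons j l ih =>
    simp only [kosCech, List.foldr_cons] at ih ⊢
    rw [resTo_extMul yset (α' := kosMu q j) (fun _ _ => rfl) ?_ (fun _ => rfl), ← extMul_single,
      resTo_extMul yset (α' := Pi.single (.inr (.inr j)) 1) (fun _ _ => rfl) ?_ (fun _ => rfl), ih]
    · intro z _; simp
    · intro z hz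
      simp only [kosMu, Sum.elim_inl]
      rw [if_neg]
      rintro rfl
      exact hz (by simp [yset])

theorem hasDeg_unitForm {ι R : Type*} [DecidableEq ι] [CommRing R] :
    HasDeg 0 (unitForm : Finset ι → R) := by
  intro S hS; exact if_neg fun h => hS (by simp [h])

theorem hasDeg_kosTop (l : List (Fin r)) : HasDeg (2 * l.length) (kosTop q l) := by
  induction l with
  | nil => exact hasDeg_unitForm
  | cons j l ih =>
    simp only [kosTop, List.foldr_cons] at ih ⊢
    rw [← extMul_single]
    exact (ih.extMul _).extMul _

theorem kosForm_split (f : Fin r → Laurent (Var n r) A)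
    (q : Fin r → Fin (n + 1) → Laurent (Var n r) A) :
    cform yset (kosForm f q) = ∑ j, ((yL A j : Laurent (Var n r) A) • kosMu q j +
      f j • (Pi.single (.inr (.inr j)) 1 : Var n r ⊕ Var n r → Laurent (Var n r) A)) := by
  funext i
  rw [Finset.sum_apply]
  simp only [Pi.add_apply, Pi.smul_apply, smul_eq_mul]
  rcases i with (i | i) | (i | i)
  · simp [cform, yset, kosMu]
  · rw [Finset.sum_eq_single i]
    · simp [cform, yset, kosMu, yL_mul_yInv]
    · intro j _ hj; simp [kosMu, hj.symm]
    · simp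
  · simp [cform, kosForm, kosMu]
  · rw [Finset.sum_eq_single i]
    · simp [cform, kosForm, kosMu]
    · intro j _ hj; simp [kosMu, hj.symm]
    · simp

theorem extMul_sum {ι R κ : Type*} [DecidableEq ι] [Fintype ι] [CommRing R] {rk : ι → ℕ}
    (s : Finset κ) (α : κ → ι → R) (ω : Finset ι → R) :
    extMul rk (∑ j ∈ s, α j) ω = ∑ j ∈ s, extMul rk (α j) ω := by
  classical
  induction s using Finset.induction_on with
  | empty => simp [extMul_zero]
  | insert a s ha ih => rw [Finset.sum_insert ha, Finset.sum_insert ha, extMul_add, ih]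

/-- By `kosForm_split` the 1-form is `∑ y_j μ_j + f_j dy_j` with `μ_j = q_j + y_j⁻¹ ε_j`. Both `μ_j`
and `dy_j` are factors of the product, so each of them annihilates it. -/
theorem extMul_kosCech (f : Fin r → Laurent (Var n r) A)
    (q : Fin r → Fin (n + 1) → Laurent (Var n r) A) :
    extMul crk (cform yset (kosForm f q)) (kosCech q (List.finRange r)) = 0 := by
  rw [kosForm_split, extMul_sum]
  refine Finset.sum_eq_zero fun j _ => ?_
  have key : ∀ l : List (Fin r), j ∈ l →
      extMul crk (kosMu q j) (kosCech q l) = 0 ∧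
      extMul crk (Pi.single (.inr (.inr j)) 1) (kosCech q l) = 0 := by
    intro l
    induction l with
    | nil => simp
    | cons i l ih =>
      intro hj
      have hc : kosCech q (i :: l) =
          extMul crk (kosMu q i) (extMul crk (Pi.single (.inr (.inr i)) 1) (kosCech q l)) := by
        rw [extMul_single]; rfl
      rw [hc]
      by_cases h : j = i
      · subst h
        refine ⟨extMul_extMul_self crk_injective _ _, ?_⟩
        rw [extMul_extMul crk_injective, extMul_extMul_self crk_injective, map_zero, neg_zero]
      · obtain ⟨h1, h2⟩ := ih ((List.mem_cons.1 hj).resolve_left h)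
        constructor
        · rw [extMul_extMul crk_injective, extMul_extMul crk_injective (kosMu q j), h1]; simp
        · rw [extMul_extMul crk_injective, extMul_extMul crk_injective (Pi.single _ _) (Pi.single _ _),
            h2]; simp
  obtain ⟨h1, h2⟩ := key _ (List.mem_finRange j)
  rw [extMul_add, extMul_smul, extMul_smul, h1, h2]; simp

/-- At the top index only the Čech parts `y_j⁻¹ ε_j` of the factors contribute. The coefficient is
therefore a monomial up to sign, and a multiple of `kosCech` can cancel any obstruction at this
index. -/
theorem kosCech_top (l : List (Fin r)) (hl : l.Nodup) :
    ∃ u : ℤ, u * u = 1 ∧ kosCech q l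
      ((l.toFinset.map Function.Embedding.inr : Finset (Var n r)).disjSum
        (l.toFinset.map Function.Embedding.inr)) =
      u • AddMonoidAlgebra.single
        (Sum.elim 0 (fun j => if j ∈ l then -1 else 0) : Var n r → ℤ) (1 : A) := by
  induction l with
  | nil =>
    refine ⟨1, by simp, ?_⟩
    simp only [kosCech, List.foldr_nil, unitForm]
    rw [if_pos (by simp), one_smul, AddMonoidAlgebra.one_def]
    congr 1
    funext z; rcases z with z | z <;> simp
  | cons j l ih =>
    obtain ⟨u, hu, ih⟩ := ih (List.nodup_cons.1 hl).2
    have hj : j ∉ l := (List.nodup_cons.1 hl).1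
    have hc : kosCech q (j :: l) = extMul crk (kosMu q j) (crea crk (.inr (.inr j)) (kosCech q l)) := rfl
    set U : Finset (Var n r ⊕ Var n r) :=
      (((j :: l).toFinset.map Function.Embedding.inr : Finset (Var n r)).disjSum
        ((j :: l).toFinset.map Function.Embedding.inr)) with hU
    have hmem : (Sum.inl (Sum.inr j) : Var n r ⊕ Var n r) ∈ U := by simp [hU]
    have hmem2 : (Sum.inr (Sum.inr j) : Var n r ⊕ Var n r) ∈ U.erase (Sum.inl (Sum.inr j)) := by
      simp [hU]
    have hUe : (U.erase (Sum.inl (Sum.inr j))).erase (Sum.inr (Sum.inr j)) =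
        ((l.toFinset.map Function.Embedding.inr : Finset (Var n r)).disjSum
          (l.toFinset.map Function.Embedding.inr)) := by
      ext x
      rcases x with (x | x) | (x | x)
      · simp [hU]
      · by_cases h : x = j
        · subst h; simp [hU, hj]
        · simp [hU, h]
      · simp [hU]
      · by_cases h : x = j
        · subst h; simp [hU, hj]
        · simp [hU, h]
    refine ⟨esgn crk U (.inl (.inr j)) *
      (esgn crk (U.erase (Sum.inl (Sum.inr j))) (.inr (.inr j)) * u), ?_, ?_⟩
    · have h1 := esgn_mul_self (rk := crk) U (.inl (.inr j))
      have h2 := esgn_mul_self (rk := crk) (U.erase (Sum.inl (Sum.inr j))) (.inr (.inr j))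
      generalize esgn crk U (.inl (.inr j)) = a at *
      generalize esgn crk (U.erase (Sum.inl (Sum.inr j))) (.inr (.inr j)) = b at *
      calc a * (b * u) * (a * (b * u)) = (a * a) * ((b * b) * (u * u)) := by ring
        _ = 1 := by rw [h1, h2, hu]; norm_num
    · rw [hc, extMul_apply, Finset.sum_eq_single_of_mem _ hmem]
      · rw [crea_apply, if_pos hmem2, hUe, ih]
        simp only [kosMu, Sum.elim_inl, if_true, yInv, mul_smul_comm, smul_smul,
          AddMonoidAlgebra.single_mul_single, mul_one]
        congr 2
        funext z
        rcases z with z | z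
        · simp
        · by_cases h : z = j
          · subst h; simp [hj]
          · simp [h]
      · intro i hi hne
        rcases i with z | z | z
        · have : z ≠ Sum.inr j := fun h => hne (by rw [h])
          simp [kosMu, this]
        · simp [hU] at hi
        · simp [kosMu]

end Koszul

/-! ### Mayer–Vietoris for the loci `x ≠ 0` and `y ≠ 0` -/

section KoszulMain

variable {n r : ℕ} {A : Type*} [CommRing A]

theorem kosForm_mem_lneg {f : Fin r → Laurent (Var n r) A} {q : Fin r → Fin (n + 1) → Laurent (Var n r) A}
    (hf : ∀ j, f j ∈ lneg A ∅) (hq : ∀ j i, q j i ∈ lneg A ∅) (z : Var n r) :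
    kosForm f q z ∈ lneg A ∅ := by
  rcases z with i | j
  · change (∑ j, yL A j * q j i) ∈ _
    exact sum_mem fun j _ => mul_mem_lneg (single_mem_lneg ∅ _ 1 (by simp) 1) (hq j i)
      subset_rfl subset_rfl
  · exact hf j

theorem kosForm_mem_lwt {f : Fin r → Laurent (Var n r) A} {q : Fin r → Fin (n + 1) → Laurent (Var n r) A}
    {d : Fin r → ℕ} (hf : ∀ j, f j ∈ lwt A (wt d) (d j))
    (hq : ∀ j i, q j i ∈ lwt A (wt d) (d j - 1)) (z : Var n r) :
    kosForm f q z ∈ lwt A (wt d) (-wt d z) := by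
  rcases z with i | j
  · change (∑ j, yL A j * q j i) ∈ _
    exact sum_mem fun j _ => mul_mem_lwt (single_mem_lwt (wt d) (.inr j) 1 1) (hq j i)
      (by simp only [wt, Sum.elim_inl, Sum.elim_inr]; ring)
  · simpa [kosForm, wt] using hf j

/-- In `weight_relation` the left side is nonnegative because no `x_i` is inverted. The right side
is nonpositive, since a negative exponent of `y_j` stays nonpositive after adding `1` for `dy_j`. So
all terms vanish, and as `d_j > 0` this determines the exponents and forces every `dy_j` to occur.
-/
theorem wtCond_sub_kosCech_eq {d : Fin r → ℕ} (hd : ∀ j, 0 < d j) {t : Cech (Var n r) A}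
    (ht : WtCond (wt d) 0 t) {U : Finset (Var n r ⊕ Var n r)} {e : Var n r → ℤ}
    (hl : LocalCond t) (hU : U.toLeft = yset) (h : (t U).coeff e ≠ 0)
    (hneg : ∀ z ∈ (yset : Finset (Var n r)), e z < 0) :
    U = (yset : Finset (Var n r)).disjSum yset ∧ e = Sum.elim (0 : Fin (n + 1) → ℤ) (fun _ => -1) := by
  have h1 := weight_relation ht h
  have h2 : ∀ i, 0 ≤ e (.inl i) := by
    intro i; by_contra h3
    have := hl U e h (.inl i) (by omega)
    rw [hU] at this; simp [yset] at this
  have h3 : ∀ j, e (.inr j) < 0 := fun j => hneg _ (by simp [yset])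
  have hL : ∀ i ∈ Finset.univ, 0 ≤ e (.inl i) + if (Sum.inr (Sum.inl i) : Var n r ⊕ Var n r) ∈ U then 1 else 0 := by
    intro i _; have := h2 i; split_ifs <;> omega
  have hR : ∀ j ∈ Finset.univ, (d j : ℤ) *
      (e (.inr j) + if (Sum.inr (Sum.inr j) : Var n r ⊕ Var n r) ∈ U then 1 else 0) ≤ 0 := by
    intro j _; have := h3 j
    exact mul_nonpos_of_nonneg_of_nonpos (by positivity) (by split_ifs <;> omega)
  have hL0 := Finset.sum_nonneg hL
  have hR0 := Finset.sum_nonpos hR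
  have hL1 := (Finset.sum_eq_zero_iff_of_nonneg hL).1 (by omega)
  have hR1 := (Finset.sum_eq_zero_iff_of_nonpos hR).1 (by omega)
  have h5 : ∀ i, e (.inl i) = 0 ∧ (Sum.inr (Sum.inl i) : Var n r ⊕ Var n r) ∉ U := by
    intro i
    have h6 := hL1 i (Finset.mem_univ _)
    have h7 := h2 i
    split_ifs at h6 with h8
    · omega
    · exact ⟨by omega, h8⟩
  have h6 : ∀ j, e (.inr j) = -1 ∧ (Sum.inr (Sum.inr j) : Var n r ⊕ Var n r) ∈ U := by
    intro j
    have h6 := hR1 j (Finset.mem_univ _)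
    have h7 := h3 j
    have h9 := hd j
    have h10 := (mul_eq_zero.1 h6).resolve_left (by omega)
    split_ifs at h10 with h8
    · exact ⟨by omega, h8⟩
    · omega
  constructor
  · ext x
    rcases x with x | x | x
    · rw [Finset.inl_mem_disjSum, ← hU, Finset.mem_toLeft]
    · simp [(h5 x).2, yset]
    · simp [(h6 x).2, yset]
  · funext x
    rcases x with x | x
    · simp [(h5 x).1]
    · simp [(h6 x).1]

/-- Now the left side of `weight_relation` is nonpositive and the right side nonnegative. Vanishing
of the left side forces every `dx_i` to occur, in addition to the `n + 1` Čech generators. -/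
theorem card_of_toLeft_eq_xset {d : Fin r → ℕ} {t : Cech (Var n r) A}
    (ht : WtCond (wt d) 0 t) {U : Finset (Var n r ⊕ Var n r)} {e : Var n r → ℤ}
    (hl : LocalCond t) (hU : U.toLeft = xset) (h : (t U).coeff e ≠ 0)
    (hneg : ∀ z ∈ (xset : Finset (Var n r)), e z < 0) : 2 * (n + 1) ≤ U.card := by
  have h1 := weight_relation ht h
  have h2 : ∀ i, 0 ≤ e (.inr i) := by
    intro i; by_contra h3
    have := hl U e h (.inr i) (by omega)
    rw [hU] at this; simp [xset] at this
  have h3 : ∀ j, e (.inl j) < 0 := fun j => hneg _ (by simp [xset])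
  have hL : ∀ i ∈ Finset.univ, e (.inl i) + (if (Sum.inr (Sum.inl i) : Var n r ⊕ Var n r) ∈ U then 1 else 0) ≤ 0 := by
    intro i _; have := h3 i; split_ifs <;> omega
  have hR : ∀ j ∈ Finset.univ, 0 ≤ (d j : ℤ) *
      (e (.inr j) + if (Sum.inr (Sum.inr j) : Var n r ⊕ Var n r) ∈ U then 1 else 0) := by
    intro j _; have := h2 j
    exact mul_nonneg (by positivity) (by split_ifs <;> omega)
  have hL0 := Finset.sum_nonpos hL
  have hR0 := Finset.sum_nonneg hR
  have hL1 := (Finset.sum_eq_zero_iff_of_nonpos hL).1 (by omega)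
  have h4 : (xset : Finset (Var n r)).disjSum xset ⊆ U := by
    intro x hx
    rcases x with x | x | x
    · rw [Finset.inl_mem_disjSum, ← hU, Finset.mem_toLeft] at hx; exact hx
    · have h6 := hL1 x (Finset.mem_univ _)
      have h7 := h3 x
      split_ifs at h6 with h8
      · exact h8
      · omega
    · simp [xset] at hx
  have := Finset.card_le_card h4
  rw [Finset.card_disjSum] at this
  simp [xset] at this
  omega

theorem localCond_toCech {z : Finset (Var n r) → Laurent (Var n r) A} (h : ∀ S, z S ∈ lneg A ∅) :
    LocalCond (toCech z) := by
  intro U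
  unfold toCech
  split_ifs
  · exact lneg_mono (Finset.empty_subset _) (h _)
  · exact zero_mem _

theorem wtCond_toCech {w : Var n r → ℤ} {z : Finset (Var n r) → Laurent (Var n r) A}
    (h : ∀ S, z S ∈ lwt A w (0 - ∑ x ∈ S, w x)) : WtCond w 0 (toCech z) := by
  intro U
  unfold toCech
  split_ifs
  · exact h _
  · exact zero_mem _

theorem hasDeg_toCech {k : ℕ} {z : Finset (Var n r) → Laurent (Var n r) A} (h : HasDeg k z) :
    HasDeg k (toCech z) := by
  intro U hU
  unfold toCech
  split_ifs with h1
  · refine h _ ?_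
    have := Finset.card_toLeft_add_card_toRight (u := U)
    rw [h1] at this; simp at this; omega
  · rfl

theorem HasDeg.degPart {ι R : Type*} [DecidableEq ι] [CommRing R] {k : ℕ} (ω : Finset ι → R) :
    HasDeg k (degPart (k + 1) ω) := by
  intro S hS; exact if_neg (by omega)

theorem LocalCond.degPart {V : Type*} [Fintype V] [DecidableEq V] {t : Cech V A} (h : LocalCond t) (k : ℕ) :
    LocalCond (degPart k t) := by
  intro U
  unfold DworkCI.degPart
  split_ifs
  · exact h U
  · exact zero_mem _

theorem WtCond.degPart {V : Type*} [Fintype V] [DecidableEq V] {w : V → ℤ} {c : ℤ} {t : Cech V A}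
    (h : WtCond w c t) (k : ℕ) : WtCond w c (degPart k t) := by
  intro U
  unfold DworkCI.degPart
  split_ifs
  · exact h U
  · exact zero_mem _

theorem bottom_resTo (B : Finset (Var n r)) (t : Cech (Var n r) A) : bottom (resTo B t) = bottom t := by
  funext S; simp [bottom, resTo, -Finset.empty_disjSum]

theorem resTo_toCech (B : Finset (Var n r)) (z : Finset (Var n r) → Laurent (Var n r) A) :
    resTo B (toCech z) = toCech z := by
  funext U
  by_cases h : U.toLeft = ∅
  · simp [resTo, toCech, h]
  · simp [resTo, toCech, h]

theorem resTo_resTo (B : Finset (Var n r)) (t : Cech (Var n r) A) :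
    resTo B (resTo B t) = resTo B t := by
  funext U
  simp only [resTo]; split_ifs <;> rfl

/-- The cohomology of the weight zero part of the Koszul complex, in Laurent form. -/
theorem exists_laurent_primitive {f : Fin r → Laurent (Var n r) A}
    {q : Fin r → Fin (n + 1) → Laurent (Var n r) A} {d : Fin r → ℕ} (hr : r < n) (hd : ∀ j, 0 < d j)
    (hf1 : ∀ j, f j ∈ lneg A ∅) (hf2 : ∀ j, f j ∈ lwt A (wt d) (d j))
    (hq1 : ∀ j i, q j i ∈ lneg A ∅) (hq2 : ∀ j i, q j i ∈ lwt A (wt d) (d j - 1))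
    (hβ : ∀ i j, ∃ β : Var n r → Laurent (Var n r) A,
      (∀ z, β z ∈ lneg A {Sum.inl i, Sum.inr j}) ∧ ∑ z, kosForm f q z * β z = 1)
    {k : ℕ} (hk : k < n + r) (z : Finset (Var n r) → Laurent (Var n r) A)
    (hz1 : ∀ S, z S ∈ lneg A ∅) (hz2 : ∀ S, z S ∈ lwt A (wt d) (0 - ∑ x ∈ S, wt d x))
    (hz3 : HasDeg k z) (hz : extMul vrk (kosForm f q) z = 0) :
    ∃ (c : A) (ξ : Finset (Var n r) → Laurent (Var n r) A), (∀ S, ξ S ∈ lneg A ∅) ∧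
      (∀ S, ξ S ∈ lwt A (wt d) (0 - ∑ x ∈ S, wt d x)) ∧ (∀ S, S.card + 1 ≠ k → ξ S = 0) ∧
      (k ≠ 2 * r → c = 0) ∧
      z = algebraMap A (Laurent (Var n r) A) c • kosTop q (List.finRange r) +
        extMul vrk (kosForm f q) ξ := by
  have hinj := crk_injective (n := n) (r := r)
  set G := kosForm f q with hGdef
  have hG1 : ∀ z, G z ∈ lneg A ∅ := kosForm_mem_lneg hf1 hq1
  have hG2 : ∀ z, G z ∈ lwt A (wt d) (-wt d z) := kosForm_mem_lwt hf2 hq2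
  set Z := toCech z with hZ
  have hZl : LocalCond Z := localCond_toCech hz1
  have hZw : WtCond (wt d) 0 Z := wtCond_toCech hz2
  have hZd : HasDeg k Z := hasDeg_toCech hz3
  set εX : Var n r ⊕ Var n r → Laurent (Var n r) A := cform xset 0 with hεX
  set εY : Var n r ⊕ Var n r → Laurent (Var n r) A := cform yset 0 with hεY
  set Γ : Var n r ⊕ Var n r → Laurent (Var n r) A := Sum.elim 0 G with hΓ
  have hsplit : cform Finset.univ G = εX + εY + Γ := by
    funext i; rcases i with (i | i) | i <;> simp [cform, hεX, hεY, hΓ, xset, yset]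
  have hsplitX : cform xset G = εX + Γ := by
    funext i; rcases i with (i | i) | i <;> simp [cform, hεX, hΓ, xset]
  have hΓZ : extMul crk Γ Z = 0 := by
    rw [hΓ, hZ, extMul_toCech, hz]; funext U; simp [toCech]
  have h0l : ∀ z : Var n r, (0 : Var n r → Laurent (Var n r) A) z ∈ lneg A ∅ := fun _ => zero_mem _
  have h0w : ∀ z : Var n r, (0 : Var n r → Laurent (Var n r) A) z ∈ lwt A (wt d) (-wt d z) :=
    fun _ => zero_mem _
  have hXl : LocalCond (extMul crk εX Z) := hZl.extMul (cform_mem_lneg _ h0l)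
  have hXw : WtCond (wt d) 0 (extMul crk εX Z) := by
    simpa using hZw.extMul (rk := crk) (cform_mem_lwt xset h0w)
  -- The cochain `εX Z` fails to be a total cocycle only by `u`, whose Čech indices contain both an
  -- `x_i` and a `y_j`. There the gradient generates the unit ideal, and `u` is the boundary of some
  -- `t` with the same support.
  set u := extMul crk εX (extMul crk εY Z) with hu
  have hul : LocalCond u := (hZl.extMul (cform_mem_lneg _ h0l)).extMul (cform_mem_lneg _ h0l)
  have huw : WtCond (wt d) 0 u := by
    have := (hZw.extMul (rk := crk) (cform_mem_lwt yset h0w)).extMul (rk := crk) (cform_mem_lwt xset h0w)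
    simpa using this
  have hud : HasDeg (k + 1 + 1) u := (hZd.extMul _).extMul _
  have hDX : extMul crk (cform Finset.univ G) (extMul crk εX Z) = -u := by
    rw [extMul_extMul hinj, hsplit, extMul_add, extMul_add, hΓZ, add_zero, map_add,
      extMul_extMul_self hinj, zero_add]
  have hDu : extMul crk (cform Finset.univ G) u = 0 := by
    have := congrArg (extMul crk (cform Finset.univ G)) hDX
    rw [extMul_extMul_self hinj, map_neg] at this
    exact neg_eq_zero.1 this.symm
  let P : Finset (Var n r) → Prop := fun B => (∃ i, Sum.inl i ∈ B) ∧ ∃ j, Sum.inr j ∈ B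
  have hP : ∀ B B', B ⊆ B' → P B → P B' := fun B B' h ⟨⟨i, hi⟩, j, hj⟩ => ⟨⟨i, h hi⟩, j, h hj⟩
  have huP : ∀ U, ¬ P U.toLeft → u U = 0 := by
    intro U hU
    rw [hu, extMul_apply]
    refine Finset.sum_eq_zero fun i hi => ?_
    rcases i with (i | i) | i
    · rw [extMul_apply, Finset.sum_eq_zero, mul_zero, smul_zero]
      intro i' hi'
      rcases i' with (i' | i') | i'
      · simp [hεY, cform, yset]
      · exfalso
        refine hU ⟨⟨i, by simpa using hi⟩, i', ?_⟩
        simpa using Finset.mem_of_mem_erase hi'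
      · simp [hεY, cform]
    · simp [hεX, cform, xset]
    · simp [hεX, cform]
  have hβ' : ∀ B, P B → ∃ β : Var n r → Laurent (Var n r) A, (∀ z, β z ∈ lneg A B) ∧
      ∑ z, G z * β z = 1 := by
    rintro B ⟨⟨i, hi⟩, j, hj⟩
    obtain ⟨β, h1, h2⟩ := hβ i j
    refine ⟨β, fun z => lneg_mono ?_ (h1 z), h2⟩
    intro x hx
    rcases Finset.mem_insert.1 hx with h | h
    · rwa [h]
    · rw [Finset.mem_singleton.1 h]; exact hj
  obtain ⟨t0, ht0l, ht0P, ht0⟩ := exists_primitive_of_columns hinj hG1 P hP hβ' u hul huP hDu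
  set t := degPart (k + 1 + 1) (wtPart (wt d) t0) with ht
  have htl : LocalCond t := ht0l.wtPart.degPart _
  have htw : WtCond (wt d) 0 t := (wtCond_wtPart _ _).degPart _
  have htd : HasDeg (k + 1) t := HasDeg.degPart _
  have htP : ∀ U, ¬ P U.toLeft → t U = 0 := by
    intro U hU
    simp only [ht, degPart, wtPart, ht0P U hU, map_zero, ite_self]
  have hDt : extMul crk (cform Finset.univ G) t = u := by
    have h1 : extMul crk (cform Finset.univ G) (wtPart (wt d) t0) = u := by
      rw [extMul_wtPart (cform_mem_lwt _ hG2), ht0, wtPart_eq_self huw]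
    rw [ht, extMul_degPart (by rw [h1]; exact hud), h1]
  have hvd : HasDeg (k + 1) (extMul crk εX Z + t) := by
    intro S hS; rw [Pi.add_apply, (hZd.extMul _) S hS, htd S hS, add_zero]
  have hDv : extMul crk (cform Finset.univ G) (extMul crk εX Z + t) = 0 := by
    rw [map_add, hDX, hDt, neg_add_cancel]
  -- The full Čech index already has `n + 1 + r` elements, more than the total degree `k + 1`, so
  -- there is no obstruction at the origin.
  obtain ⟨w0, hw0l, _, hw0⟩ := exists_primitive_of_rows hinj Finset.univ hG1 _ (hXl.add htl)
    (by funext U; simp [resTo]) hDv (by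
      intro U e hU h
      exfalso
      rw [hvd U ?_] at h
      · exact h rfl
      · have := Finset.card_toLeft_add_card_toRight (u := U)
        rw [hU] at this; simp at this; omega)
  set w := degPart (k + 1) (wtPart (wt d) w0) with hw
  have hwl : LocalCond w := hw0l.wtPart.degPart _
  have hww : WtCond (wt d) 0 w := (wtCond_wtPart _ _).degPart _
  have hwd : HasDeg k w := HasDeg.degPart _
  have hDw : extMul crk (cform Finset.univ G) w = extMul crk εX Z + t := by
    have h1 : extMul crk (cform Finset.univ G) (wtPart (wt d) w0) = extMul crk εX Z + t := by
      rw [extMul_wtPart (cform_mem_lwt _ hG2), hw0, wtPart_eq_self (hXw.add htw)]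
    rw [hw, extMul_degPart (by rw [h1]; exact hvd), h1]
  -- As `t` vanishes on indices over `x` alone and over `y` alone, the restriction of `w` over `x`
  -- has the same boundary as `Z`, while its restriction over `y` is a cocycle.
  have hres : ∀ B, extMul crk (cform B G) (resTo B w) = resTo B (extMul crk εX Z + t) := by
    intro B
    rw [← hDw, resTo_extMul B (α := cform Finset.univ G) (α' := cform B G) (fun z hz => by simp [cform, hz])
      (fun z hz => by simp [cform, hz]) (fun z => rfl)]
  have htX : resTo xset t = 0 := by
    funext U
    simp only [resTo]
    split_ifs with h
    · exact htP U fun h1 => by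
        obtain ⟨j, hj⟩ := h1.2
        have := h hj; simp [xset] at this
    · rfl
  have htY : resTo yset t = 0 := by
    funext U
    simp only [resTo]
    split_ifs with h
    · exact htP U fun h1 => by
        obtain ⟨j, hj⟩ := h1.1
        have := h hj; simp [yset] at this
    · rfl
  -- the part over `x ≠ 0`
  have hDX1 : extMul crk (cform xset G) (resTo xset w - Z) = 0 := by
    rw [map_sub, hres, resTo_add, htX, add_zero, hsplitX, extMul_add, hΓZ, add_zero,
      resTo_extMul xset (α' := εX) (fun _ _ => rfl) (fun z hz => by simp [hεX, cform, hz])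
        (fun _ => rfl), resTo_toCech, sub_self]
  -- The obstruction along `x = 0` lives in degree at least `2(n + 1)`, and `k < n + r < 2(n + 1)`
  -- because `r < n`.
  obtain ⟨w1, hw1l, _, hw1⟩ := exists_primitive_of_rows hinj xset hG1 _ ((hwl.resTo xset).sub hZl)
    (by rw [resTo_sub, resTo_resTo, resTo_toCech]) hDX1 (by
      intro U e hU h
      by_contra hno
      have := card_of_toLeft_eq_xset ((hww.resTo xset).sub hZw) ((hwl.resTo xset).sub hZl) hU h
        (fun z hz => by by_contra h3; exact hno ⟨z, hz, by omega⟩)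
      rw [Pi.sub_apply, hZd U (by omega), sub_zero, resTo, if_pos hU.subset, hwd U (by omega)] at h
      exact h rfl)
  -- the part over `y ≠ 0`
  obtain ⟨σ, hσ, htop⟩ := kosCech_top (q := q) _ (List.nodup_finRange r)
  have hys : ((List.finRange r).toFinset.map Function.Embedding.inr : Finset (Var n r)) = yset := by
    ext x; rcases x with x | x <;> simp [yset]
  have hes : (Sum.elim (0 : Fin (n + 1) → ℤ) (fun j => if j ∈ List.finRange r then -1 else 0) : Var n r → ℤ) =
      Sum.elim (0 : Fin (n + 1) → ℤ) (fun _ => -1) := by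
    funext x; rcases x with x | x <;> simp
  rw [hys, hes] at htop
  set e0 : Var n r → ℤ := Sum.elim (0 : Fin (n + 1) → ℤ) (fun _ => -1) with he0
  set U0 : Finset (Var n r ⊕ Var n r) := yset.disjSum yset with hU0
  -- The only obstruction along `y = 0` is the coefficient of `∏ y_j⁻¹` at the index `U0`. The
  -- coefficient of `K` there is the sign `σ`, so this `c` removes it.
  set c : A := σ • (resTo yset w U0).coeff e0 with hc
  set K := kosCech q (List.finRange r) with hK
  have hwc : WtCond (wt d) 0 (algebraMap A (Laurent (Var n r) A) c • K) := by
    intro U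
    rw [Pi.smul_apply, algebraMap_smul]
    exact Submodule.smul_mem _ _ (wtCond_kosCech hq2 _ U)
  have hlc : LocalCond (algebraMap A (Laurent (Var n r) A) c • K) := by
    intro U
    rw [Pi.smul_apply, algebraMap_smul]
    exact Submodule.smul_mem _ _ (localCond_kosCech hq1 _ U)
  have hDY1 : extMul crk (cform yset G) (resTo yset w - algebraMap A (Laurent (Var n r) A) c • K) = 0 := by
    rw [map_sub, map_smul, hres, resTo_add, htY, add_zero, hGdef, extMul_kosCech, smul_zero, sub_zero,
      resTo_extMul yset (α := εX) (α' := 0) (fun z hz => ?_) (fun z hz => rfl) (fun _ => rfl), extMul_zero]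
    rcases z with z | z
    · simp [yset] at hz
    · simp [hεX, cform, xset]
  obtain ⟨w2, hw2l, _, hw2⟩ := exists_primitive_of_rows hinj yset hG1 _ ((hwl.resTo yset).sub hlc)
    (by rw [resTo_sub, resTo_resTo, resTo_smul, resTo_kosCech]) hDY1 (by
      intro U e hU h
      by_contra hno
      obtain ⟨h1, h2⟩ := wtCond_sub_kosCech_eq hd ((hww.resTo yset).sub hwc)
        ((hwl.resTo yset).sub hlc) hU h
        (fun z hz => by by_contra h3; exact hno ⟨z, hz, by omega⟩)
      apply h
      rw [h1, h2, Pi.sub_apply, Pi.smul_apply, algebraMap_smul, htop, AddMonoidAlgebra.coeff_sub,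
        Finsupp.sub_apply, AddMonoidAlgebra.coeff_smul_apply, AddMonoidAlgebra.coeff_smul,
        Finsupp.smul_apply, AddMonoidAlgebra.coeff_single, Finsupp.single_eq_same, hc]
      rw [smul_eq_mul, smul_mul_smul_comm, hσ, one_smul, mul_one]
      exact sub_self _)
  have hb1 := congrArg bottom hw1
  have hw1' : extMul crk (cform xset G) (wtPart (wt d) w1) = resTo xset w - Z := by
    rw [extMul_wtPart (cform_mem_lwt _ hG2), hw1, wtPart_eq_self ((hww.resTo xset).sub hZw)]
  have hw2' : extMul crk (cform yset G) (wtPart (wt d) w2) =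
      resTo yset w - algebraMap A (Laurent (Var n r) A) c • K := by
    rw [extMul_wtPart (cform_mem_lwt _ hG2), hw2, wtPart_eq_self ((hww.resTo yset).sub hwc)]
  have hbsub : ∀ t t' : Cech (Var n r) A, bottom (t - t') = bottom t - bottom t' := fun _ _ => rfl
  have hbsmul : ∀ (a : Laurent (Var n r) A) (t : Cech (Var n r) A), bottom (a • t) = a • bottom t := fun _ _ => rfl
  have hb1 := congrArg bottom hw1'
  have hb2 := congrArg bottom hw2'
  rw [bottom_extMul, hbsub, bottom_resTo, bottom_toCech] at hb1
  rw [bottom_extMul, hbsub, bottom_resTo, hbsmul, bottom_kosCech] at hb2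
  have hGr : ∀ B, (fun z => cform B G (Sum.inr z)) = G := fun B => rfl
  rw [hGr] at hb1 hb2
  -- The components of empty Čech index express the bottom of `w` once as `z` and once as `c` times
  -- `kosTop`, each up to a coboundary. Subtraction eliminates `w`.
  have hfin : z = algebraMap A (Laurent (Var n r) A) c • kosTop q (List.finRange r) +
      extMul vrk G (bottom (wtPart (wt d) w2) - bottom (wtPart (wt d) w1)) := by
    rw [map_sub, hb1, hb2]; abel
  have hcz : k ≠ 2 * r → c = 0 := by
    intro hk2
    rw [hc, resTo, if_pos (by simp [hU0]), hwd U0 (by simp [hU0, yset]; omega)]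
    simp
  refine ⟨c, degPart k (bottom (wtPart (wt d) w2) - bottom (wtPart (wt d) w1)), ?_, ?_, ?_, hcz, ?_⟩
  · intro S
    unfold degPart
    split_ifs
    · have h1 := hw1l.wtPart (w := wt d) ((∅ : Finset (Var n r)).disjSum S)
      have h2 := hw2l.wtPart (w := wt d) ((∅ : Finset (Var n r)).disjSum S)
      rw [Finset.toLeft_disjSum] at h1 h2
      exact sub_mem h2 h1
    · exact zero_mem _
  · intro S
    unfold degPart
    split_ifs
    · have h1 := wtCond_wtPart (wt d) w1 ((∅ : Finset (Var n r)).disjSum S)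
      have h2 := wtCond_wtPart (wt d) w2 ((∅ : Finset (Var n r)).disjSum S)
      rw [Finset.toRight_disjSum] at h1 h2
      exact sub_mem h2 h1
    · exact zero_mem _
  · intro S hS; exact if_neg hS
  · rw [extMul_degPart]
    · exact hfin
    · rw [← sub_eq_iff_eq_add'] at hfin
      rw [← hfin]
      intro S hS
      rw [Pi.sub_apply, hz3 S hS, Pi.smul_apply]
      by_cases hk2 : k = 2 * r
      · rw [hasDeg_kosTop _ S (by rw [List.length_finRange]; omega)]; simp
      · rw [hcz hk2]; simp

end KoszulMain

/-! ### Polynomial forms -/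

section PolyForms

variable {n r : ℕ}

section

variable {V A : Type*} [CommRing A]

/-- Exponents of monomials as exponents of Laurent monomials. -/
def castExp : (V →₀ ℕ) →+ (V → ℤ) where
  toFun m z := m z
  map_zero' := by funext z; simp
  map_add' m m' := by funext z; simp

theorem castExp_apply (m : V →₀ ℕ) (z : V) : castExp m z = m z := rfl

theorem castExp_injective : Function.Injective (castExp : (V →₀ ℕ) → (V → ℤ)) := by
  intro m m' h
  ext z
  have := congrFun h z
  rw [castExp_apply, castExp_apply] at this
  exact_mod_cast this

/-- Polynomials as Laurent polynomials. -/
def emb : MvPolynomial V A →+* Laurent V A := AddMonoidAlgebra.mapDomainRingHom A castExp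

theorem coeff_emb (p : MvPolynomial V A) (m : V →₀ ℕ) :
    (emb p).coeff (castExp m) = MvPolynomial.coeff m p :=
  Finsupp.mapDomain_apply castExp_injective _ _

theorem exists_castExp {p : MvPolynomial V A} {e : V → ℤ} (h : (emb p).coeff e ≠ 0) :
    ∃ m, castExp m = e ∧ MvPolynomial.coeff m p ≠ 0 := by
  obtain ⟨m, rfl⟩ := Finsupp.mem_range_of_mapDomain_ne_zero h
  exact ⟨m, rfl, by rwa [coeff_emb] at h⟩

theorem emb_mem_lneg (p : MvPolynomial V A) (Z : Finset V) : emb p ∈ lneg A Z := by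
  intro e he z hz
  obtain ⟨m, rfl, _⟩ := exists_castExp he
  rw [castExp_apply] at hz; omega

theorem emb_injective : Function.Injective (emb : MvPolynomial V A → Laurent V A) := by
  intro p p' h
  ext m
  rw [← coeff_emb, h, coeff_emb]

theorem exists_emb_eq [Finite V] {a : Laurent V A} (h : a ∈ lneg A ∅) : ∃ p, emb p = a := by
  refine ⟨AddMonoidAlgebra.comapDomain castExp castExp_injective a, ?_⟩
  refine AddMonoidAlgebra.mapDomain_comapDomain (fun e he => ?_) _
  have h1 := h e (Finsupp.mem_support_iff.1 he)
  refine ⟨Finsupp.equivFunOnFinite.symm fun z => (e z).toNat, ?_⟩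
  funext z
  rw [castExp_apply]
  have : ¬ e z < 0 := fun h2 => by simpa using h1 z h2
  simp; omega

theorem emb_C (c : A) : emb (MvPolynomial.C c : MvPolynomial V A) = algebraMap A (Laurent V A) c := by
  rw [MvPolynomial.C_apply]
  change AddMonoidAlgebra.mapDomain _ (AddMonoidAlgebra.single 0 c) = _
  rw [AddMonoidAlgebra.mapDomain_single]
  simp [AddMonoidAlgebra.coe_algebraMap]

theorem emb_monomial (m : V →₀ ℕ) (a : A) :
    emb (MvPolynomial.monomial m a) = AddMonoidAlgebra.single (castExp m) a :=
  AddMonoidAlgebra.mapDomain_single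

theorem emb_mem_lwt [Fintype V] {w : V → ℤ} {c : ℤ} {p : MvPolynomial V A}
    (h : ∀ m, MvPolynomial.coeff m p ≠ 0 → ∑ z, (m z : ℤ) * w z = c) : emb p ∈ lwt A w c := by
  intro e he
  obtain ⟨m, rfl, h1⟩ := exists_castExp he
  exact h m h1

end

variable {F : Type*} [Field F]

theorem pderiv_inr_totalPoly (f : Fin r → MvPolynomial (Fin (n + 1)) F) (j : Fin r) :
    MvPolynomial.pderiv (.inr j) (totalPoly f) = MvPolynomial.rename Sum.inl (f j) := by
  have h : ∀ i, MvPolynomial.pderiv (.inr j : Var n r) (MvPolynomial.rename Sum.inl (f i)) = 0 := by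
    intro i
    refine MvPolynomial.pderiv_eq_zero_of_notMem_vars fun h => ?_
    have := MvPolynomial.vars_rename _ _ h
    simp at this
  rw [totalPoly, map_sum, Finset.sum_eq_single j]
  · rw [MvPolynomial.pderiv_mul, h, mul_zero, add_zero, MvPolynomial.pderiv_X_self, one_mul]
  · intro i _ hi
    rw [MvPolynomial.pderiv_mul, h, mul_zero, add_zero, MvPolynomial.pderiv_X_of_ne (by simpa using hi),
      zero_mul]
  · simp

theorem pderiv_inl_totalPoly (f : Fin r → MvPolynomial (Fin (n + 1)) F) (i : Fin (n + 1)) :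
    MvPolynomial.pderiv (.inl i) (totalPoly f) =
      ∑ j, MvPolynomial.X (.inr j) * MvPolynomial.rename Sum.inl (MvPolynomial.pderiv i (f j)) := by
  rw [totalPoly, map_sum]
  refine Finset.sum_congr rfl fun j _ => ?_
  rw [MvPolynomial.pderiv_mul, MvPolynomial.pderiv_X_of_ne (by simp), zero_mul, zero_add,
    MvPolynomial.pderiv_rename Sum.inl_injective]

theorem coeff_totalPoly_add_single (f : Fin r → MvPolynomial (Fin (n + 1)) F) (j : Fin r)
    (m : Var n r →₀ ℕ) :
    MvPolynomial.coeff (m + Finsupp.single (.inr j) 1) (totalPoly f) =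
      MvPolynomial.coeff m (MvPolynomial.rename Sum.inl (f j)) := by
  rw [totalPoly, MvPolynomial.coeff_sum, Finset.sum_eq_single j]
  · rw [add_comm, MvPolynomial.coeff_X_mul]
  · intro i _ hi
    rw [MvPolynomial.coeff_X_mul']
    split_ifs with h
    · refine MvPolynomial.coeff_rename_eq_zero _ _ _ fun u hu => ?_
      exfalso
      have h1 := DFunLike.congr_fun hu (.inr j)
      rw [Finsupp.mapDomain_of_notMem_range _ _ (by simp)] at h1
      have hi' : (Sum.inr i : Var n r) ≠ .inr j := by simpa using hi
      simp [hi'] at h1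
    · rfl
  · simp

theorem weight_of_coeff_rename {A : Type*} [CommRing A] {d : Fin r → ℕ} {e : ℕ} {g : MvPolynomial (Fin (n + 1)) A}
    (hg : g.IsHomogeneous e) {m : Var n r →₀ ℕ}
    (h : MvPolynomial.coeff m (MvPolynomial.rename Sum.inl g) ≠ 0) :
    ∑ z, (m z : ℤ) * wt d z = e := by
  obtain ⟨u, rfl, hu⟩ := MvPolynomial.coeff_rename_ne_zero _ _ _ h
  have h1 := hg hu
  rw [Fintype.sum_sum_type]
  have h2 : ∀ j : Fin r, (Finsupp.mapDomain Sum.inl u : Var n r →₀ ℕ) (.inr j) = 0 := fun j =>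
    Finsupp.mapDomain_of_notMem_range _ _ (by simp)
  simp only [Finsupp.mapDomain_apply Sum.inl_injective, h2, wt, Sum.elim_inl, mul_one,
    Nat.cast_zero, zero_mul, Finset.sum_const_zero, add_zero]
  rw [← h1, Finsupp.weight_apply, Finsupp.sum_fintype _ _ (by simp)]
  simp

/-- At a common zero of the partial derivatives either `x = 0`, or all `f_j` vanish at `x` and `∑
y_j df_j = 0`, so that `y = 0` by the Jacobian criterion. Hence `x_i y_j` vanishes on the zero locus
and is in the radical. -/
theorem exists_pow_mem_span_pderiv (f : Fin r → MvPolynomial (Fin (n + 1)) F)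
    (hsmooth : IsSmoothCompleteIntersection f) (i : Fin (n + 1)) (j : Fin r) :
    ∃ N : ℕ, ∃ h : Var n r → MvPolynomial (Var n r) F,
      ∑ z, h z * MvPolynomial.pderiv z (totalPoly f) =
        (MvPolynomial.X (.inl i) * MvPolynomial.X (.inr j)) ^ N := by
  set I : Ideal (MvPolynomial (Var n r) F) :=
    Ideal.span (Set.range fun z => MvPolynomial.pderiv z (totalPoly f)) with hI
  have h1 : (MvPolynomial.X (.inl i) * MvPolynomial.X (.inr j) : MvPolynomial (Var n r) F) ∈
      I.radical := by
    rw [← MvPolynomial.vanishingIdeal_zeroLocus_eq_radical (K := AlgebraicClosure F)]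
    intro P hP
    have hP' : ∀ z, MvPolynomial.aeval P (MvPolynomial.pderiv z (totalPoly f)) = 0 :=
      fun z => hP _ (Ideal.subset_span ⟨z, rfl⟩)
    rw [map_mul, MvPolynomial.aeval_X, MvPolynomial.aeval_X]
    by_cases hx : P (.inl i) = 0
    · rw [hx, zero_mul]
    · have hx' : P ∘ Sum.inl ≠ 0 := fun h => hx (congrFun h i)
      have hli := hsmooth (P ∘ Sum.inl) hx' (fun j => by
        have := hP' (.inr j)
        rwa [pderiv_inr_totalPoly, MvPolynomial.aeval_rename] at this)
      rw [Fintype.linearIndependent_iff] at hli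
      rw [hli (fun j => P (.inr j)) ?_ j, mul_zero]
      funext i
      have := hP' (.inl i)
      rw [pderiv_inl_totalPoly, map_sum] at this
      simpa [MvPolynomial.aeval_rename] using this
  obtain ⟨N, hN⟩ := h1
  obtain ⟨h, hh⟩ := Ideal.mem_span_range_iff_exists_fun.1 hN
  exact ⟨N, h, hh⟩

variable {A : Type*} [CommRing A] (t : F →+* A)

/-- The form `∏_{j ∈ l} d f_j dy_j` with coefficients mapped to `A`. -/
def polyTop (f : Fin r → MvPolynomial (Fin (n + 1)) F) (l : List (Fin r)) :
    Finset (Var n r) → MvPolynomial (Var n r) A :=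
  l.foldr (fun j ω => extMul vrk (Sum.elim (fun i => MvPolynomial.map t
    (MvPolynomial.rename Sum.inl (MvPolynomial.pderiv i (f j)))) 0) (crea vrk (.inr j) ω)) unitForm

/-- The gradient of `∑ y_j f_j`, mapped to `A`. -/
def polyGrad (f : Fin r → MvPolynomial (Fin (n + 1)) F) (z : Var n r) : MvPolynomial (Var n r) A :=
  MvPolynomial.map t (MvPolynomial.pderiv z (totalPoly f))

/-- The weight zero part of the Koszul complex of `d (∑ y_j f_j)` is exact below degree `n + r`,
except in degree `2 r`, where the cohomology is generated by the class of `∏ df_j dy_j`. -/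
theorem exists_poly_primitive (f : Fin r → MvPolynomial (Fin (n + 1)) F) (d : Fin r → ℕ)
    (hr : r < n) (hd : ∀ j, 0 < d j) (hf : ∀ j, (f j).IsHomogeneous (d j))
    (hsmooth : IsSmoothCompleteIntersection f) {k : ℕ} (hk : k < n + r)
    (z : Finset (Var n r) → MvPolynomial (Var n r) A)
    (hzw : ∀ S m, MvPolynomial.coeff m (z S) ≠ 0 → formWt d m S = 0)
    (hzd : HasDeg k z) (hz : extMul vrk (polyGrad t f) z = 0) :
    ∃ (c : A) (ξ : Finset (Var n r) → MvPolynomial (Var n r) A),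
      (∀ S m, MvPolynomial.coeff m (ξ S) ≠ 0 → formWt d m S = 0) ∧
      (∀ S, S.card + 1 ≠ k → ξ S = 0) ∧ (k ≠ 2 * r → c = 0) ∧
      z = (MvPolynomial.C c : MvPolynomial (Var n r) A) • polyTop t f (List.finRange r) + extMul vrk (polyGrad t f) ξ := by
  set fL : Fin r → Laurent (Var n r) A := fun j =>
    emb (MvPolynomial.map t (MvPolynomial.rename Sum.inl (f j))) with hfL
  set qL : Fin r → Fin (n + 1) → Laurent (Var n r) A := fun j i =>
    emb (MvPolynomial.map t (MvPolynomial.rename Sum.inl (MvPolynomial.pderiv i (f j)))) with hqL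
  have hgrad : ∀ x, emb (polyGrad t f x) = kosForm fL qL x := by
    rintro (i | j)
    · simp only [polyGrad, pderiv_inl_totalPoly, map_sum, map_mul, MvPolynomial.map_X, kosForm,
        Sum.elim_inl]
      refine Finset.sum_congr rfl fun j _ => ?_
      congr 1
      rw [MvPolynomial.X, emb_monomial, yL]
      congr 1
      funext x
      rw [castExp_apply, Pi.single_apply, Finsupp.single_apply]
      simp [eq_comm]
    · simp only [polyGrad, pderiv_inr_totalPoly, kosForm, Sum.elim_inr, hfL]
  have hmap0 : ∀ (g : MvPolynomial (Var n r) F) (m), MvPolynomial.coeff m (MvPolynomial.map t g) ≠ 0 →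
      MvPolynomial.coeff m g ≠ 0 := by
    intro g m h h0
    rw [MvPolynomial.coeff_map, h0, map_zero] at h
    exact h rfl
  -- Bézout coefficients come from division of the relation for `(x_i y_j)^N` by this monomial,
  -- which inverts only the two variables allowed.
  have hβ : ∀ i j, ∃ β : Var n r → Laurent (Var n r) A,
      (∀ z, β z ∈ lneg A {Sum.inl i, Sum.inr j}) ∧ ∑ z, kosForm fL qL z * β z = 1 := by
    intro i j
    obtain ⟨N, h, hh⟩ := exists_pow_mem_span_pderiv f hsmooth i j
    set e : Var n r → ℤ := Pi.single (.inl i) 1 + Pi.single (.inr j) 1 with he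
    refine ⟨fun z => emb (MvPolynomial.map t (h z)) * AddMonoidAlgebra.single (-(N • e)) 1,
      fun z => ?_, ?_⟩
    · refine mul_mem_lneg (emb_mem_lneg _ ∅) (single_mem_lsupp ?_ _) (Finset.empty_subset _) subset_rfl
      intro x hx
      by_contra hx'
      simp only [Finset.mem_insert, Finset.mem_singleton, not_or] at hx'
      simp [he, hx'.1, hx'.2] at hx
    · have h1 := congrArg (fun g => (emb (MvPolynomial.map t g) : Laurent (Var n r) A)) hh
      simp only [map_sum, map_mul, map_pow, MvPolynomial.map_X] at h1
      have h2 : (emb (MvPolynomial.X (.inl i)) * emb (MvPolynomial.X (.inr j)) : Laurent (Var n r) A) =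
          AddMonoidAlgebra.single e 1 := by
        rw [MvPolynomial.X, MvPolynomial.X, emb_monomial, emb_monomial,
          AddMonoidAlgebra.single_mul_single, one_mul]
        congr 1
        funext x
        rw [Pi.add_apply, castExp_apply, castExp_apply, he, Pi.add_apply, Pi.single_apply, Finsupp.single_apply,
          Pi.single_apply, Finsupp.single_apply]
        simp [eq_comm]
      rw [h2, AddMonoidAlgebra.single_pow, one_pow] at h1
      have h3 : ∀ z, kosForm fL qL z * (emb (MvPolynomial.map t (h z)) * AddMonoidAlgebra.single (-(N • e)) 1) =
          (emb (MvPolynomial.map t (h z)) * emb (MvPolynomial.map t (MvPolynomial.pderiv z (totalPoly f)))) *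
            AddMonoidAlgebra.single (-(N • e)) 1 := by
        intro z
        rw [← hgrad, polyGrad]; ring
      rw [Finset.sum_congr rfl fun z _ => h3 z, ← Finset.sum_mul, h1,
        AddMonoidAlgebra.single_mul_single, add_neg_cancel, one_mul, AddMonoidAlgebra.one_def]
  have hwtconv : ∀ (S : Finset (Var n r)) (m : Var n r →₀ ℕ), formWt d m S = 0 ↔
      ∑ z, (m z : ℤ) * wt d z = 0 - ∑ x ∈ S, wt d x := by
    intro S m; unfold formWt; constructor <;> intro h <;> linarith
  obtain ⟨c, ξ, h1, h2, h3, h4, h5⟩ := exists_laurent_primitive (f := fL) (q := qL) (d := d) hr hd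
    (fun j => emb_mem_lneg _ _)
    (fun j => emb_mem_lwt fun m hm => weight_of_coeff_rename (hf j) (hmap0 _ _ hm))
    (fun j i => emb_mem_lneg _ _)
    (fun j i => emb_mem_lwt fun m hm => by
      rw [weight_of_coeff_rename (hf j).pderiv (hmap0 _ _ hm), Nat.cast_sub (hd j)]; simp)
    hβ hk (fun S => emb (z S)) (fun S => emb_mem_lneg _ _)
    (fun S => emb_mem_lwt fun m hm => (hwtconv S m).1 (hzw S m hm))
    (fun S hS => by show emb (z S) = 0; rw [hzd S hS, map_zero])
    (by
      funext S
      have := map_extMul emb (rk := vrk) (polyGrad t f) z S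
      rw [hz, Pi.zero_apply, map_zero] at this
      rw [show kosForm fL qL = fun i => emb (polyGrad t f i) from funext fun i => (hgrad i).symm,
        ← this]; rfl)
  choose ξ' hξ' using fun S => exists_emb_eq (h1 S)
  have htop : ∀ l S, emb (polyTop t f l S) = kosTop qL l S := by
    intro l
    induction l with
    | nil => intro S; simp only [polyTop, kosTop, List.foldr_nil, unitForm]; split_ifs <;> simp
    | cons j l ih =>
      intro S
      simp only [polyTop, kosTop, List.foldr_cons] at ih ⊢
      rw [map_extMul]
      refine congrFun (congrArg₂ (fun (a : Var n r → Laurent (Var n r) A) b => extMul vrk a b) ?_ ?_) S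
      · funext x; rcases x with x | x <;> simp [hqL]
      · funext U
        rw [crea_apply, crea_apply]
        split_ifs
        · rw [map_zsmul, ih]
        · rw [map_zero]
  refine ⟨c, ξ', ?_, ?_, h4, ?_⟩
  · intro S m hm
    rw [← coeff_emb, hξ'] at hm
    exact (hwtconv S m).2 (h2 S _ hm)
  · intro S hS
    apply emb_injective
    rw [hξ', h3 S hS, map_zero]
  · funext S
    apply emb_injective
    have := congrFun h5 S
    simp only [Pi.add_apply, Pi.smul_apply, smul_eq_mul, map_add, map_mul, emb_C, htop,
      map_extMul, hξ'] at this ⊢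
    rw [this]
    rw [show (fun i => emb (polyGrad t f i)) = kosForm fL qL from funext hgrad]

end PolyForms

/-! ### Restricted power series and forms over an adically complete ring -/

section Restricted

variable {V O : Type*} [CommRing O] (ϖ : O)

variable (V) in
/-- The power series whose coefficients tend to zero `ϖ`-adically. -/
def tateRing : Subring (MvPowerSeries V O) where
  carrier := {g | ∀ N : ℕ, {m | ¬ ϖ ^ N ∣ MvPowerSeries.coeff m g}.Finite}
  zero_mem' N := by simp
  one_mem' N := by
    classical
    refine (Set.finite_singleton 0).subset fun m hm => ?_
    by_contra h
    rw [Set.mem_ofPred_eq, MvPowerSeries.coeff_one, if_neg (by simpa using h)] at hm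
    exact hm (dvd_zero _)
  add_mem' {g h} hg hh N := by
    refine ((hg N).union (hh N)).subset fun m hm => ?_
    by_contra h'
    simp only [Set.mem_union, Set.mem_ofPred_eq, not_or, not_not] at h'
    exact hm (by rw [map_add]; exact dvd_add h'.1 h'.2)
  neg_mem' {g} hg N := by simpa using hg N
  mul_mem' {g h} hg hh N := by
    classical
    refine (Set.Finite.image2 (· + ·) (hg N) (hh N)).subset fun m hm => ?_
    rw [Set.mem_ofPred_eq, MvPowerSeries.coeff_mul] at hm
    obtain ⟨⟨a, b⟩, hab, h1⟩ : ∃ x ∈ Finset.HasAntidiagonal.antidiagonal m,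
        ¬ ϖ ^ N ∣ MvPowerSeries.coeff x.1 g * MvPowerSeries.coeff x.2 h := by
      by_contra hc
      push Not at hc
      exact hm (Finset.dvd_sum hc)
    exact ⟨a, fun h2 => h1 (h2.mul_right _), b, fun h2 => h1 (h2.mul_left _),
      Finset.HasAntidiagonal.mem_antidiagonal.1 hab⟩

variable {ϖ}

theorem coe_mem_tateRing (P : MvPolynomial V O) : (P : MvPowerSeries V O) ∈ tateRing V ϖ := by
  intro N
  refine P.support.finite_toSet.subset fun m hm => ?_
  rw [Finset.mem_coe, MvPolynomial.mem_support_iff]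
  intro h
  rw [Set.mem_ofPred_eq, MvPolynomial.coeff_coe, h] at hm
  exact hm (dvd_zero _)

theorem pderiv_mem_tateRing {g : MvPowerSeries V O} (hg : g ∈ tateRing V ϖ) (i : V) :
    MvPowerSeries.pderiv O i g ∈ tateRing V ϖ := by
  intro N
  refine ((hg N).preimage (f := (· + Finsupp.single i 1)) (add_left_injective _).injOn).subset
    fun m hm h => hm ?_
  rw [MvPowerSeries.coeff_pderiv]
  exact Dvd.dvd.mul_right h _

theorem smul_mem_tateRing {g : MvPowerSeries V O} (hg : g ∈ tateRing V ϖ) (a : O) :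
    a • g ∈ tateRing V ϖ := by
  intro N
  refine (hg N).subset fun m hm h => hm ?_
  rw [map_smul]
  exact Dvd.dvd.mul_left h _

theorem exists_coe_eq_map {g : MvPowerSeries V O} (hg : g ∈ tateRing V ϖ) :
    ∃ P : MvPolynomial V (O ⧸ Ideal.span {ϖ}),
      (P : MvPowerSeries V (O ⧸ Ideal.span {ϖ})) = MvPowerSeries.map (Ideal.Quotient.mk _) g := by
  classical
  have hfin := hg 1
  refine ⟨∑ m ∈ hfin.toFinset, MvPolynomial.monomial m
    (Ideal.Quotient.mk _ (MvPowerSeries.coeff m g)), ?_⟩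
  ext m
  rw [MvPolynomial.coeff_coe, MvPolynomial.coeff_sum, MvPowerSeries.coeff_map]
  simp only [MvPolynomial.coeff_monomial, Finset.sum_ite_eq', Set.Finite.mem_toFinset,
    Set.mem_ofPred_eq, pow_one]
  split_ifs with h
  · exact (Ideal.Quotient.eq_zero_iff_mem.2 (Ideal.mem_span_singleton.2 h)).symm
  · rfl

/-- Zero coefficients are lifted to zero, so that conditions on the support such as weight and
degree are inherited by the lift. -/
theorem exists_lift (P : MvPolynomial V (O ⧸ Ideal.span {ϖ})) :
    ∃ Q : MvPolynomial V O, MvPolynomial.map (Ideal.Quotient.mk _) Q = P ∧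
      ∀ m, MvPolynomial.coeff m P = 0 → MvPolynomial.coeff m Q = 0 := by
  classical
  choose s hs using Ideal.Quotient.mk_surjective (I := Ideal.span {ϖ})
  have h : ∀ m, MvPolynomial.coeff m (∑ m ∈ P.support, MvPolynomial.monomial m
      (s (MvPolynomial.coeff m P))) =
      if MvPolynomial.coeff m P = 0 then 0 else s (MvPolynomial.coeff m P) := by
    intro m
    rw [MvPolynomial.coeff_sum]
    simp only [MvPolynomial.coeff_monomial, Finset.sum_ite_eq', MvPolynomial.mem_support_iff,
      ite_not]
  refine ⟨_, ?_, fun m hm => by rw [h, if_pos hm]⟩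
  ext m
  rw [MvPolynomial.coeff_map, h]
  split_ifs with h0
  · rw [map_zero, h0]
  · exact hs _

theorem exists_eq_smul {g : MvPowerSeries V O} (hϖ : ∀ a, ϖ * a = 0 → a = 0)
    (h : MvPowerSeries.map (Ideal.Quotient.mk (Ideal.span {ϖ})) g = 0) :
    ∃ g' : MvPowerSeries V O, g = ϖ • g' ∧ (g ∈ tateRing V ϖ → g' ∈ tateRing V ϖ) ∧
      ∀ m, MvPowerSeries.coeff m g = 0 → MvPowerSeries.coeff m g' = 0 := by
  have h1 : ∀ m, ∃ a, MvPowerSeries.coeff m g = ϖ * a := by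
    intro m
    have := congrArg (MvPowerSeries.coeff m) h
    rw [MvPowerSeries.coeff_map, map_zero, Ideal.Quotient.eq_zero_iff_mem,
      Ideal.mem_span_singleton] at this
    exact this
  choose a ha using h1
  set A : MvPowerSeries V O := a with hA
  have hcoeff : ∀ m, MvPowerSeries.coeff m A = a m := fun _ => rfl
  refine ⟨A, ?_, fun hg N => ?_, fun m hm => ?_⟩
  · ext m; rw [ha m, map_smul, hcoeff, smul_eq_mul]
  · refine (hg (N + 1)).subset fun m hm h2 => hm ?_
    rw [ha m, pow_succ'] at h2
    show ϖ ^ N ∣ a m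
    obtain ⟨b, hb⟩ := h2
    refine ⟨b, ?_⟩
    have := hϖ (a m - ϖ ^ N * b) (by linear_combination hb)
    exact sub_eq_zero.1 this
  · rw [ha m] at hm; rw [hcoeff]; exact hϖ _ hm

end Restricted

/-! ### The operator `c d + ψ ∧` and the weight over a general coefficient ring -/

section RestrictedForms

variable {n r : ℕ} {O : Type*} [CommRing O]

/-- The exterior derivative over an arbitrary ring of coefficients. -/
def formDeriv : (Finset (Var n r) → MvPowerSeries (Var n r) O) →ₗ[O]
    (Finset (Var n r) → MvPowerSeries (Var n r) O) where
  toFun ω S := ∑ i ∈ S, esgn vrk S i • MvPowerSeries.pderiv O i (ω (S.erase i))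
  map_add' ω ω' := by
    funext S
    simp only [Pi.add_apply, map_add, smul_add, Finset.sum_add_distrib]
  map_smul' a ω := by
    funext S
    simp only [Pi.smul_apply, RingHom.id_apply, Finset.smul_sum, Derivation.map_smul]
    exact Finset.sum_congr rfl fun i _ => smul_comm _ _ _

theorem formDeriv_apply (ω : Finset (Var n r) → MvPowerSeries (Var n r) O)
    (S : Finset (Var n r)) : formDeriv ω S =
      ∑ i ∈ S, esgn vrk S i • MvPowerSeries.pderiv O i (ω (S.erase i)) := rfl

/-- The operator `c d + ψ ∧`. -/
def twistedD (c : O) (ψ : Var n r → MvPowerSeries (Var n r) O) :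
    (Finset (Var n r) → MvPowerSeries (Var n r) O) →ₗ[O]
      (Finset (Var n r) → MvPowerSeries (Var n r) O) :=
  c • formDeriv + (extMul vrk ψ).restrictScalars O

theorem twistedD_apply (c : O) (ψ : Var n r → MvPowerSeries (Var n r) O)
    (ω : Finset (Var n r) → MvPowerSeries (Var n r) O) :
    twistedD c ψ ω = c • formDeriv ω + extMul vrk ψ ω := rfl

/-- Every monomial of the form has weight zero. -/
def FormWtZero (d : Fin r → ℕ) (ω : Finset (Var n r) → MvPowerSeries (Var n r) O) : Prop :=
  ∀ S m, MvPowerSeries.coeff m (ω S) ≠ 0 → formWt d m S = 0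

theorem formWt_single_add (d : Fin r → ℕ) (m m' : Var n r →₀ ℕ) (S : Finset (Var n r)) :
    formWt d (m + m') S = ∑ z, (m z : ℤ) * wt d z + formWt d m' S := by
  unfold formWt
  simp only [Finsupp.add_apply, Nat.cast_add, add_mul, Finset.sum_add_distrib]
  ring

theorem formWt_erase (d : Fin r → ℕ) (m : Var n r →₀ ℕ) {S : Finset (Var n r)} {i : Var n r}
    (h : i ∈ S) : formWt d m S = wt d i + formWt d m (S.erase i) := by
  unfold formWt
  rw [← Finset.add_sum_erase S _ h]; ring

theorem FormWtZero.extMul {d : Fin r → ℕ} {α : Var n r → MvPowerSeries (Var n r) O}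
    (hα : ∀ i m, MvPowerSeries.coeff m (α i) ≠ 0 → ∑ z, (m z : ℤ) * wt d z = - wt d i)
    {ω : Finset (Var n r) → MvPowerSeries (Var n r) O} (h : FormWtZero d ω) :
    FormWtZero d (extMul vrk α ω) := by
  classical
  intro S m hm
  rw [extMul_apply, map_sum] at hm
  obtain ⟨i, hi, h1⟩ := Finset.exists_ne_zero_of_sum_ne_zero hm
  rw [map_zsmul, MvPowerSeries.coeff_mul] at h1
  obtain ⟨⟨a, b⟩, hab, h2⟩ := Finset.exists_ne_zero_of_sum_ne_zero (fun h3 => h1 (by rw [h3, smul_zero]))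
  have h3 := hα i a (left_ne_zero_of_mul h2)
  have h4 := h _ b (right_ne_zero_of_mul h2)
  rw [← Finset.HasAntidiagonal.mem_antidiagonal.1 hab, formWt_single_add, formWt_erase d _ hi, h3, h4]; ring

theorem FormWtZero.formDeriv {d : Fin r → ℕ}
    {ω : Finset (Var n r) → MvPowerSeries (Var n r) O} (h : FormWtZero d ω) :
    FormWtZero d (formDeriv ω) := by
  classical
  intro S m hm
  rw [formDeriv_apply, map_sum] at hm
  obtain ⟨i, hi, h1⟩ := Finset.exists_ne_zero_of_sum_ne_zero hm
  rw [map_zsmul, MvPowerSeries.coeff_pderiv] at h1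
  have h2 := h _ _ (left_ne_zero_of_mul (right_ne_zero_of_smul h1))
  rw [add_comm, formWt_single_add] at h2
  rw [formWt_erase d m hi, ← h2]
  congr 1
  rw [Finset.sum_eq_single i]
  · simp
  · intro z _ hz; simp [Finsupp.single_eq_of_ne hz]
  · simp

theorem FormWtZero.add {d : Fin r → ℕ} {ω ω' : Finset (Var n r) → MvPowerSeries (Var n r) O}
    (h : FormWtZero d ω) (h' : FormWtZero d ω') : FormWtZero d (ω + ω') := by
  intro S m hm
  rw [Pi.add_apply, map_add] at hm
  by_cases h0 : MvPowerSeries.coeff m (ω S) = 0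
  · exact h' S m fun h1 => hm (by rw [h0, h1, add_zero])
  · exact h S m h0

theorem FormWtZero.smul {d : Fin r → ℕ} {ω : Finset (Var n r) → MvPowerSeries (Var n r) O}
    (h : FormWtZero d ω) (a : O) : FormWtZero d (a • ω) := by
  intro S m hm
  rw [Pi.smul_apply, map_smul] at hm
  exact h S m (right_ne_zero_of_smul hm)

theorem FormWtZero.sub {d : Fin r → ℕ} {ω ω' : Finset (Var n r) → MvPowerSeries (Var n r) O}
    (h : FormWtZero d ω) (h' : FormWtZero d ω') : FormWtZero d (ω - ω') := by
  have := h.add (h'.smul (-1))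
  rwa [neg_smul, one_smul, ← sub_eq_add_neg] at this

theorem hasDeg_sub {k : ℕ} {ω ω' : Finset (Var n r) → MvPowerSeries (Var n r) O}
    (h : HasDeg k ω) (h' : HasDeg k ω') : HasDeg k (ω - ω') := fun S hS => by
  rw [Pi.sub_apply, h S hS, h' S hS, sub_zero]

theorem hasDeg_smul {k : ℕ} {ω : Finset (Var n r) → MvPowerSeries (Var n r) O}
    (h : HasDeg k ω) (a : O) : HasDeg k (a • ω) := fun S hS => by
  rw [Pi.smul_apply, h S hS, smul_zero]

theorem HasDeg.formDeriv {k : ℕ} {ω : Finset (Var n r) → MvPowerSeries (Var n r) O}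
    (h : HasDeg k ω) : HasDeg (k + 1) (formDeriv ω) := by
  intro S hS
  rw [formDeriv_apply]
  refine Finset.sum_eq_zero fun i hi => ?_
  rw [h, map_zero, smul_zero]
  rw [Finset.card_erase_of_mem hi]
  have := Finset.card_pos.2 ⟨i, hi⟩; omega

end RestrictedForms

/-! ### Lifting primitives from the residue ring -/

section Lifting

variable {n r : ℕ} {O : Type*} [CommRing O] {ϖ : O}

/-- The sum `∑ ϖ^i g_i` is formed coefficient by coefficient. Convergence is expressed by an
explicit remainder `ϖ^N • R` for each `N`, which passes through any linear operator without a
continuity argument. -/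
theorem exists_eq_sum_add_pow (hcomp : ∀ a : ℕ → O, ∃ L, ∀ N, ϖ ^ N ∣ L - ∑ i ∈ Finset.range N, ϖ ^ i * a i)
    (hsep : ∀ a : O, (∀ N, ϖ ^ N ∣ a) → a = 0) {V : Type*} (g : ℕ → MvPowerSeries V O) :
    ∃ G : MvPowerSeries V O,
      (∀ N, ∃ R, G = ∑ i ∈ Finset.range N, ϖ ^ i • g i + ϖ ^ N • R) ∧
      (∀ m, (∀ i, MvPowerSeries.coeff m (g i) = 0) → MvPowerSeries.coeff m G = 0) := by
  choose L hL using hcomp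
  set G : MvPowerSeries V O := fun m => L fun i => MvPowerSeries.coeff m (g i) with hG
  have hGc : ∀ m, MvPowerSeries.coeff m G = L fun i => MvPowerSeries.coeff m (g i) := fun _ => rfl
  refine ⟨G, fun N => ?_, fun m hm => ?_⟩
  · choose R' hR' using fun m => hL (fun i => MvPowerSeries.coeff m (g i)) N
    set R : MvPowerSeries V O := R' with hR
    have hRc : ∀ m, MvPowerSeries.coeff m R = R' m := fun _ => rfl
    refine ⟨R, ?_⟩
    ext m
    rw [map_add, map_sum, hGc, map_smul, hRc, smul_eq_mul, ← hR' m]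
    simp only [map_smul, smul_eq_mul]
    ring
  · rw [hGc]
    refine hsep _ fun N => ?_
    have := hL (fun i => MvPowerSeries.coeff m (g i)) N
    simpa [hm] using this

theorem sum_pow_smul_mem_tateRing {V : Type*} {g : ℕ → MvPowerSeries V O}
    {G : MvPowerSeries V O} (hg : ∀ i, g i ∈ tateRing V ϖ)
    (hG : ∀ N, ∃ R, G = ∑ i ∈ Finset.range N, ϖ ^ i • g i + ϖ ^ N • R) : G ∈ tateRing V ϖ := by
  intro N
  obtain ⟨R, hR⟩ := hG N
  have h1 : ∑ i ∈ Finset.range N, ϖ ^ i • g i ∈ tateRing V ϖ :=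
    sum_mem fun i _ => smul_mem_tateRing (hg i) _
  refine (h1 N).subset fun m hm h => hm ?_
  rw [hR, map_add, map_smul]
  exact dvd_add h (Dvd.intro _ rfl)

/-- A cocycle of the twisted de Rham complex of weight zero with restricted coefficients is a
coboundary plus a multiple of a given lift of `∏ df_j dy_j`. -/
theorem exists_restricted_primitive {F : Type*} [Field F]
    (hϖ : ∀ a, ϖ * a = 0 → a = 0) (hsep : ∀ a : O, (∀ N, ϖ ^ N ∣ a) → a = 0)
    (hcomp : ∀ a : ℕ → O, ∃ L, ∀ N, ϖ ^ N ∣ L - ∑ i ∈ Finset.range N, ϖ ^ i * a i)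
    (t : F →+* O ⧸ Ideal.span {ϖ})
    (f : Fin r → MvPolynomial (Fin (n + 1)) F) (d : Fin r → ℕ)
    (hr : r < n) (hd : ∀ j, 0 < d j) (hf : ∀ j, (f j).IsHomogeneous (d j))
    (hsmooth : IsSmoothCompleteIntersection f)
    {c : O} (hc : ϖ ∣ c) {ψ : Var n r → MvPowerSeries (Var n r) O}
    (hψT : ∀ i, ψ i ∈ tateRing _ ϖ)
    (hψw : ∀ i m, MvPowerSeries.coeff m (ψ i) ≠ 0 → ∑ z, (m z : ℤ) * wt d z = - wt d i)
    (hψ : ∀ i, MvPowerSeries.map (Ideal.Quotient.mk (Ideal.span {ϖ})) (ψ i) = polyGrad t f i)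
    (hDD : ∀ ω, twistedD c ψ (twistedD c ψ ω) = 0)
    {ω₀ : Finset (Var n r) → MvPowerSeries (Var n r) O}
    (hω₀T : ∀ S, ω₀ S ∈ tateRing _ ϖ) (hω₀w : FormWtZero d ω₀) (hω₀d : HasDeg (2 * r) ω₀)
    (hω₀ : twistedD c ψ ω₀ = 0)
    (hω₀r : ∀ S, MvPowerSeries.map (Ideal.Quotient.mk (Ideal.span {ϖ})) (ω₀ S) =
      polyTop t f (List.finRange r) S)
    {k : ℕ} (hk : k < n + r) (z : Finset (Var n r) → MvPowerSeries (Var n r) O)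
    (hzT : ∀ S, z S ∈ tateRing _ ϖ) (hzw : FormWtZero d z) (hzd : HasDeg k z)
    (hz : twistedD c ψ z = 0) :
    ∃ (a : O) (ξ : Finset (Var n r) → MvPowerSeries (Var n r) O),
      (∀ S, ξ S ∈ tateRing _ ϖ) ∧ FormWtZero d ξ ∧ (∀ S, S.card + 1 ≠ k → ξ S = 0) ∧
      (k ≠ 2 * r → a = 0) ∧ z = a • ω₀ + twistedD c ψ ξ := by
  set μ := Ideal.Quotient.mk (Ideal.span {ϖ}) with hμ
  have hμϖ : μ ϖ = 0 := Ideal.Quotient.eq_zero_iff_mem.2 (Ideal.mem_span_singleton_self _)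
  have hμc : μ c = 0 := Ideal.Quotient.eq_zero_iff_mem.2 (Ideal.mem_span_singleton.2 hc)
  have hcoe : Function.Injective
      (fun P : MvPolynomial (Var n r) (O ⧸ Ideal.span {ϖ}) =>
        (P : MvPowerSeries (Var n r) (O ⧸ Ideal.span {ϖ}))) := MvPolynomial.coe_injective _ _
  have hmapsmul : ∀ (a : O) (g : MvPowerSeries (Var n r) O),
      MvPowerSeries.map μ (a • g) = μ a • MvPowerSeries.map μ g := by
    intro a g; ext m; simp [MvPowerSeries.coeff_map]
  have hredD : ∀ ω S, MvPowerSeries.map μ (twistedD c ψ ω S) =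
      extMul vrk (fun i => (polyGrad t f i : MvPowerSeries (Var n r) (O ⧸ Ideal.span {ϖ})))
        (fun U => MvPowerSeries.map μ (ω U)) S := by
    intro ω S
    rw [twistedD_apply, Pi.add_apply, map_add, Pi.smul_apply, hmapsmul, hμc, zero_smul, zero_add,
      map_extMul]
    simp only [hψ]
  set P : (Finset (Var n r) → MvPowerSeries (Var n r) O) → Prop := fun z =>
    (∀ S, z S ∈ tateRing _ ϖ) ∧ FormWtZero d z ∧ HasDeg k z ∧ twistedD c ψ z = 0 with hP
  -- One approximation step: solve modulo `ϖ`, lift the solution, and divide the remainder by `ϖ`.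
  -- The quotient satisfies the same conditions since `ϖ` is not a zero divisor.
  have step : ∀ z : {z // P z}, ∃ (a : O) (ξ : Finset (Var n r) → MvPolynomial (Var n r) O) (z' : {z // P z}),
      FormWtZero d (fun S => (ξ S : MvPowerSeries (Var n r) O)) ∧
      (∀ S, S.card + 1 ≠ k → ξ S = 0) ∧ (k ≠ 2 * r → a = 0) ∧
      z.1 = a • ω₀ + twistedD c ψ (fun S => (ξ S : MvPowerSeries (Var n r) O)) + ϖ • z'.1 := by
    rintro ⟨z, hzT, hzw, hzd, hz⟩
    choose z₀ hz₀ using fun S => exists_coe_eq_map (hzT S)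
    have hz₀c : ∀ S m, MvPolynomial.coeff m (z₀ S) = μ (MvPowerSeries.coeff m (z S)) := by
      intro S m
      rw [← MvPolynomial.coeff_coe, hz₀, MvPowerSeries.coeff_map]
    obtain ⟨a₀, ξ₀, h1, h2, h3, h4⟩ := exists_poly_primitive t f d hr hd hf hsmooth hk z₀
      (fun S m hm => hzw S m fun h0 => hm (by rw [hz₀c, h0, map_zero]))
      (fun S hS => hcoe (by show (z₀ S : MvPowerSeries (Var n r) (O ⧸ Ideal.span {ϖ})) = _; rw [hz₀, hzd S hS]; simp))
      (by
        funext S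
        apply hcoe
        have h5 := map_extMul (rk := vrk) (MvPolynomial.coeToMvPowerSeries.ringHom (σ := Var n r) (R := O ⧸ Ideal.span {ϖ}))
          (polyGrad t f) z₀ S
        simp only [MvPolynomial.coeToMvPowerSeries.ringHom_apply] at h5
        simp only [h5, hz₀]
        rw [← hredD, hz]; simp)
    obtain ⟨a₁, ha₁⟩ := Ideal.Quotient.mk_surjective a₀
    -- Outside degree `2 r` the coefficient is zero modulo `ϖ`, but an arbitrary lift of it need not
    -- be; the lift `0` is imposed.
    set a : O := if k = 2 * r then a₁ else 0 with ha
    have haμ : μ a = a₀ := by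
      rw [ha]; split_ifs with h
      · exact ha₁
      · rw [map_zero, h3 h]
    choose ξ hξ hξs using fun S => exists_lift (ϖ := ϖ) (ξ₀ S)
    have hξw : FormWtZero d (fun S => (ξ S : MvPowerSeries (Var n r) O)) := by
      intro S m hm
      rw [MvPolynomial.coeff_coe] at hm
      exact h1 S m fun h => hm (hξs S m h)
    have hξd : ∀ S, S.card + 1 ≠ k → ξ S = 0 := by
      intro S hS
      ext m
      rw [MvPolynomial.coeff_zero]
      exact hξs S m (by rw [h2 S hS, MvPolynomial.coeff_zero])
    have hξr : ∀ S, MvPowerSeries.map μ (ξ S : MvPowerSeries (Var n r) O) = ξ₀ S := by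
      intro S
      ext m
      rw [MvPowerSeries.coeff_map, MvPolynomial.coeff_coe, MvPolynomial.coeff_coe, ← hξ S,
        MvPolynomial.coeff_map]
    set ρ := z - (a • ω₀ + twistedD c ψ (fun S => (ξ S : MvPowerSeries (Var n r) O))) with hρ
    have hξd' : HasDeg k (twistedD c ψ (fun S => (ξ S : MvPowerSeries (Var n r) O))) := by
      intro S hS
      have hz0 : ∀ i ∈ S, ξ (S.erase i) = 0 := by
        intro i hi
        apply hξd
        rw [Finset.card_erase_of_mem hi]
        have := Finset.card_pos.2 ⟨i, hi⟩; omega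
      rw [twistedD_apply, Pi.add_apply, Pi.smul_apply, formDeriv_apply, extMul_apply]
      rw [Finset.sum_eq_zero fun i hi => by rw [hz0 i hi]; simp,
        Finset.sum_eq_zero fun i hi => by rw [hz0 i hi]; simp]
      simp
    have hρ0 : ∀ S, MvPowerSeries.map μ (ρ S) = 0 := by
      intro S
      have h5 := congrArg (fun p : MvPolynomial (Var n r) (O ⧸ Ideal.span {ϖ}) =>
        (p : MvPowerSeries (Var n r) (O ⧸ Ideal.span {ϖ}))) (congrFun h4 S)
      have h6 := map_extMul (rk := vrk) (MvPolynomial.coeToMvPowerSeries.ringHom (σ := Var n r) (R := O ⧸ Ideal.span {ϖ}))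
          (polyGrad t f) ξ₀ S
      simp only [MvPolynomial.coeToMvPowerSeries.ringHom_apply] at h6
      rw [hρ, Pi.sub_apply, map_sub, ← hz₀, Pi.add_apply, map_add, Pi.smul_apply, hmapsmul, haμ,
        hω₀r, hredD]
      simp only [hξr]
      rw [← h6, h5, sub_eq_zero]
      simp only [Pi.add_apply, Pi.smul_apply, smul_eq_mul, MvPolynomial.coe_add,
        MvPolynomial.coe_mul, MvPolynomial.coe_C, MvPowerSeries.smul_eq_C_mul]
    have hρT : ∀ S, ρ S ∈ tateRing _ ϖ := by
      intro S
      refine sub_mem (hzT S) (add_mem (smul_mem_tateRing (hω₀T S) _) ?_)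
      rw [twistedD_apply]
      refine add_mem (smul_mem_tateRing ?_ _) ?_
      · rw [formDeriv_apply]
        exact sum_mem fun i _ => zsmul_mem (pderiv_mem_tateRing (coe_mem_tateRing _) _) _
      · rw [extMul_apply]
        exact sum_mem fun i _ => zsmul_mem (mul_mem (hψT i) (coe_mem_tateRing _)) _
    have hρw : FormWtZero d ρ := by
      refine hzw.sub ((hω₀w.smul _).add ?_)
      rw [twistedD_apply]
      exact (hξw.formDeriv.smul _).add (hξw.extMul hψw)
    have hρd : HasDeg k ρ := by
      refine hasDeg_sub hzd ?_
      by_cases hk2 : k = 2 * r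
      · intro S hS
        rw [Pi.add_apply, Pi.smul_apply, hω₀d S (by omega), hξd' S hS]; simp
      · rw [ha, if_neg hk2, zero_smul, zero_add]; exact hξd'
    choose ρ' hρ' hρ'T hρ's using fun S => exists_eq_smul hϖ (hρ0 S)
    have hρe : ρ = ϖ • ρ' := funext hρ'
    refine ⟨a, ξ, ⟨ρ', fun S => hρ'T S (hρT S), ?_, ?_, ?_⟩, hξw, hξd, fun h => if_neg h, ?_⟩
    · intro S m hm
      exact hρw S m fun h => hm (hρ's S m h)
    · intro S hS
      ext m
      exact hρ's S m (by rw [hρd S hS]; simp)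
    · have h5 : twistedD c ψ ρ = 0 := by
        rw [hρ, map_sub, map_add, map_smul, hω₀, hDD, hz]; simp
      rw [hρe, map_smul] at h5
      funext S
      ext m
      have := congrArg (MvPowerSeries.coeff m) (congrFun h5 S)
      rw [Pi.smul_apply, map_smul] at this
      simpa using hϖ _ (by simpa using this)
    · show z = _ + ϖ • ρ'
      rw [← hρe, hρ]; abel
  choose a ξ z' hξw hξd ha heq using step
  -- The successive quotients of the remainders, starting from `z`.
  set zs : ℕ → {z // P z} := fun i => Nat.rec ⟨z, hzT, hzw, hzd, hz⟩ (fun _ z => z' z) i with hzs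
  have hzs0 : (zs 0).1 = z := rfl
  have hzsS : ∀ i, zs (i + 1) = z' (zs i) := fun _ => rfl
  have hpart : ∀ N, z = (∑ i ∈ Finset.range N, ϖ ^ i * a (zs i)) • ω₀ +
      twistedD c ψ (fun S => ∑ i ∈ Finset.range N, ϖ ^ i • (ξ (zs i) S : MvPowerSeries (Var n r) O)) +
        ϖ ^ N • (zs N).1 := by
    intro N
    induction N with
    | zero => simp [hzs0]; exact map_zero (twistedD c ψ)
    | succ N ih =>
      have h7 : (fun S => ∑ i ∈ Finset.range (N + 1), ϖ ^ i • (ξ (zs i) S : MvPowerSeries (Var n r) O)) =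
          (fun S => ∑ i ∈ Finset.range N, ϖ ^ i • (ξ (zs i) S : MvPowerSeries (Var n r) O)) +
          ϖ ^ N • (fun S => (ξ (zs N) S : MvPowerSeries (Var n r) O)) := by
        funext S; rw [Finset.sum_range_succ]; rfl
      rw [h7, map_add, map_smul, Finset.sum_range_succ, add_smul, hzsS, pow_succ]
      conv_lhs => rw [ih, heq (zs N)]
      rw [smul_add, smul_add, smul_smul, smul_smul]
      abel
  obtain ⟨α, hα⟩ := hcomp fun i => a (zs i)
  choose Ξ hΞ hΞs using fun S => exists_eq_sum_add_pow hcomp hsep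
    (fun i => (ξ (zs i) S : MvPowerSeries (Var n r) O))
  refine ⟨α, Ξ, fun S => sum_pow_smul_mem_tateRing (fun i => coe_mem_tateRing _) (hΞ S), ?_, ?_, ?_, ?_⟩
  · intro S m hm
    by_contra h
    refine hm (hΞs S m fun i => ?_)
    by_contra h0
    exact h (hξw (zs i) S m h0)
  · intro S hS
    ext m
    exact hΞs S m fun i => by rw [hξd _ S hS]; simp
  · intro hk2
    refine hsep _ fun N => ?_
    simpa [ha _ hk2] using hα N
  -- Both limits differ from their partial sums by multiples of `ϖ^N`, so the defect is divisible by
  -- `ϖ^N` for every `N`.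
  · rw [← sub_eq_zero]
    funext S
    ext m
    refine (hsep _ fun N => ?_).trans (by simp)
    obtain ⟨α', hα'⟩ := hα N
    choose R hR using fun S => hΞ S N
    have h8 : Ξ = (fun S => ∑ i ∈ Finset.range N, ϖ ^ i • (ξ (zs i) S : MvPowerSeries (Var n r) O)) +
        ϖ ^ N • R := by
      funext S; exact hR S
    have h9 : z - (α • ω₀ + twistedD c ψ Ξ) = ϖ ^ N • ((zs N).1 - (α' • ω₀ + twistedD c ψ R)) := by
      rw [h8, map_add, map_smul, sub_eq_iff_eq_add.1 hα']
      conv_lhs => rw [hpart N]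
      rw [add_smul, smul_sub, smul_add, smul_smul]
      abel
    rw [h9, Pi.smul_apply, map_smul]
    exact Dvd.intro _ rfl

end Lifting

/-! ### The ring of integers -/

namespace Constants

variable {p : ℕ} [hp : Fact p.Prime] {F : Type*} [Field F] (c : Constants p F)

theorem norm_natCast (k : ℕ) : ‖(k : ℂ_[p])‖ = ‖(k : ℚ_[p])‖ := by
  rw [← PadicComplex.norm_extends' p (k : ℚ_[p])]
  congr 1
  exact (map_natCast (algebraMap ℚ_[p] ℂ_[p]) k).symm

theorem norm_π_pow : ‖c.π‖ ^ c.M = (p : ℝ)⁻¹ := by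
  rw [← norm_pow, c.π_pow, norm_natCast, Padic.norm_p]

theorem norm_p_eq : ‖(p : ℂ_[p])‖ = ‖c.π‖ ^ c.M := by
  rw [← norm_pow, c.π_pow]

theorem norm_π_lt_one : ‖c.π‖ < 1 := by
  by_contra h
  have h1 := one_le_pow₀ (n := c.M) (not_lt.1 h)
  rw [c.norm_π_pow] at h1
  have h2 : (1 : ℝ) < p := by exact_mod_cast hp.out.one_lt
  exact absurd h1 (not_le.2 (inv_lt_one_of_one_lt₀ h2))

theorem π_ne_zero : c.π ≠ 0 := by
  intro h
  have h1 := c.norm_π_pow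
  rw [h, norm_zero, zero_pow c.M_pos.ne'] at h1
  have h2 : (0 : ℝ) < p := by exact_mod_cast hp.out.pos
  exact absurd h1 (inv_pos.2 h2).ne

theorem norm_π_pos : 0 < ‖c.π‖ := norm_pos_iff.2 c.π_ne_zero

/-- With orders measured in units of `ord π`, the order of `γ` is `M' = M/(p-1)`, and the bounds on
`b` become integer inequalities. The lower one makes `π^(Mb)/γ` divisible by `π`; the upper one
makes the coefficients of `ψ` tend to zero. -/
theorem exists_M : ∃ M' : ℕ, 0 < M' ∧ c.M = (p - 1) * M' ∧ M' < c.Mb ∧ c.Mb < p * M' ∧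
    ‖c.γ‖ = ‖c.π‖ ^ M' := by
  obtain ⟨M', hM⟩ := c.dvd_M
  have hp1 := hp.out.one_lt
  have hM' : 0 < M' := by
    rcases Nat.eq_zero_or_pos M' with h | h
    · have := c.M_pos; rw [hM, h] at this; simp at this
    · exact h
  have hMq : (c.M : ℚ) = ((p : ℚ) - 1) * M' := by
    rw [hM, Nat.cast_mul, Nat.cast_sub hp1.le, Nat.cast_one]
  have hpq : (0 : ℚ) < (p : ℚ) - 1 := by
    have : (1 : ℚ) < p := by exact_mod_cast hp1
    linarith
  have hMpos : (0 : ℚ) < M' := by exact_mod_cast hM'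
  refine ⟨M', hM', hM, ?_, ?_, ?_⟩
  · have h1 := c.lt_b
    rw [div_lt_iff₀ hpq] at h1
    have : (M' : ℚ) < c.Mb := by rw [c.Mb_eq, hMq]; nlinarith
    exact_mod_cast this
  · have h1 := c.b_lt
    rw [lt_div_iff₀ hpq] at h1
    have : (c.Mb : ℚ) < (p : ℚ) * M' := by rw [c.Mb_eq, hMq]; nlinarith
    exact_mod_cast this
  · have h1 := c.γ_norm
    rw [c.norm_p_eq, hM, mul_comm, pow_mul] at h1
    exact (pow_left_inj₀ (norm_nonneg _) (pow_nonneg (norm_nonneg _) _) (by omega)).1 h1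

theorem π_mem : c.π ∈ c.coeffField :=
  IntermediateField.subset_adjoin _ _ (Or.inr (Or.inr rfl))

theorem T_mem (x : F) : c.T x ∈ c.coeffField :=
  IntermediateField.subset_adjoin _ _ (Or.inl ⟨x, rfl⟩)

theorem γ_mem_coeffField : c.γ ∈ c.coeffField :=
  IntermediateField.adjoin.mono _ _ _ (by simp) c.γ_mem

theorem gammaTrunc_mem (l : ℕ) : c.gammaTrunc l ∈ c.coeffField :=
  sum_mem fun _ _ => div_mem (pow_mem c.γ_mem_coeffField _) (pow_mem (natCast_mem _ _) _)

/-- The element `π` of the ring of integers. -/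
def ϖ : c.integers := ⟨c.π, c.π_mem, c.norm_π_lt_one.le⟩

theorem coe_ϖ : (c.ϖ : ℂ_[p]) = c.π := rfl

theorem dvd_iff (N : ℕ) (a : c.integers) : c.ϖ ^ N ∣ a ↔ ‖(a : ℂ_[p])‖ ≤ ‖c.π‖ ^ N := by
  constructor
  · rintro ⟨b, rfl⟩
    rw [Subring.coe_mul, Subring.coe_pow, coe_ϖ, norm_mul, norm_pow]
    exact mul_le_of_le_one_right (pow_nonneg (norm_nonneg _) _) b.2.2
  · intro h
    refine ⟨⟨(c.π ^ N)⁻¹ * a, mul_mem (inv_mem (pow_mem c.π_mem _)) a.2.1, ?_⟩, ?_⟩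
    · rw [norm_mul, norm_inv, norm_pow, inv_mul_le_iff₀ (pow_pos c.norm_π_pos _), mul_one]
      exact h
    · apply Subtype.ext
      rw [Subring.coe_mul, Subring.coe_pow, coe_ϖ, mul_inv_cancel_left₀ (pow_ne_zero _ c.π_ne_zero)]

theorem ϖ_regular (a : c.integers) (h : c.ϖ * a = 0) : a = 0 := by
  rcases mul_eq_zero.1 h with h | h
  · exact absurd (congrArg Subtype.val h) c.π_ne_zero
  · exact h

theorem ϖ_separated (a : c.integers) (h : ∀ N, c.ϖ ^ N ∣ a) : a = 0 := by
  apply Subtype.ext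
  show (a : ℂ_[p]) = 0
  rw [← norm_le_zero_iff]
  refine ge_of_tendsto (tendsto_pow_atTop_nhds_zero_of_lt_one (norm_nonneg c.π) c.norm_π_lt_one) ?_
  exact Filter.Eventually.of_forall fun N => (c.dvd_iff N a).1 (h N)

theorem finiteDimensional_coeffField [Finite F] : FiniteDimensional ℚ_[p] c.coeffField := by
  have := Fintype.ofFinite F
  have hfin : Finite (Set.range c.T ∪ {c.ζ, c.π} : Set ℂ_[p]) :=
    ((Set.finite_range c.T).union (Set.toFinite _))
  refine IntermediateField.finiteDimensional_adjoin fun x hx => ?_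
  have key : ∀ (x : ℂ_[p]) (N : ℕ) (a : ℚ_[p]), 0 < N → x ^ N = algebraMap ℚ_[p] ℂ_[p] a → IsIntegral ℚ_[p] x := by
    intro x N a hN h
    exact ⟨Polynomial.X ^ N - Polynomial.C a, Polynomial.monic_X_pow_sub_C _ hN.ne', by simp [h]⟩
  rcases hx with ⟨y, rfl⟩ | rfl | rfl
  · by_cases hy : y = 0
    · rw [hy, map_zero]; exact isIntegral_zero
    · have hq : 1 < Fintype.card F := Fintype.one_lt_card
      refine key _ (Fintype.card F - 1) 1 (by omega) ?_
      rw [← map_pow, FiniteField.pow_card_sub_one_eq_one y hy, map_one, map_one]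
  · exact key _ p 1 hp.out.pos (by rw [c.isPrimitiveRoot.pow_eq_one, map_one])
  · exact key _ c.M (p : ℚ_[p]) c.M_pos (by rw [c.π_pow, map_natCast])

/-- The field generated is finite over `ℚ_p`, and a finite-dimensional subspace over a complete
field is closed. This keeps limits taken in `ℂ_p` inside the ring of integers. -/
theorem isClosed_integers [Finite F] : IsClosed (c.integers : Set ℂ_[p]) := by
  have := c.finiteDimensional_coeffField
  have h1 : IsClosed (c.coeffField.toSubmodule : Set ℂ_[p]) := by
    have : FiniteDimensional ℚ_[p] (Subalgebra.toSubmodule c.coeffField.toSubalgebra) := this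
    exact Submodule.closed_of_finiteDimensional _
  have h2 : (c.integers : Set ℂ_[p]) = (c.coeffField.toSubmodule : Set ℂ_[p]) ∩ {x | ‖x‖ ≤ 1} := rfl
  rw [h2]
  exact h1.inter (isClosed_le continuous_norm continuous_const)

theorem exists_adic_sum [Finite F] (a : ℕ → c.integers) :
    ∃ L, ∀ N, c.ϖ ^ N ∣ L - ∑ i ∈ Finset.range N, c.ϖ ^ i * a i := by
  have hsum : ∀ b : ℕ → c.integers, Summable fun i => c.π ^ i * (b i : ℂ_[p]) := by
    intro b
    refine Summable.of_norm_bounded (g := fun i => ‖c.π‖ ^ i)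
      (summable_geometric_of_lt_one (norm_nonneg _) c.norm_π_lt_one) fun i => ?_
    rw [norm_mul, norm_pow]
    exact mul_le_of_le_one_right (pow_nonneg (norm_nonneg _) _) (b i).2.2
  have hmem : ∀ b : ℕ → c.integers, ∑' i, c.π ^ i * (b i : ℂ_[p]) ∈ c.integers := by
    intro b
    refine c.isClosed_integers.mem_of_tendsto (hsum b).hasSum.tendsto_sum_nat
      (Filter.Eventually.of_forall fun N => sum_mem fun i _ => mul_mem (pow_mem c.ϖ.2 _) (b i).2)
  refine ⟨⟨_, hmem a⟩, fun N => ⟨⟨_, hmem fun i => a (i + N)⟩, ?_⟩⟩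
  apply Subtype.ext
  have h1 := (hsum a).sum_add_tsum_nat_add N
  show (∑' i, c.π ^ i * (a i : ℂ_[p])) - ((∑ i ∈ Finset.range N, c.ϖ ^ i * a i : c.integers) : ℂ_[p]) =
    c.π ^ N * ∑' i, c.π ^ i * (a (i + N) : ℂ_[p])
  rw [AddSubmonoidClass.coe_finsetSum]
  simp only [Subring.coe_mul, Subring.coe_pow, coe_ϖ]
  rw [← h1, add_sub_cancel_left, ← tsum_mul_left]
  refine tsum_congr fun i => ?_
  rw [pow_add]; ring

/-- The factor `π^(Mb) / γ` of the boundary operator. -/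
def factor : ℂ_[p] := c.π ^ c.Mb * c.γ⁻¹

theorem γ_ne_zero : c.γ ≠ 0 := by
  obtain ⟨M', h1, h2, h3, h4, h5⟩ := c.exists_M
  intro h
  rw [h, norm_zero] at h5
  exact pow_ne_zero _ c.norm_π_pos.ne' h5.symm

theorem factor_mem : c.factor ∈ c.coeffField :=
  mul_mem (pow_mem c.π_mem _) (inv_mem c.γ_mem_coeffField)

theorem norm_factor_le : ‖c.factor‖ ≤ ‖c.π‖ := by
  obtain ⟨M', h1, h2, h3, h4, h5⟩ := c.exists_M
  rw [factor, norm_mul, norm_inv, norm_pow, h5, ← div_eq_mul_inv,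
    div_le_iff₀ (pow_pos c.norm_π_pos _), ← pow_succ']
  exact pow_le_pow_of_le_one (norm_nonneg _) c.norm_π_lt_one.le h3

/-- The factor `π^(Mb) / γ`, as an integer. -/
def factorInt : c.integers := ⟨c.factor, c.factor_mem, c.norm_factor_le.trans c.norm_π_lt_one.le⟩

theorem ϖ_dvd_factorInt : c.ϖ ∣ c.factorInt := by
  have := (c.dvd_iff 1 c.factorInt).2 (by rw [pow_one]; exact c.norm_factor_le)
  rwa [pow_one] at this

theorem sub_one_mul_add_pow_le {q : ℕ} (hq : 1 ≤ q) (l k : ℕ) : (q - 1) * k + q ^ l ≤ q ^ (l + k) := by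
  induction k with
  | zero => simp
  | succ k ih =>
    obtain ⟨q, rfl⟩ := Nat.exists_eq_add_of_le' hq
    rw [Nat.add_sub_cancel] at *
    have h1 : 1 ≤ (q + 1) ^ (l + k) := Nat.one_le_pow _ _ (by omega)
    calc q * (k + 1) + (q + 1) ^ l = (q * k + (q + 1) ^ l) + q * 1 := by ring
      _ ≤ (q + 1) ^ (l + k) + q * (q + 1) ^ (l + k) := add_le_add ih (Nat.mul_le_mul_left _ h1)
      _ = (q + 1) ^ (l + (k + 1)) := by ring

/-- Since the series vanishes at `γ`, the partial sum is minus the tail. No term of the tail exceeds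
the term of index `l + 1`, because by `sub_one_mul_add_pow_le` the growth of `p^i` outweighs the
denominators `p^i`. -/
theorem norm_gammaTrunc_le {M' : ℕ} (hM : c.M = (p - 1) * M') (hγ : ‖c.γ‖ = ‖c.π‖ ^ M') (l : ℕ) :
    ‖c.gammaTrunc l‖ ≤ ‖c.π‖ ^ (M' * p ^ (l + 1)) / ‖c.π‖ ^ (c.M * (l + 1)) := by
  have hterm : ∀ i, ‖c.γ ^ p ^ (i + (l + 1)) / (p : ℂ_[p]) ^ (i + (l + 1))‖ ≤
      ‖c.π‖ ^ (M' * p ^ (l + 1)) / ‖c.π‖ ^ (c.M * (l + 1)) := by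
    intro i
    rw [norm_div, norm_pow, norm_pow, hγ, c.norm_p_eq, ← pow_mul, ← pow_mul,
      div_le_div_iff₀ (pow_pos c.norm_π_pos _) (pow_pos c.norm_π_pos _), ← pow_add, ← pow_add]
    refine pow_le_pow_of_le_one (norm_nonneg _) c.norm_π_lt_one.le ?_
    have h1 := Nat.mul_le_mul_left M' (sub_one_mul_add_pow_le hp.out.one_lt.le (l + 1) i)
    rw [hM, add_comm i (l + 1)]
    nlinarith
  have h1 : Filter.Tendsto (fun N => ∑ i ∈ Finset.range N,
      c.γ ^ p ^ (i + (l + 1)) / (p : ℂ_[p]) ^ (i + (l + 1))) Filter.atTop (𝓝 (-c.gammaTrunc l)) := by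
    have h2 := ((hasSum_nat_add_iff' (l + 1)).2 c.γ_root).tendsto_sum_nat
    rwa [zero_sub] at h2
  rw [← norm_neg]
  refine le_of_tendsto h1.norm (Filter.Eventually.of_forall fun N => ?_)
  exact IsUltrametricDist.norm_sum_le_of_forall_le_of_nonneg
    (div_nonneg (pow_nonneg (norm_nonneg _) _) (pow_nonneg (norm_nonneg _) _)) fun i _ => hterm i

/-- The normalized coefficient `(π^(Mb) / γ) p^l γ_l π^(-Mb p^l)`. -/
def kappa (l : ℕ) : ℂ_[p] :=
  c.factor * (p : ℂ_[p]) ^ l * c.gammaTrunc l / c.π ^ (c.Mb * p ^ l)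

theorem kappa_zero : c.kappa 0 = 1 := by
  have h1 := c.γ_ne_zero
  have h2 := pow_ne_zero c.Mb c.π_ne_zero
  simp only [kappa, factor, gammaTrunc, zero_add, Finset.sum_range_one, pow_zero, pow_one, div_one,
    mul_one]
  field_simp

/-- Counting orders with `M = (p-1) M'` leaves the exponent `(p M' - Mb)(p^l - 1)`, which is at
least `l` because `Mb < p M'` and `l + 1 ≤ p^l`. -/
theorem norm_kappa_le (l : ℕ) : ‖c.kappa l‖ ≤ ‖c.π‖ ^ l := by
  obtain ⟨M', h1, h2, h3, h4, h5⟩ := c.exists_M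
  have h6 := c.norm_gammaTrunc_le h2 h5 l
  have hρ := c.norm_π_pos
  have hq := hp.out.one_lt
  rw [le_div_iff₀ (pow_pos hρ _)] at h6
  rw [kappa, factor, norm_div, norm_mul, norm_mul, norm_mul, norm_inv, norm_pow, norm_pow, norm_pow,
    h5, c.norm_p_eq, div_le_iff₀ (pow_pos hρ _), ← pow_mul]
  have h7 : ‖c.π‖ ^ c.Mb * (‖c.π‖ ^ M')⁻¹ * ‖c.π‖ ^ (c.M * l) * ‖c.gammaTrunc l‖ =
      (‖c.π‖ ^ c.Mb * ‖c.π‖ ^ (c.M * l) * ‖c.gammaTrunc l‖) / ‖c.π‖ ^ M' := by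
    field_simp
  rw [h7, div_le_iff₀ (pow_pos hρ _), ← mul_le_mul_iff_left₀ (pow_pos hρ (c.M * (l + 1)))]
  calc _ = ‖c.π‖ ^ c.Mb * ‖c.π‖ ^ (c.M * l) * (‖c.gammaTrunc l‖ * ‖c.π‖ ^ (c.M * (l + 1))) := by ring
    _ ≤ ‖c.π‖ ^ c.Mb * ‖c.π‖ ^ (c.M * l) * ‖c.π‖ ^ (M' * p ^ (l + 1)) :=
        mul_le_mul_of_nonneg_left h6 (by positivity)
    _ = ‖c.π‖ ^ (c.Mb + c.M * l + M' * p ^ (l + 1)) := by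
        rw [pow_add _ (c.Mb + c.M * l), pow_add _ c.Mb]
    _ ≤ ‖c.π‖ ^ (l + c.Mb * p ^ l + M' + c.M * (l + 1)) := by
        refine pow_le_pow_of_le_one hρ.le c.norm_π_lt_one.le ?_
        have h8 : l + 1 ≤ p ^ l := Nat.lt_pow_self hq
        obtain ⟨u, hu⟩ := Nat.exists_eq_add_of_le' h8
        obtain ⟨q, rfl⟩ := Nat.exists_eq_add_of_lt hq
        rw [pow_succ, hu, h2]
        have h9 : 1 + q + 1 - 1 = 1 + q := by omega
        rw [h9]
        obtain ⟨w, hw⟩ := Nat.exists_eq_add_of_lt h4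
        have h10 : c.Mb * (u + (l + 1)) + (w + 1) * (u + (l + 1)) = M' * ((u + (l + 1)) * (1 + q + 1)) := by
          rw [← add_mul, ← add_assoc, ← hw]; ring
        nlinarith
    _ = ‖c.π‖ ^ l * ‖c.π‖ ^ (c.Mb * p ^ l) * ‖c.π‖ ^ M' * ‖c.π‖ ^ (c.M * (l + 1)) := by
        rw [pow_add, pow_add, pow_add]

theorem kappa_mem (l : ℕ) : c.kappa l ∈ c.integers :=
  ⟨div_mem (mul_mem (mul_mem c.factor_mem (pow_mem (natCast_mem _ _) _)) (c.gammaTrunc_mem l))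
    (pow_mem c.π_mem _),
    (c.norm_kappa_le l).trans (pow_le_one₀ (norm_nonneg _) c.norm_π_lt_one.le)⟩

/-! ### The residue ring -/

theorem T_mem_integers [Finite F] (x : F) : c.T x ∈ c.integers := by
  have := Fintype.ofFinite F
  refine ⟨c.T_mem x, ?_⟩
  by_cases hx : x = 0
  · rw [hx, map_zero, norm_zero]; exact zero_le_one
  · have hq : 1 < Fintype.card F := Fintype.one_lt_card
    have h1 : ‖c.T x‖ ^ (Fintype.card F - 1) = 1 := by
      rw [← norm_pow, ← map_pow, FiniteField.pow_card_sub_one_eq_one x hx, map_one, norm_one]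
    exact (pow_le_one_iff_of_nonneg (norm_nonneg _) (by omega)).1 h1.le

/-- The residue ring of the integers modulo `π`. -/
abbrev Res : Type := c.integers ⧸ Ideal.span {c.ϖ}

theorem charP_res : CharP c.Res p := by
  have : Nontrivial c.Res := by
    refine Ideal.Quotient.nontrivial_iff.2 fun h => ?_
    rw [Ideal.span_singleton_eq_top] at h
    obtain ⟨b, hb⟩ := isUnit_iff_dvd_one.1 h
    have h1 := congrArg (fun x : c.integers => ‖(x : ℂ_[p])‖) hb
    simp only [Subring.coe_one, norm_one, Subring.coe_mul, norm_mul, coe_ϖ] at h1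
    have := mul_le_of_le_one_right (norm_nonneg c.π) b.2.2
    have := c.norm_π_lt_one
    linarith
  refine (CharP.charP_iff_prime_eq_zero hp.out).2 ?_
  have h1 : (p : c.integers) = c.ϖ ^ c.M := Subtype.ext (by
    rw [Subring.coe_pow, coe_ϖ, c.π_pow]; rfl)
  rw [← map_natCast (Ideal.Quotient.mk (Ideal.span {c.ϖ})), h1, map_pow,
    Ideal.Quotient.eq_zero_iff_mem.2 (Ideal.mem_span_singleton_self _), zero_pow c.M_pos.ne']

/-- The Teichmüller lift, followed by reduction modulo `π`, is a homomorphism of rings. -/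
def residueHom [Finite F] [CharP F p] : F →+* c.Res where
  toFun x := Ideal.Quotient.mk _ ⟨c.T x, c.T_mem_integers x⟩
  map_one' := by
    rw [← map_one (Ideal.Quotient.mk (Ideal.span {c.ϖ}))]
    congr 1
    exact Subtype.ext (map_one c.T)
  map_mul' x y := by
    rw [← map_mul]
    congr 1
    exact Subtype.ext (map_mul c.T x y)
  map_zero' := by
    rw [← map_zero (Ideal.Quotient.mk (Ideal.span {c.ϖ}))]
    congr 1
    exact Subtype.ext (map_zero c.T)
  map_add' x y := by
    have := Fintype.ofFinite F
    have := c.charP_res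
    set R : F → c.integers := fun x => ⟨c.T x, c.T_mem_integers x⟩ with hR
    obtain ⟨⟨e, he⟩, -, hcard⟩ := FiniteField.card F p
    have hR_pow : ∀ j x, R x = R x ^ p ^ (e * j) := by
      intro j x
      induction j with
      | zero => simp
      | succ j ih =>
        rw [Nat.mul_succ, pow_add, pow_mul, ← ih]
        apply Subtype.ext
        rw [Subring.coe_pow]
        show c.T x = c.T x ^ _
        rw [← map_pow]
        have h2 := FiniteField.pow_card x
        rw [hcard] at h2
        exact congrArg _ h2.symm
    set ε : c.integers := R (x + y) - (R x + R y) with hε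
    have hε1 : ‖(ε : ℂ_[p])‖ < 1 := c.T_add x y
    -- The additive defect `ε` has norm less than `1`, but `π` need not be a uniformizer and need
    -- not divide it. A high power of the `q`-Frobenius fixes all Teichmüller representatives, is
    -- additive in characteristic `p`, and kills `ε` modulo `π`.
    obtain ⟨j, hj⟩ := exists_pow_lt_of_lt_one c.norm_π_pos hε1
    have hε0 : Ideal.Quotient.mk (Ideal.span {c.ϖ}) ε ^ p ^ (e * j) = 0 := by
      rw [← map_pow, Ideal.Quotient.eq_zero_iff_mem, Ideal.mem_span_singleton]
      have h3 := (c.dvd_iff 1 (ε ^ p ^ (e * j))).2 ?_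
      · rwa [pow_one] at h3
      · rw [Subring.coe_pow, norm_pow, pow_one]
        refine (pow_le_pow_of_le_one (norm_nonneg _) hε1.le ?_).trans hj.le
        exact (Nat.le_mul_of_pos_left j he).trans (Nat.lt_pow_self hp.out.one_lt).le
    have h4 : R (x + y) = R x + R y + ε := by rw [hε]; ring
    show Ideal.Quotient.mk _ (R (x + y)) = Ideal.Quotient.mk _ (R x) + Ideal.Quotient.mk _ (R y)
    rw [hR_pow j (x + y), h4, map_pow, map_add, map_add, add_pow_char_pow, add_pow_char_pow, hε0,
      add_zero, ← map_pow, ← map_pow, ← hR_pow, ← hR_pow]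

theorem residueHom_apply [Finite F] [CharP F p] (x : F) :
    c.residueHom x = Ideal.Quotient.mk _ ⟨c.T x, c.T_mem_integers x⟩ := rfl

theorem isUnit_natCast {k : ℕ} (hk : ¬ p ∣ k) : IsUnit (k : c.integers) := by
  have h1 : ‖(k : ℂ_[p])‖ = 1 := by
    rw [norm_natCast]
    have h2 := mt Padic.norm_natCast_lt_one_iff.1 hk
    exact le_antisymm (by exact_mod_cast Padic.norm_int_le_one (p := p) (k : ℤ)) (not_lt.1 h2)
  have h0 : (k : ℂ_[p]) ≠ 0 := fun h => by rw [h, norm_zero] at h1; exact zero_ne_one h1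
  refine IsUnit.of_mul_eq_one ⟨(k : ℂ_[p])⁻¹, inv_mem (natCast_mem _ _), by rw [norm_inv, h1, inv_one]⟩ ?_
  apply Subtype.ext
  show (k : ℂ_[p]) * (k : ℂ_[p])⁻¹ = 1
  exact mul_inv_cancel₀ h0

end Constants

/-! ### The coefficients of `H` -/

section TotalPoly

variable {n r : ℕ} {F : Type*} [Field F]

theorem ydeg_smul (a : ℕ) (m : Var n r →₀ ℕ) : ydeg (a • m) = a * ydeg m := by
  simp [ydeg, Finset.mul_sum]

theorem ydeg_add (m m' : Var n r →₀ ℕ) : ydeg (m + m') = ydeg m + ydeg m' := by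
  simp [ydeg, Finset.sum_add_distrib]

theorem ydeg_single_inr (j : Fin r) : ydeg (Finsupp.single (.inr j : Var n r) 1) = 1 := by
  rw [ydeg, Finset.sum_eq_single j]
  · simp
  · intro i _ hi; exact Finsupp.single_eq_of_ne (by simpa using hi)
  · simp

theorem exists_of_coeff_totalPoly_ne_zero {f : Fin r → MvPolynomial (Fin (n + 1)) F}
    {m : Var n r →₀ ℕ} (h : MvPolynomial.coeff m (totalPoly f) ≠ 0) :
    ∃ (j : Fin r) (u : Fin (n + 1) →₀ ℕ), m = u.mapDomain Sum.inl + Finsupp.single (.inr j) 1 ∧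
      MvPolynomial.coeff u (f j) ≠ 0 := by
  rw [totalPoly, MvPolynomial.coeff_sum] at h
  obtain ⟨j, _, h1⟩ := Finset.exists_ne_zero_of_sum_ne_zero h
  rw [MvPolynomial.coeff_X_mul'] at h1
  split_ifs at h1 with h2
  · obtain ⟨u, hu, hu'⟩ := MvPolynomial.coeff_rename_ne_zero _ _ _ h1
    refine ⟨j, u, ?_, hu'⟩
    rw [hu, tsub_add_cancel_of_le]
    rw [Finsupp.single_le_iff]
    exact Nat.one_le_iff_ne_zero.2 (Finsupp.mem_support_iff.1 h2)
  · exact absurd rfl h1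

theorem ydeg_mapDomain_inl (u : Fin (n + 1) →₀ ℕ) : ydeg (u.mapDomain Sum.inl : Var n r →₀ ℕ) = 0 := by
  rw [ydeg]
  exact Finset.sum_eq_zero fun j _ => Finsupp.mapDomain_of_notMem_range _ _ (by simp)

theorem ydeg_of_coeff_totalPoly_ne_zero {f : Fin r → MvPolynomial (Fin (n + 1)) F}
    {m : Var n r →₀ ℕ} (h : MvPolynomial.coeff m (totalPoly f) ≠ 0) : ydeg m = 1 := by
  obtain ⟨j, u, rfl, _⟩ := exists_of_coeff_totalPoly_ne_zero h
  rw [ydeg_add, ydeg_mapDomain_inl, ydeg_single_inr]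

theorem sum_wt_single (d : Fin r → ℕ) (i : Var n r) :
    ∑ z, ((Finsupp.single i 1 : Var n r →₀ ℕ) z : ℤ) * wt d z = wt d i := by
  rw [Finset.sum_eq_single i]
  · simp
  · intro z _ hz; simp [Finsupp.single_eq_of_ne hz]
  · simp

theorem weight_of_coeff_totalPoly_ne_zero {f : Fin r → MvPolynomial (Fin (n + 1)) F}
    {d : Fin r → ℕ} (hf : ∀ j, (f j).IsHomogeneous (d j))
    {m : Var n r →₀ ℕ} (h : MvPolynomial.coeff m (totalPoly f) ≠ 0) :
    ∑ z, (m z : ℤ) * wt d z = 0 := by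
  obtain ⟨j, u, rfl, hu⟩ := exists_of_coeff_totalPoly_ne_zero h
  have h1 := weight_of_coeff_rename (r := r) (d := d) (hf j) (m := u.mapDomain Sum.inl) (by
    rwa [MvPolynomial.coeff_rename_mapDomain _ Sum.inl_injective])
  simp only [Finsupp.add_apply, Nat.cast_add, add_mul, Finset.sum_add_distrib]
  rw [h1, sum_wt_single]
  simp [wt]

end TotalPoly

namespace Constants

variable {p : ℕ} [hp : Fact p.Prime] {F : Type*} [Field F] (c : Constants p F) {n r : ℕ}

theorem pow_smul_injective (l : ℕ) : Function.Injective fun m : Var n r →₀ ℕ => p ^ l • m := by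
  intro m m' h
  ext z
  have := DFunLike.congr_fun h z
  simp only [Finsupp.smul_apply, smul_eq_mul] at this
  exact Nat.eq_of_mul_eq_mul_left (pow_pos hp.out.pos l) this

theorem coeff_twistedLift_smul (f : Fin r → MvPolynomial (Fin (n + 1)) F) (l : ℕ)
    (m : Var n r →₀ ℕ) : MvPolynomial.coeff (p ^ l • m) (c.twistedLift f l) =
      c.T (MvPolynomial.coeff m (totalPoly f)) ^ p ^ l := by
  classical
  rw [twistedLift, MvPolynomial.coeff_sum]
  simp only [MvPolynomial.coeff_monomial, (pow_smul_injective l).eq_iff, Finset.sum_ite_eq',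
    MvPolynomial.mem_support_iff]
  split_ifs with h
  · rfl
  · rw [not_not.1 h, map_zero, zero_pow (pow_pos hp.out.pos l).ne']

theorem exists_of_coeff_twistedLift_ne_zero {f : Fin r → MvPolynomial (Fin (n + 1)) F} {l : ℕ}
    {m : Var n r →₀ ℕ} (h : MvPolynomial.coeff m (c.twistedLift f l) ≠ 0) :
    ∃ m₀, MvPolynomial.coeff m₀ (totalPoly f) ≠ 0 ∧ m = p ^ l • m₀ := by
  classical
  rw [twistedLift, MvPolynomial.coeff_sum] at h
  obtain ⟨m₀, h1, h2⟩ := Finset.exists_ne_zero_of_sum_ne_zero h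
  rw [MvPolynomial.coeff_monomial] at h2
  split_ifs at h2 with h3
  · exact ⟨m₀, MvPolynomial.mem_support_iff.1 h1, h3.symm⟩
  · exact absurd rfl h2

/-- The `l`-th term of `H` is homogeneous of degree `p^l` in `y`, so the exponent determines `l` and
the sum defining the coefficient has one term. -/
theorem coeff_hSeries_smul (f : Fin r → MvPolynomial (Fin (n + 1)) F) (l : ℕ)
    {m : Var n r →₀ ℕ} (hm : ydeg m = 1) : MvPowerSeries.coeff (p ^ l • m) (c.hSeries f) =
      c.gammaTrunc l * c.T (MvPolynomial.coeff m (totalPoly f)) ^ p ^ l := by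
  rw [← c.coeff_twistedLift_smul f l m]
  refine finsum_eq_single (fun l' => c.gammaTrunc l' * MvPolynomial.coeff (p ^ l • m) (c.twistedLift f l'))
    l fun l' hl => ?_
  by_contra h
  obtain ⟨m₀, h1, h2⟩ := c.exists_of_coeff_twistedLift_ne_zero (right_ne_zero_of_mul h)
  have h3 := congrArg ydeg h2
  rw [ydeg_smul, ydeg_smul, hm, ydeg_of_coeff_totalPoly_ne_zero h1, mul_one, mul_one] at h3
  exact hl (Nat.pow_right_injective hp.out.two_le h3).symm

theorem exists_of_coeff_hSeries_ne_zero {f : Fin r → MvPolynomial (Fin (n + 1)) F}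
    {m : Var n r →₀ ℕ} (h : MvPowerSeries.coeff m (c.hSeries f) ≠ 0) :
    ∃ l m₀, MvPolynomial.coeff m₀ (totalPoly f) ≠ 0 ∧ m = p ^ l • m₀ := by
  obtain ⟨l, hl⟩ : ∃ l, c.gammaTrunc l * MvPolynomial.coeff m (c.twistedLift f l) ≠ 0 := by
    by_contra! h0
    exact h (finsum_eq_zero_of_forall_eq_zero
      (f := fun l => c.gammaTrunc l * MvPolynomial.coeff m (c.twistedLift f l)) h0)
  obtain ⟨m₀, h1, h2⟩ := c.exists_of_coeff_twistedLift_ne_zero (right_ne_zero_of_mul hl)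
  exact ⟨l, m₀, h1, h2⟩

theorem weight_of_coeff_hSeries_ne_zero {f : Fin r → MvPolynomial (Fin (n + 1)) F}
    {d : Fin r → ℕ} (hf : ∀ j, (f j).IsHomogeneous (d j)) {m : Var n r →₀ ℕ}
    (h : MvPowerSeries.coeff m (c.hSeries f) ≠ 0) : ∑ z, (m z : ℤ) * wt d z = 0 := by
  obtain ⟨l, m₀, h1, rfl⟩ := c.exists_of_coeff_hSeries_ne_zero h
  have := weight_of_coeff_totalPoly_ne_zero hf h1
  simp only [Finsupp.smul_apply, smul_eq_mul, Nat.cast_mul, mul_assoc, ← Finset.mul_sum, this,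
    mul_zero]

/-- The coefficients of the gradient of `π^(Mb) γ⁻¹ H`, with `y` replaced by `π^(-Mb) y`. -/
def psiVal (f : Fin r → MvPolynomial (Fin (n + 1)) F) (i : Var n r) (a : Var n r →₀ ℕ) : ℂ_[p] :=
  c.factor * MvPowerSeries.coeff a (MvPowerSeries.pderiv ℂ_[p] i (c.hSeries f)) /
    c.π ^ (c.Mb * ydeg (a + Finsupp.single i 1))

/-- Differentiating a monomial that is a `p^l`-th power yields an extra factor `p^l`. It is absorbed
in `kappa` and provides part of the decay of the gradient. -/
theorem psiVal_of_eq_smul (f : Fin r → MvPolynomial (Fin (n + 1)) F) {i : Var n r}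
    {a m₀ : Var n r →₀ ℕ} {l : ℕ} (hm : ydeg m₀ = 1) (h : a + Finsupp.single i 1 = p ^ l • m₀) :
    c.psiVal f i a = m₀ i * c.T (MvPolynomial.coeff m₀ (totalPoly f)) ^ p ^ l * c.kappa l := by
  have h1 : ((a i : ℂ_[p]) + 1) = (p : ℂ_[p]) ^ l * m₀ i := by
    have := DFunLike.congr_fun h i
    rw [Finsupp.add_apply, Finsupp.single_eq_same, Finsupp.smul_apply, smul_eq_mul] at this
    exact_mod_cast this
  rw [psiVal, MvPowerSeries.coeff_pderiv, h, c.coeff_hSeries_smul f l hm, h1, ydeg_smul, hm, mul_one,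
    kappa]
  ring

theorem psiVal_eq_zero_or (f : Fin r → MvPolynomial (Fin (n + 1)) F) (i : Var n r)
    (a : Var n r →₀ ℕ) : c.psiVal f i a = 0 ∨ ∃ l m₀, MvPolynomial.coeff m₀ (totalPoly f) ≠ 0 ∧
      a + Finsupp.single i 1 = p ^ l • m₀ ∧
      c.psiVal f i a = m₀ i * c.T (MvPolynomial.coeff m₀ (totalPoly f)) ^ p ^ l * c.kappa l := by
  by_cases h : MvPowerSeries.coeff (a + Finsupp.single i 1) (c.hSeries f) = 0
  · left
    rw [psiVal, MvPowerSeries.coeff_pderiv, h]; simp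
  · right
    obtain ⟨l, m₀, h1, h2⟩ := c.exists_of_coeff_hSeries_ne_zero h
    exact ⟨l, m₀, h1, h2, c.psiVal_of_eq_smul f (ydeg_of_coeff_totalPoly_ne_zero h1) h2⟩

variable [Finite F]

theorem psiVal_mem (f : Fin r → MvPolynomial (Fin (n + 1)) F) (i : Var n r)
    (a : Var n r →₀ ℕ) : c.psiVal f i a ∈ c.integers := by
  rcases c.psiVal_eq_zero_or f i a with h | ⟨l, m₀, -, -, h⟩
  · rw [h]; exact zero_mem _
  · rw [h]; exact mul_mem (mul_mem (natCast_mem _ _) (pow_mem (c.T_mem_integers _) _)) (c.kappa_mem l)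

/-- The gradient of `π^(Mb) γ⁻¹ H`, with `y` replaced by `π^(-Mb) y`. -/
def psi (f : Fin r → MvPolynomial (Fin (n + 1)) F) (i : Var n r) :
    MvPowerSeries (Var n r) c.integers := fun a => ⟨c.psiVal f i a, c.psiVal_mem f i a⟩

theorem coeff_psi (f : Fin r → MvPolynomial (Fin (n + 1)) F) (i : Var n r) (a : Var n r →₀ ℕ) :
    ((MvPowerSeries.coeff a (c.psi f i) : c.integers) : ℂ_[p]) = c.psiVal f i a := rfl

theorem coeff_psi_eq_zero_or (f : Fin r → MvPolynomial (Fin (n + 1)) F) (i : Var n r)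
    (a : Var n r →₀ ℕ) : MvPowerSeries.coeff a (c.psi f i) = 0 ∨
      ∃ l m₀, MvPolynomial.coeff m₀ (totalPoly f) ≠ 0 ∧
      a + Finsupp.single i 1 = p ^ l • m₀ ∧ c.ϖ ^ l ∣ MvPowerSeries.coeff a (c.psi f i) := by
  rcases c.psiVal_eq_zero_or f i a with h | ⟨l, m₀, h1, h2, h⟩
  · exact Or.inl (Subtype.ext h)
  · refine Or.inr ⟨l, m₀, h1, h2, ?_⟩
    rw [dvd_iff, coeff_psi, h, norm_mul]
    refine (mul_le_of_le_one_left (norm_nonneg _) ?_).trans (c.norm_kappa_le l)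
    exact (mul_mem (natCast_mem c.integers _) (pow_mem (c.T_mem_integers _) _)).2

theorem psi_mem_tateRing (f : Fin r → MvPolynomial (Fin (n + 1)) F) (i : Var n r) :
    c.psi f i ∈ tateRing (Var n r) c.ϖ := by
  intro N
  have hfin : (Set.image2 (fun l m₀ => p ^ l • m₀) (Finset.range N : Set ℕ)
      ((totalPoly f).support : Set (Var n r →₀ ℕ))).Finite :=
    Set.Finite.image2 _ (Finset.finite_toSet _) (Finset.finite_toSet _)
  refine (hfin.preimage (f := (· + Finsupp.single i 1)) (add_left_injective _).injOn).subset
    fun a ha => ?_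
  rcases c.coeff_psi_eq_zero_or f i a with h | ⟨l, m₀, h1, h2, h3⟩
  · exact absurd (h ▸ dvd_zero _) ha
  · refine ⟨l, ?_, m₀, ?_, h2.symm⟩
    · rw [Finset.mem_coe, Finset.mem_range]
      by_contra h4
      exact ha ((pow_dvd_pow _ (not_lt.1 h4)).trans h3)
    · exact MvPolynomial.mem_support_iff.2 h1

theorem weight_of_coeff_psi {f : Fin r → MvPolynomial (Fin (n + 1)) F} {d : Fin r → ℕ}
    (hf : ∀ j, (f j).IsHomogeneous (d j)) (i : Var n r) (a : Var n r →₀ ℕ)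
    (h : MvPowerSeries.coeff a (c.psi f i) ≠ 0) : ∑ z, (a z : ℤ) * wt d z = - wt d i := by
  have h1 : MvPowerSeries.coeff (a + Finsupp.single i 1) (c.hSeries f) ≠ 0 := by
    intro h0
    refine h (Subtype.ext ?_)
    rw [coeff_psi, psiVal, MvPowerSeries.coeff_pderiv, h0]; simp
  have h2 := c.weight_of_coeff_hSeries_ne_zero hf h1
  simp only [Finsupp.add_apply, Nat.cast_add, add_mul, Finset.sum_add_distrib] at h2
  rw [sum_wt_single] at h2
  linarith

/-- The `l`-th term of `H` contributes multiples of `π^l`, so only `l = 0` survives, and its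
normalizing factor `kappa 0` is `1`. -/
theorem map_psi [CharP F p] (f : Fin r → MvPolynomial (Fin (n + 1)) F) (i : Var n r) :
    MvPowerSeries.map (Ideal.Quotient.mk (Ideal.span {c.ϖ})) (c.psi f i) =
      (polyGrad c.residueHom f i : MvPowerSeries (Var n r) c.Res) := by
  ext a
  rw [MvPowerSeries.coeff_map, MvPolynomial.coeff_coe, polyGrad, MvPolynomial.coeff_map,
    MvPolynomial.coeff_pderiv]
  by_cases hy : ydeg (a + Finsupp.single i 1) = 1
  · have h1 := c.psiVal_of_eq_smul f (i := i) (a := a) (l := 0) hy (by simp)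
    rw [pow_zero, pow_one, kappa_zero, mul_one] at h1
    have h2 : MvPowerSeries.coeff a (c.psi f i) =
        ((a i + 1 : ℕ) : c.integers) * ⟨c.T (MvPolynomial.coeff (a + Finsupp.single i 1) (totalPoly f)),
          c.T_mem_integers _⟩ := by
      apply Subtype.ext
      rw [coeff_psi, h1]
      simp
    rw [h2, map_mul, map_natCast, map_mul, residueHom_apply, mul_comm]
    congr 1
    push_cast
    rw [map_add, map_natCast, map_one]
  · have h1 : MvPolynomial.coeff (a + Finsupp.single i 1) (totalPoly f) = 0 := by
      by_contra h
      exact hy (ydeg_of_coeff_totalPoly_ne_zero h)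
    rw [h1, zero_mul, map_zero, Ideal.Quotient.eq_zero_iff_mem, Ideal.mem_span_singleton]
    rcases c.coeff_psi_eq_zero_or f i a with h | ⟨l, m₀, h2, h3, h4⟩
    · rw [h]; exact dvd_zero _
    · refine (dvd_pow_self _ ?_).trans h4
      rintro rfl
      rw [h3, ydeg_smul, ydeg_of_coeff_totalPoly_ne_zero h2] at hy
      simp at hy

end Constants

/-! ### Identities for differential forms -/

section FormIdentities

variable {n r : ℕ} {R : Type*} [CommRing R]

/-- The coefficientwise partial derivative of a form. -/
def formPD (i : Var n r) (ω : Finset (Var n r) → MvPowerSeries (Var n r) R) :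
    Finset (Var n r) → MvPowerSeries (Var n r) R := fun S => MvPowerSeries.pderiv R i (ω S)

theorem formPD_smul (i : Var n r) (g : MvPowerSeries (Var n r) R)
    (ω : Finset (Var n r) → MvPowerSeries (Var n r) R) :
    formPD i (g • ω) = MvPowerSeries.pderiv R i g • ω + g • formPD i ω := by
  funext S
  simp only [formPD, Pi.smul_apply, smul_eq_mul, Derivation.leibniz, Pi.add_apply]
  ring

theorem formPD_crea (i j : Var n r) (ω : Finset (Var n r) → MvPowerSeries (Var n r) R) :
    formPD i (crea vrk j ω) = crea vrk j (formPD i ω) := by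
  funext S
  simp only [formPD, crea_apply]
  split_ifs
  · rw [map_zsmul]
  · rw [map_zero]

theorem formPD_anni (i j : Var n r) (ω : Finset (Var n r) → MvPowerSeries (Var n r) R) :
    formPD i (anni vrk j ω) = anni vrk j (formPD i ω) := by
  funext S
  simp only [formPD, anni_apply]
  split_ifs
  · rw [map_zero]
  · rw [map_zsmul]

theorem pderiv_comm (i j : Var n r) (g : MvPowerSeries (Var n r) R) :
    MvPowerSeries.pderiv R i (MvPowerSeries.pderiv R j g) =
      MvPowerSeries.pderiv R j (MvPowerSeries.pderiv R i g) := by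
  ext m
  simp only [MvPowerSeries.coeff_pderiv, Finsupp.add_apply]
  by_cases h : i = j
  · subst h; rfl
  · rw [Finsupp.single_eq_of_ne h, Finsupp.single_eq_of_ne (Ne.symm h),
      add_right_comm m (Finsupp.single j 1)]
    push_cast; ring

theorem formPD_comm (i j : Var n r) (ω : Finset (Var n r) → MvPowerSeries (Var n r) R) :
    formPD i (formPD j ω) = formPD j (formPD i ω) := funext fun _ => pderiv_comm _ _ _

theorem formDeriv_eq (ω : Finset (Var n r) → MvPowerSeries (Var n r) R) :
    formDeriv ω = ∑ i, crea vrk i (formPD i ω) := by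
  funext S
  rw [Finset.sum_apply, formDeriv_apply]
  simp only [crea_apply]
  rw [← Finset.sum_filter]
  refine Finset.sum_congr ?_ fun _ _ => rfl
  ext i; simp

theorem formDeriv_formDeriv (ω : Finset (Var n r) → MvPowerSeries (Var n r) R) :
    formDeriv (formDeriv ω) = 0 := by
  simp only [formDeriv_eq, map_sum, formPD_crea]
  refine sum_sum_alternating _ (fun i => crea_crea_self _ _) fun i j h => ?_
  rw [crea_crea vrk_injective h.symm, formPD_comm]

/-- Closedness of `α` is required only after multiplication with `ω`. This admits `β_j`, which is
closed only modulo `dy_j`, when `ω` contains the factor `dy_j`. -/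
theorem formDeriv_extMul {α : Var n r → MvPowerSeries (Var n r) R}
    {ω : Finset (Var n r) → MvPowerSeries (Var n r) R}
    (h : ∀ i j, MvPowerSeries.pderiv R i (α j) • crea vrk i (crea vrk j ω) =
      MvPowerSeries.pderiv R j (α i) • crea vrk i (crea vrk j ω)) :
    formDeriv (extMul vrk α ω) = -extMul vrk α (formDeriv ω) := by
  rw [← add_eq_zero_iff_eq_neg]
  simp only [formDeriv_eq, extMul_eq, formPD_smul, map_sum, map_add, map_smul,
    formPD_crea]
  rw [← Finset.sum_add_distrib]
  simp only [← Finset.sum_add_distrib]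
  refine sum_sum_alternating _ (fun i => ?_) fun i j hij => ?_
  · simp only [crea_crea_self, smul_zero, add_zero]
  · rw [h i j, crea_crea vrk_injective hij, crea_crea vrk_injective hij,
      crea_crea vrk_injective hij (formPD j ω)]
    simp only [smul_neg]
    abel

theorem twistedD_twistedD {c : R} {ψ : Var n r → MvPowerSeries (Var n r) R}
    (h : ∀ i j, MvPowerSeries.pderiv R i (ψ j) = MvPowerSeries.pderiv R j (ψ i))
    (ω : Finset (Var n r) → MvPowerSeries (Var n r) R) :
    twistedD c ψ (twistedD c ψ ω) = 0 := by
  have h1 : extMul vrk ψ (c • formDeriv ω) = c • extMul vrk ψ (formDeriv ω) :=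
    LinearMap.map_smul_of_tower _ _ _
  rw [twistedD_apply, twistedD_apply, map_add, map_add, map_smul, formDeriv_formDeriv, smul_zero,
    zero_add, formDeriv_extMul (fun i j => by rw [h i j]), extMul_extMul_self vrk_injective, h1]
  simp

/-- Contraction with `∑ x_i ∂/∂x_i - ∑ d_j y_j ∂/∂y_j`. -/
def formTheta (d : Fin r → ℕ) : (Finset (Var n r) → MvPowerSeries (Var n r) R) →ₗ[R]
    (Finset (Var n r) → MvPowerSeries (Var n r) R) :=
  (extContr vrk fun i => wt d i • MvPowerSeries.X i).restrictScalars R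

theorem formTheta_apply (d : Fin r → ℕ) (ω : Finset (Var n r) → MvPowerSeries (Var n r) R) :
    formTheta d ω = extContr vrk (fun i => wt d i • MvPowerSeries.X i) ω := rfl

theorem formTheta_formTheta (d : Fin r → ℕ) (ω : Finset (Var n r) → MvPowerSeries (Var n r) R) :
    formTheta d (formTheta d ω) = 0 := extContr_extContr_self vrk_injective _ _

theorem coeff_X_mul_pderiv (i : Var n r) (g : MvPowerSeries (Var n r) R) (m : Var n r →₀ ℕ) :
    MvPowerSeries.coeff m (MvPowerSeries.X i * MvPowerSeries.pderiv R i g) =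
      m i * MvPowerSeries.coeff m g := by
  rw [MvPowerSeries.X, MvPowerSeries.coeff_monomial_mul]
  split_ifs with h
  · rw [one_mul, MvPowerSeries.coeff_pderiv, tsub_add_cancel_of_le h, mul_comm]
    congr 1
    rw [Finsupp.single_le_iff] at h
    rw [Finsupp.tsub_apply, Finsupp.single_eq_same, Nat.cast_sub h]; simp
  · rw [Finsupp.single_le_iff, not_le, Nat.lt_one_iff] at h
    rw [h]; simp

/-- Cartan's formula: the Lie derivative along the weighted Euler field multiplies each monomial
form by its weight. -/
theorem formDeriv_formTheta (d : Fin r → ℕ) (ω : Finset (Var n r) → MvPowerSeries (Var n r) R) :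
    formDeriv (formTheta d ω) + formTheta d (formDeriv ω) =
      fun S m => (formWt d m S : R) * MvPowerSeries.coeff m (ω S) := by
  have h1 : formDeriv (formTheta d ω) + formTheta d (formDeriv ω) =
      ∑ i, wt d i • (crea vrk i (anni vrk i ω) + (MvPowerSeries.X i : MvPowerSeries (Var n r) R) • formPD i ω) := by
    simp only [formTheta_apply, formDeriv_eq, extContr_eq, formPD_smul, map_sum, map_add,
      map_smul, formPD_anni]
    rw [Finset.sum_comm (f := fun j i => (wt d i • MvPowerSeries.X i : MvPowerSeries (Var n r) R) •
      anni vrk i (crea vrk j (formPD j ω))), ← Finset.sum_add_distrib]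
    refine Finset.sum_congr rfl fun i _ => ?_
    rw [← Finset.sum_add_distrib, Finset.sum_eq_single i]
    · have := crea_anni_self (rk := vrk) i (formPD i ω)
      conv_rhs => rw [← this]
      rw [map_zsmul, MvPowerSeries.pderiv_X_self]
      simp only [smul_assoc, one_smul, smul_add]
      abel
    · intro j _ h
      rw [crea_anni vrk_injective h, crea_anni vrk_injective h, map_zsmul,
        MvPowerSeries.pderiv_X_of_ne h.symm]
      simp
    · simp
  rw [h1]
  funext S
  ext m
  rw [Finset.sum_apply, map_sum]
  have h2 : ∀ i, MvPowerSeries.coeff m ((wt d i • (crea vrk i (anni vrk i ω) +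
      (MvPowerSeries.X i : MvPowerSeries (Var n r) R) • formPD i ω)) S) =
      ((((m i : ℤ) * wt d i + if i ∈ S then wt d i else 0) : ℤ) : R) * MvPowerSeries.coeff m (ω S) := by
    intro i
    have h3 : crea vrk i (anni vrk i ω) S = if i ∈ S then ω S else 0 := by
      simp only [crea_apply, anni_apply]
      split_ifs with hi hi'
      · simp at hi'
      · rw [smul_smul, esgn_erase hi, osgn_self, one_mul, esgn_mul_self, Finset.insert_erase hi, one_smul]
      · rfl
    rw [Pi.smul_apply, map_zsmul, Pi.add_apply, map_add, Pi.smul_apply, smul_eq_mul, h3, formPD,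
      coeff_X_mul_pderiv]
    split_ifs
    · rw [zsmul_eq_mul]; push_cast; ring
    · rw [zsmul_eq_mul, map_zero]; push_cast; ring
  rw [Finset.sum_congr rfl fun i _ => h2 i, ← Finset.sum_mul, ← Int.cast_sum, Finset.sum_add_distrib]
  simp only [Finset.sum_ite_mem, Finset.univ_inter]
  rfl

theorem FormWtZero.formDeriv_formTheta {d : Fin r → ℕ}
    {ω : Finset (Var n r) → MvPowerSeries (Var n r) R} (h : FormWtZero d ω) :
    DworkCI.formDeriv (DworkCI.formTheta d ω) = -DworkCI.formTheta d (DworkCI.formDeriv ω) := by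
  rw [← add_eq_zero_iff_eq_neg, DworkCI.formDeriv_formTheta]
  funext S
  ext m
  by_cases h0 : MvPowerSeries.coeff m (ω S) = 0
  · rw [h0, mul_zero]; rfl
  · rw [h S m h0, Int.cast_zero, zero_mul]; rfl

/-- The Lie derivative vanishes in weight zero, and the hypothesis on `ψ` says that its contraction
with the vector field is zero. -/
theorem FormWtZero.twistedD_formTheta {d : Fin r → ℕ} {c : R}
    {ψ : Var n r → MvPowerSeries (Var n r) R}
    (hψ : ∑ i, ψ i * (wt d i • MvPowerSeries.X i) = 0)
    {ω : Finset (Var n r) → MvPowerSeries (Var n r) R} (h : FormWtZero d ω) :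
    twistedD c ψ (DworkCI.formTheta d ω) = -DworkCI.formTheta d (twistedD c ψ ω) := by
  have h1 := extMul_extContr vrk_injective ψ (fun i => wt d i • MvPowerSeries.X i) ω
  rw [hψ, zero_smul, add_eq_zero_iff_eq_neg] at h1
  rw [twistedD_apply, twistedD_apply, h.formDeriv_formTheta, map_add, map_smul,
    DworkCI.formTheta_apply d ω, h1, DworkCI.formTheta_apply d (DworkCI.extMul vrk ψ ω), smul_neg, neg_add]

/-! ### Exactness of the contraction -/

/-- The multidegree of `∏_{z ∈ S} dz`. -/
def chi (S : Finset (Var n r)) : Var n r →₀ ℕ := ∑ i ∈ S, Finsupp.single i 1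

theorem chi_apply (S : Finset (Var n r)) (i : Var n r) : chi S i = if i ∈ S then 1 else 0 := by
  classical
  rw [chi, Finsupp.finsetSum_apply]
  simp [Finsupp.single_apply]

theorem chi_insert {S : Finset (Var n r)} {i : Var n r} (h : i ∉ S) :
    chi (insert i S) = Finsupp.single i 1 + chi S := Finset.sum_insert h

theorem chi_erase {S : Finset (Var n r)} {i : Var n r} (h : i ∈ S) :
    Finsupp.single i 1 + chi (S.erase i) = chi S := Finset.add_sum_erase S _ h

theorem formWt_eq_sum (d : Fin r → ℕ) (m : Var n r →₀ ℕ) (S : Finset (Var n r)) :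
    formWt d m S = ∑ i, ((m + chi S) i : ℤ) * wt d i := by
  simp only [Finsupp.add_apply, Nat.cast_add, add_mul, Finset.sum_add_distrib, chi_apply]
  simp [formWt]

/-- The part of multidegree `e` of a form. -/
def slice (e : Var n r →₀ ℕ) (ω : Finset (Var n r) → MvPowerSeries (Var n r) R) :
    Finset (Var n r) → R :=
  open Classical in fun S => if chi S ≤ e then MvPowerSeries.coeff (e - chi S) (ω S) else 0

theorem slice_add_chi (ω : Finset (Var n r) → MvPowerSeries (Var n r) R) (m : Var n r →₀ ℕ)
    (S : Finset (Var n r)) : slice (m + chi S) ω S = MvPowerSeries.coeff m (ω S) := by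
  rw [slice, if_pos le_add_self, add_tsub_cancel_right]

/-- The contraction preserves the multidegree that counts `z` and `dz` alike. In each multidegree it
becomes contraction with the constant vector of weights. -/
theorem slice_formTheta (d : Fin r → ℕ) (e : Var n r →₀ ℕ)
    (ω : Finset (Var n r) → MvPowerSeries (Var n r) R) :
    slice e (formTheta d ω) = extContr vrk (fun i => (wt d i : R)) (slice e ω) := by
  classical
  funext S
  rw [extContr_apply]
  by_cases h : chi S ≤ e
  · obtain ⟨m, rfl⟩ := exists_add_of_le h
    rw [add_comm, slice_add_chi, formTheta_apply, extContr_apply, map_sum]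
    refine Finset.sum_congr rfl fun i hi => ?_
    rw [Finset.mem_compl] at hi
    rw [map_zsmul, smul_mul_assoc, map_zsmul, zsmul_eq_mul (MvPowerSeries.coeff m _) (wt d i), slice, chi_insert hi,
      MvPowerSeries.X, MvPowerSeries.coeff_monomial_mul, add_tsub_add_eq_tsub_right]
    simp only [add_le_add_iff_right, one_mul]
  · rw [slice, if_neg h]
    symm
    refine Finset.sum_eq_zero fun i hi => ?_
    rw [Finset.mem_compl] at hi
    rw [slice, if_neg, mul_zero, smul_zero]
    rw [chi_insert hi]
    exact fun h' => h (le_add_self.trans h')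

/-- A homotopy for the contraction: division by `x_i` followed by multiplication by `d x_i`, where
`x_i` is a variable occurring in the multidegree. -/
def thetaHtpy (ω : Finset (Var n r) → MvPowerSeries (Var n r) R) :
    Finset (Var n r) → MvPowerSeries (Var n r) R :=
  open Classical in fun S m => if h : ∃ i : Fin (n + 1), (m + chi S) (.inl i) ≠ 0 then
    crea vrk (.inl h.choose) (slice (m + chi S) ω) S else 0

theorem slice_thetaHtpy {e : Var n r →₀ ℕ} (h : ∃ i : Fin (n + 1), e (.inl i) ≠ 0)
    (ω : Finset (Var n r) → MvPowerSeries (Var n r) R) :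
    slice e (thetaHtpy ω) = crea vrk (.inl h.choose) (slice e ω) := by
  classical
  funext S
  by_cases hS : chi S ≤ e
  · obtain ⟨m, rfl⟩ := exists_add_of_le hS
    rw [slice, if_pos hS, add_tsub_cancel_left]
    have h1 : MvPowerSeries.coeff m (thetaHtpy ω S) = if h : ∃ i : Fin (n + 1), (m + chi S) (.inl i) ≠ 0 then
      crea vrk (.inl h.choose) (slice (m + chi S) ω) S else 0 := rfl
    have h2 : chi S + m = m + chi S := add_comm _ _
    rw [h1]
    simp only [h2] at h ⊢
    rw [dif_pos h]
  · rw [slice, if_neg hS, crea_apply]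
    split_ifs with hi
    · rw [slice, if_neg, smul_zero]
      intro h'
      refine hS fun z => ?_
      have h1 := h' z
      have h2 := h.choose_spec
      rw [chi_apply] at h1 ⊢
      simp only [Finset.mem_erase] at h1
      by_cases hz : z = .inl h.choose
      · rw [hz, if_pos hi]; omega
      · simpa [hz] using h1
    · rfl

theorem exists_coeff_thetaHtpy (ω : Finset (Var n r) → MvPowerSeries (Var n r) R)
    {S : Finset (Var n r)} {m : Var n r →₀ ℕ} (h : MvPowerSeries.coeff m (thetaHtpy ω S) ≠ 0) :
    ∃ i : Fin (n + 1), .inl i ∈ S ∧ MvPowerSeries.coeff m (thetaHtpy ω S) = esgn vrk S (.inl i) •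
      MvPowerSeries.coeff (m + Finsupp.single (.inl i) 1) (ω (S.erase (.inl i))) := by
  classical
  have h1 : MvPowerSeries.coeff m (thetaHtpy ω S) = if h : ∃ i : Fin (n + 1), (m + chi S) (.inl i) ≠ 0 then
      crea vrk (.inl h.choose) (slice (m + chi S) ω) S else 0 := rfl
  rw [h1] at h ⊢
  split_ifs at h ⊢ with h2
  · rw [crea_apply] at h ⊢
    split_ifs at h ⊢ with hi
    · refine ⟨_, hi, ?_⟩
      congr 1
      have h9 : m + chi S = m + Finsupp.single (.inl h2.choose) 1 + chi (S.erase (.inl h2.choose)) := by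
        rw [add_assoc, chi_erase hi]
      exact (congrArg (fun e => slice e ω (S.erase (.inl h2.choose))) h9).trans (slice_add_chi _ _ _)
    · exact absurd rfl h
  · exact absurd rfl h

/-- Off the constants, the contraction is exact on forms of weight zero. -/
theorem formTheta_thetaHtpy {d : Fin r → ℕ} (hd : ∀ j, 0 < d j)
    {ω : Finset (Var n r) → MvPowerSeries (Var n r) R} (hw : FormWtZero d ω)
    (hω : formTheta d ω = 0) (h0 : MvPowerSeries.coeff 0 (ω ∅) = 0) :
    formTheta d (thetaHtpy ω) = ω := by
  classical
  funext S
  ext m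
  rw [← slice_add_chi, ← slice_add_chi, slice_formTheta]
  by_cases h : ∃ i : Fin (n + 1), (m + chi S) (.inl i) ≠ 0
  · rw [slice_thetaHtpy h]
    -- The chosen variable is an `x_i`, of weight `1`, so the pairing in the homotopy formula is `1`
    -- and no degree `d_j` has to be inverted.
    have h1 := extMul_extContr (rk := vrk) (ι := Var n r) vrk_injective (Pi.single (.inl h.choose) (1 : R))
      (fun i => (wt d i : R)) (slice (m + chi S) ω)
    have h2 : slice (m + chi S) (0 : Finset (Var n r) → MvPowerSeries (Var n r) R) = 0 := by
      funext U; rw [slice]; split_ifs <;> simp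
    rw [extMul_single, extMul_single, ← slice_formTheta, hω, h2, map_zero, zero_add,
      Finset.sum_eq_single (.inl h.choose)] at h1
    · rw [h1]; simp [wt]
    · intro j _ hj; rw [Pi.single_eq_of_ne hj, zero_mul]
    · simp
  -- Without any `x_i`, weight zero and `d_j > 0` exclude the `y_j` as well. Only the constant term
  -- remains, and it vanishes by `h0`.
  · have h1 : slice (m + chi S) (thetaHtpy ω) = 0 := by
      funext U
      rw [slice]
      split_ifs with h2
      · have h3 : MvPowerSeries.coeff (m + chi S - chi U) (thetaHtpy ω U) =
          if h : ∃ i : Fin (n + 1), (m + chi S - chi U + chi U) (.inl i) ≠ 0 then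
          crea vrk (.inl h.choose) (slice (m + chi S - chi U + chi U) ω) U else 0 := rfl
        rw [h3, tsub_add_cancel_of_le h2, dif_neg h]; rfl
      · rfl
    rw [h1, map_zero, Pi.zero_apply, slice_add_chi]
    symm
    by_contra h4
    have h5 := hw S m h4
    rw [formWt_eq_sum, Fintype.sum_sum_type] at h5
    push Not at h
    simp only [h, Nat.cast_zero, zero_mul, Finset.sum_const_zero, zero_add, wt, Sum.elim_inr,
      mul_neg, Finset.sum_neg_distrib, neg_eq_zero] at h5
    rw [Finset.sum_eq_zero_iff_of_nonneg fun j _ => by positivity] at h5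
    have h6 : m + chi S = 0 := by
      ext z
      rcases z with i | j
      · exact h i
      · have h7 := h5 j (Finset.mem_univ j)
        have h8 : (d j : ℤ) ≠ 0 := by exact_mod_cast (hd j).ne'
        have h9 := (mul_eq_zero.1 h7).resolve_right h8
        exact_mod_cast h9
    have h7 : m = 0 := (add_eq_zero.1 h6).1
    have h8 : S = ∅ := by
      refine Finset.eq_empty_of_forall_notMem fun i hi => ?_
      have h9 := DFunLike.congr_fun (add_eq_zero.1 h6).2 i
      rw [chi_apply, if_pos hi] at h9
      exact one_ne_zero h9
    rw [h7, h8, h0] at h4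
    exact h4 rfl

end FormIdentities

/-! ### Products of the two-forms `β_j ∧ dy_j` -/

section Products

variable {n r : ℕ} {R : Type*} [CommRing R]

/-- Multiplication by `β ∧ dy_j`. -/
def twoMul (β : Var n r → R) (j : Fin r) : (Finset (Var n r) → R) →ₗ[R] (Finset (Var n r) → R) :=
  extMul vrk β ∘ₗ crea vrk (.inr j)

theorem twoMul_apply (β : Var n r → R) (j : Fin r) (ω : Finset (Var n r) → R) :
    twoMul β j ω = extMul vrk β (extMul vrk (Pi.single (.inr j) 1) ω) := by
  rw [extMul_single]; rfl

theorem twoMul_extMul (β α : Var n r → R) (j : Fin r) (ω : Finset (Var n r) → R) :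
    twoMul β j (extMul vrk α ω) = extMul vrk α (twoMul β j ω) := by
  rw [twoMul_apply, twoMul_apply, extMul_extMul vrk_injective _ α, map_neg,
    extMul_extMul vrk_injective β α, neg_neg]

/-- The 1-form `x β + g dy_j`. -/
def kappaForm (x g : R) (β : Var n r → R) (j : Fin r) : Var n r → R :=
  x • β + g • Pi.single (.inr j) 1

theorem extMul_kappaForm (x g : R) (β : Var n r → R) (j : Fin r) (ω : Finset (Var n r) → R) :
    extMul vrk (kappaForm x g β j) ω = x • extMul vrk β ω + g • crea vrk (.inr j) ω := by
  rw [kappaForm, extMul_add, extMul_smul, extMul_smul, extMul_single]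

theorem extMul_kappaForm_twoMul (x g : R) (β : Var n r → R) (j : Fin r)
    (ω : Finset (Var n r) → R) : extMul vrk (kappaForm x g β j) (twoMul β j ω) = 0 := by
  have h := twoMul_extMul β (Pi.single (.inr j) 1) j ω
  rw [extMul_single, extMul_single] at h
  rw [extMul_kappaForm, ← h, twoMul_apply, extMul_extMul_self vrk_injective, smul_zero, zero_add]
  simp only [twoMul, LinearMap.comp_apply, crea_crea_self, map_zero, smul_zero]

/-- Contraction is an antiderivation, and it takes `β ∧ dy_j` to `e (g dy_j + x β)`. -/
theorem extContr_twoMul {τ β : Var n r → R} {x g : R} {e : ℕ} {j : Fin r}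
    (h : ∑ i, β i * τ i = e • g) (h' : τ (.inr j) = -(e • x)) (ω : Finset (Var n r) → R) :
    extContr vrk τ (twoMul β j ω) =
      e • extMul vrk (kappaForm x g β j) ω + twoMul β j (extContr vrk τ ω) := by
  have h1 := extMul_extContr vrk_injective β τ (extMul vrk (Pi.single (.inr j) 1) ω)
  have h2 := extMul_extContr vrk_injective (Pi.single (.inr j) 1) τ ω
  rw [Finset.sum_eq_single (.inr j) (fun i _ hi => by rw [Pi.single_eq_of_ne hi, zero_mul])
    (by simp), Pi.single_eq_same, one_mul, h'] at h2
  rw [h] at h1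
  rw [twoMul_apply, twoMul_apply, eq_sub_of_add_eq' h1, eq_sub_of_add_eq' h2, map_sub,
    map_smul, extMul_kappaForm, extMul_single]
  module

variable (β : Fin r → Var n r → R) (d : Fin r → ℕ)

/-- The elementary symmetric expression of degree `m` in the two-forms `β_j ∧ dy_j` and the
integers `d_j`. -/
def bForm : List (Fin r) → ℕ → (Finset (Var n r) → R)
  | [], 0 => unitForm
  | [], _ + 1 => 0
  | j :: l, 0 => d j • bForm l 0
  | j :: l, m + 1 => d j • bForm l (m + 1) + twoMul (β j) j (bForm l m)

theorem bForm_zero (l : List (Fin r)) : bForm β d l 0 = (l.map d).prod • unitForm := by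
  induction l with
  | nil => simp [bForm]
  | cons j l ih => rw [bForm, ih, smul_smul, List.map_cons, List.prod_cons]

theorem bForm_of_lt {l : List (Fin r)} {m : ℕ} (h : l.length < m) : bForm β d l m = 0 := by
  induction l generalizing m with
  | nil =>
    obtain ⟨m, rfl⟩ := Nat.exists_eq_succ_of_ne_zero (Nat.ne_zero_of_lt h)
    rfl
  | cons j l ih =>
    obtain ⟨m, rfl⟩ := Nat.exists_eq_succ_of_ne_zero (Nat.ne_zero_of_lt h)
    rw [List.length_cons] at h
    rw [bForm, ih (by omega), ih (by omega), smul_zero, map_zero, add_zero]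

theorem bForm_length (l : List (Fin r)) :
    bForm β d l l.length = l.foldr (fun j ω => twoMul (β j) j ω) unitForm := by
  induction l with
  | nil => rfl
  | cons j l ih =>
    rw [List.length_cons, bForm, bForm_of_lt _ _ (Nat.lt_succ_self _), smul_zero, zero_add, ih,
      List.foldr_cons]

theorem bForm_induction {P : (Finset (Var n r) → R) → Prop} (h0 : P 0) (h1 : P unitForm)
    (hs : ∀ (e : ℕ) ω, P ω → P (e • ω)) (ha : ∀ ω ω', P ω → P ω' → P (ω + ω'))
    (ht : ∀ j ω, P ω → P (twoMul (β j) j ω)) (l : List (Fin r)) (m : ℕ) : P (bForm β d l m) := by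
  induction l generalizing m with
  | nil => cases m; exacts [h1, h0]
  | cons j l ih =>
    cases m
    · exact hs _ _ (ih _)
    · exact ha _ _ (hs _ _ (ih _)) (ht _ _ (ih _))

theorem hasDeg_bForm (l : List (Fin r)) (m : ℕ) : HasDeg (2 * m) (bForm β d l m) := by
  induction l generalizing m with
  | nil => cases m; exacts [hasDeg_unitForm, fun _ _ => rfl]
  | cons j l ih =>
    cases m with
    | zero => intro S hS; rw [bForm, Pi.smul_apply, ih _ S hS, smul_zero]
    | succ m =>
      intro S hS
      have h := ((ih m).extMul (rk := vrk) (Pi.single (.inr j) 1)).extMul (rk := vrk) (β j)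
      rw [bForm, Pi.add_apply, Pi.smul_apply, ih _ S hS, smul_zero, zero_add, twoMul_apply]
      exact h S (by omega)

variable {β d}

theorem extContr_bForm_zero (τ : Var n r → R) (l : List (Fin r)) :
    extContr vrk τ (bForm β d l 0) = 0 := by
  rw [bForm_zero, map_nsmul]
  have : extContr vrk τ (unitForm : Finset (Var n r) → R) = 0 := by
    funext S
    rw [extContr_apply]
    refine Finset.sum_eq_zero fun i _ => ?_
    rw [unitForm, if_neg (Finset.insert_ne_empty _ _), mul_zero, smul_zero]
  rw [this, smul_zero]

/-- In the generating function `∏ (d_j + T β_j dy_j)` contraction replaces one factor by `T d_j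
κ_j`. Multiplication by `κ_j` replaces the factor of index `j` by `d_j κ_j`, because `κ_j β_j dy_j =
0`. Summing over `j`, the two operations differ by the factor `T`. -/
theorem extMul_bForm {τ : Var n r → R} {x g : Fin r → R}
    (h : ∀ j, ∑ i, β j i * τ i = d j • g j) (h' : ∀ j, τ (.inr j) = -(d j • x j))
    (l : List (Fin r)) (m : ℕ) :
    extMul vrk ((l.map fun j => kappaForm (x j) (g j) (β j) j).sum) (bForm β d l m) =
      extContr vrk τ (bForm β d l (m + 1)) := by
  induction l generalizing m with
  | nil =>
    rw [List.map_nil, List.sum_nil, extMul_zero]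
    simp [bForm]
  | cons j l ih =>
    rw [List.map_cons, List.sum_cons, extMul_add]
    cases m with
    | zero =>
      rw [bForm, bForm, map_add, map_nsmul, map_nsmul, map_nsmul, extContr_twoMul (h j) (h' j),
        extContr_bForm_zero, map_zero, ih]
      abel
    | succ m =>
      rw [bForm, bForm, map_add, map_add, map_add, map_nsmul, map_nsmul, map_nsmul,
        extContr_twoMul (h j) (h' j), extMul_kappaForm_twoMul, ← ih, ← ih, ← twoMul_extMul]
      abel

theorem formDeriv_twoMul {S : Type*} [CommRing S] {α : Var n r → MvPowerSeries (Var n r) S}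
    {j : Fin r} (h : ∀ i i', i ≠ .inr j → i' ≠ .inr j →
      MvPowerSeries.pderiv S i (α i') = MvPowerSeries.pderiv S i' (α i))
    {ω : Finset (Var n r) → MvPowerSeries (Var n r) S} (hω : formDeriv ω = 0) :
    formDeriv (twoMul α j ω) = 0 := by
  have h0 : ∀ i, crea vrk i (crea vrk (.inr j) (crea vrk i ω)) = 0 := by
    intro i
    by_cases hi : i = .inr j
    · rw [hi, crea_crea_self]
    · rw [crea_crea vrk_injective (Ne.symm hi), map_neg, crea_crea_self, neg_zero]
  have hy : formDeriv (crea vrk (.inr j) ω) = 0 := by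
    rw [← extMul_single, formDeriv_extMul, hω, map_zero, neg_zero]
    intro i i'
    have : ∀ k, MvPowerSeries.pderiv S k ((Pi.single (.inr j) 1 : Var n r → MvPowerSeries (Var n r) S) i) = 0 ∧
        MvPowerSeries.pderiv S k ((Pi.single (.inr j) 1 : Var n r → MvPowerSeries (Var n r) S) i') = 0 := by
      intro k
      constructor
      · by_cases hi : i = .inr j
        · rw [hi, Pi.single_eq_same, MvPowerSeries.pderiv_one]
        · rw [Pi.single_eq_of_ne hi, map_zero]
      · by_cases hi : i' = .inr j
        · rw [hi, Pi.single_eq_same, MvPowerSeries.pderiv_one]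
        · rw [Pi.single_eq_of_ne hi, map_zero]
    rw [(this i).2, (this i').1]
  rw [twoMul, LinearMap.comp_apply, formDeriv_extMul, hy, map_zero, neg_zero]
  intro i i'
  by_cases hi : i = .inr j
  · rw [hi]
    by_cases hi' : i' = .inr j
    · rw [hi']
    · rw [crea_crea vrk_injective hi', map_neg, crea_crea_self, neg_zero, smul_zero, smul_zero]
  · by_cases hi' : i' = .inr j
    · rw [hi', crea_crea_self, map_zero, smul_zero, smul_zero]
    · rw [h i i' hi hi']

end Products

/-! ### The integral complex -/

section DivY

variable {n r : ℕ} {R : Type*} [CommRing R]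

/-- The quotient by `y_j` of the part of a power series divisible by `y_j`. -/
def divY (j : Fin r) (g : MvPowerSeries (Var n r) R) : MvPowerSeries (Var n r) R :=
  fun m => MvPowerSeries.coeff (m + Finsupp.single (.inr j) 1) g

theorem coeff_divY (j : Fin r) (g : MvPowerSeries (Var n r) R) (m : Var n r →₀ ℕ) :
    MvPowerSeries.coeff m (divY j g) = MvPowerSeries.coeff (m + Finsupp.single (.inr j) 1) g := rfl

theorem divY_mem_tateRing {ϖ : R} {g : MvPowerSeries (Var n r) R} (hg : g ∈ tateRing (Var n r) ϖ)
    (j : Fin r) : divY j g ∈ tateRing (Var n r) ϖ := fun N =>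
  ((hg N).preimage (f := (· + Finsupp.single (Sum.inr j : Var n r) 1)) (add_left_injective _).injOn).subset
    fun _ hm h => hm h

theorem pderiv_divY (j : Fin r) (i : Fin (n + 1)) (g : MvPowerSeries (Var n r) R) :
    MvPowerSeries.pderiv R (.inl i) (divY j g) = divY j (MvPowerSeries.pderiv R (.inl i) g) := by
  ext m
  simp only [MvPowerSeries.coeff_pderiv, coeff_divY, Finsupp.add_apply]
  rw [Finsupp.single_eq_of_ne (by simp), add_zero, add_right_comm]

end DivY

/-! ### Weight zero forms with restricted coefficients -/

section TateForms

variable {n r : ℕ} {R : Type*} [CommRing R]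

/-- The forms of degree `k` and weight zero with restricted coefficients. -/
def tateForms (n : ℕ) (d : Fin r → ℕ) (ϖ : R) (k : ℕ) :
    Submodule R (Finset (Var n r) → MvPowerSeries (Var n r) R) where
  carrier := {ω | (∀ S, ω S ∈ tateRing _ ϖ) ∧ FormWtZero d ω ∧ HasDeg k ω}
  zero_mem' := ⟨fun _ => zero_mem _, fun S m h => by simp at h, fun _ _ => rfl⟩
  add_mem' h h' := ⟨fun S => add_mem (h.1 S) (h'.1 S), h.2.1.add h'.2.1, fun S hS => by
    rw [Pi.add_apply, h.2.2 S hS, h'.2.2 S hS, add_zero]⟩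
  smul_mem' a ω h := ⟨fun S => smul_mem_tateRing (h.1 S) a, h.2.1.smul a, hasDeg_smul h.2.2 a⟩

variable {d : Fin r → ℕ} {ϖ : R} {k : ℕ} {ω : Finset (Var n r) → MvPowerSeries (Var n r) R}

theorem extMul_mem_tateRing {α : Var n r → MvPowerSeries (Var n r) R}
    (hα : ∀ i, α i ∈ tateRing _ ϖ) (h : ∀ S, ω S ∈ tateRing _ ϖ) (S) :
    extMul vrk α ω S ∈ tateRing _ ϖ := by
  rw [extMul_apply]
  exact sum_mem fun i _ => zsmul_mem (mul_mem (hα i) (h _)) _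

theorem twistedD_mem_tateForms {c : R} {ψ : Var n r → MvPowerSeries (Var n r) R}
    (hψT : ∀ i, ψ i ∈ tateRing _ ϖ)
    (hψw : ∀ i m, MvPowerSeries.coeff m (ψ i) ≠ 0 → ∑ z, (m z : ℤ) * wt d z = - wt d i)
    (h : ω ∈ tateForms n d ϖ k) : twistedD c ψ ω ∈ tateForms n d ϖ (k + 1) := by
  rw [twistedD_apply]
  refine add_mem (Submodule.smul_mem _ _ ⟨fun S => ?_, h.2.1.formDeriv, h.2.2.formDeriv⟩)
    ⟨extMul_mem_tateRing hψT h.1, h.2.1.extMul hψw, h.2.2.extMul _⟩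
  rw [formDeriv_apply]
  exact sum_mem fun i _ => zsmul_mem (pderiv_mem_tateRing (h.1 _) _) _

theorem X_mem_tateRing {V : Type*} (i : V) : (MvPowerSeries.X i : MvPowerSeries V R) ∈ tateRing V ϖ := by
  have := coe_mem_tateRing (ϖ := ϖ) (MvPolynomial.X i : MvPolynomial V R)
  rwa [MvPolynomial.coe_X] at this

theorem formTheta_mem_tateForms (h : ω ∈ tateForms n d ϖ (k + 1)) :
    formTheta d ω ∈ tateForms n d ϖ k := by
  classical
  refine ⟨fun S => ?_, fun S m hm => ?_, fun S hS => ?_⟩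
  · rw [formTheta_apply, extContr_apply]
    exact sum_mem fun i _ => zsmul_mem (mul_mem (zsmul_mem (X_mem_tateRing i) _) (h.1 _)) _
  · rw [formTheta_apply, extContr_apply, map_sum] at hm
    obtain ⟨i, hi, h1⟩ := Finset.exists_ne_zero_of_sum_ne_zero hm
    rw [map_zsmul, smul_mul_assoc, map_zsmul, MvPowerSeries.X, MvPowerSeries.coeff_monomial_mul] at h1
    split_ifs at h1 with h2
    · rw [one_mul] at h1
      have h3 := h.2.1 _ _ (right_ne_zero_of_smul (right_ne_zero_of_smul h1))
      rw [formWt_eq_sum, chi_insert (Finset.mem_compl.1 hi), ← add_assoc, tsub_add_cancel_of_le h2] at h3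
      rw [formWt_eq_sum, h3]
    · simp at h1
  · rw [formTheta_apply, extContr_apply]
    refine Finset.sum_eq_zero fun i hi => ?_
    rw [h.2.2, mul_zero, smul_zero]
    rw [Finset.card_insert_of_notMem (Finset.mem_compl.1 hi)]
    omega

theorem thetaHtpy_mem_tateForms (h : ω ∈ tateForms n d ϖ k) :
    thetaHtpy ω ∈ tateForms n d ϖ (k + 1) := by
  refine ⟨fun S N => ?_, fun S m hm => ?_, fun S hS => ?_⟩
  · have hfin : (⋃ i : Fin (n + 1), {m | ¬ ϖ ^ N ∣ MvPowerSeries.coeff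
        (m + Finsupp.single (.inl i) 1) (ω (S.erase (.inl i)))}).Finite :=
      Set.finite_iUnion fun i => ((h.1 (S.erase (.inl i)) N).preimage
        (f := (· + Finsupp.single (Sum.inl i : Var n r) 1)) (add_left_injective _).injOn).subset fun _ hm h => hm h
    refine hfin.subset fun m hm => ?_
    obtain ⟨i, hi, h1⟩ := exists_coeff_thetaHtpy ω (S := S) (m := m) fun h0 => hm (h0 ▸ dvd_zero _)
    refine Set.mem_iUnion.2 ⟨i, fun h2 => hm ?_⟩
    rw [h1, zsmul_eq_mul]
    exact Dvd.dvd.mul_left h2 _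
  · obtain ⟨i, hi, h1⟩ := exists_coeff_thetaHtpy ω hm
    rw [h1] at hm
    have h2 := h.2.1 _ _ (right_ne_zero_of_smul hm)
    rw [formWt_eq_sum, add_assoc, chi_erase hi, ← formWt_eq_sum] at h2
    exact h2
  · ext m
    by_contra h0
    obtain ⟨i, hi, h1⟩ := exists_coeff_thetaHtpy ω h0
    rw [h.2.2, map_zero, smul_zero] at h1
    · exact h0 h1
    · rw [Finset.card_erase_of_mem hi]
      have := Finset.card_pos.2 ⟨_, hi⟩
      omega

theorem exists_formTheta_eq (hd : ∀ j, 0 < d j) (h : ω ∈ tateForms n d ϖ k)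
    (hω : formTheta d ω = 0) (h0 : MvPowerSeries.coeff 0 (ω ∅) = 0) :
    ∃ ξ ∈ tateForms n d ϖ (k + 1), formTheta d ξ = ω :=
  ⟨_, thetaHtpy_mem_tateForms h, formTheta_thetaHtpy hd h.2.1 hω h0⟩

theorem FormWtZero.twoMul {β : Var n r → MvPowerSeries (Var n r) R} {j : Fin r}
    (hβ : ∀ i a, MvPowerSeries.coeff a (β i) ≠ 0 →
      ∑ z, (a z : ℤ) * wt d z = - wt d i - wt d (.inr j : Var n r))
    (h : FormWtZero d ω) : FormWtZero d (twoMul β j ω) := by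
  classical
  intro S m hm
  rw [twoMul_apply, extMul_single, extMul_apply, map_sum] at hm
  obtain ⟨i, hi, h2⟩ := Finset.exists_ne_zero_of_sum_ne_zero hm
  rw [map_zsmul, crea_apply] at h2
  split_ifs at h2 with hj
  · rw [mul_smul_comm, map_zsmul, MvPowerSeries.coeff_mul] at h2
    obtain ⟨⟨a, b⟩, hab, h3⟩ := Finset.exists_ne_zero_of_sum_ne_zero
      (right_ne_zero_of_smul (right_ne_zero_of_smul h2))
    have h4 := h _ b (right_ne_zero_of_mul h3)
    have h5 := hβ i a (left_ne_zero_of_mul h3)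
    rw [← Finset.HasAntidiagonal.mem_antidiagonal.1 hab, formWt_single_add, formWt_erase d _ hi,
      formWt_erase d _ hj, h4, h5]
    ring
  · simp at h2

theorem unitForm_mem_tateForms : (unitForm : Finset (Var n r) → MvPowerSeries (Var n r) R) ∈
    tateForms n d ϖ 0 := by
  classical
  refine ⟨fun S => ?_, fun S m hm => ?_, hasDeg_unitForm⟩
  · rw [unitForm]; split_ifs; exacts [one_mem _, zero_mem _]
  · rw [unitForm] at hm
    split_ifs at hm with hS
    · rw [MvPowerSeries.coeff_one] at hm
      split_ifs at hm with h
      · rw [h, hS]; simp [formWt]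
      · exact absurd rfl hm
    · simp at hm

end TateForms

/-! ### The 1-forms `β_j` and the forms `B_m` -/

namespace Constants

variable {p : ℕ} [hp : Fact p.Prime] {F : Type*} [Field F] (c : Constants p F) {n r : ℕ}

theorem exists_y_of_coeff_hSeries_ne_zero {f : Fin r → MvPolynomial (Fin (n + 1)) F}
    {m : Var n r →₀ ℕ} (h : MvPowerSeries.coeff m (c.hSeries f) ≠ 0) :
    ∃ j, m (.inr j) ≠ 0 ∧ ∀ j' ≠ j, m (.inr j') = 0 := by
  obtain ⟨l, m₀, h1, rfl⟩ := c.exists_of_coeff_hSeries_ne_zero h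
  obtain ⟨j, u, rfl, -⟩ := exists_of_coeff_totalPoly_ne_zero h1
  have h2 : ∀ j : Fin r, (Finsupp.mapDomain Sum.inl u : Var n r →₀ ℕ) (.inr j) = 0 := fun j =>
    Finsupp.mapDomain_of_notMem_range _ _ (by simp)
  refine ⟨j, ?_, fun j' hj => ?_⟩
  · simp [h2, hp.out.ne_zero]
  · rw [Finsupp.smul_apply, Finsupp.add_apply, h2, Finsupp.single_eq_of_ne (by simpa using hj), add_zero,
      smul_zero]

/-- The coefficients of `π^(Mb) γ⁻¹ H`, with `y` replaced by `π^(-Mb) y`. -/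
def hVal (f : Fin r → MvPolynomial (Fin (n + 1)) F) : MvPowerSeries (Var n r) ℂ_[p] := fun m =>
  c.factor * MvPowerSeries.coeff m (c.hSeries f) / c.π ^ (c.Mb * ydeg m)

theorem coeff_hVal (f : Fin r → MvPolynomial (Fin (n + 1)) F) (m : Var n r →₀ ℕ) :
    MvPowerSeries.coeff m (c.hVal f) =
      c.factor * MvPowerSeries.coeff m (c.hSeries f) / c.π ^ (c.Mb * ydeg m) := rfl

theorem coeff_hSeries_ne_zero {f : Fin r → MvPolynomial (Fin (n + 1)) F} {m : Var n r →₀ ℕ}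
    (h : MvPowerSeries.coeff m (c.hVal f) ≠ 0) : MvPowerSeries.coeff m (c.hSeries f) ≠ 0 :=
  fun h0 => h (by rw [coeff_hVal, h0]; simp)

theorem psiVal_eq (f : Fin r → MvPolynomial (Fin (n + 1)) F) (i : Var n r) (a : Var n r →₀ ℕ) :
    c.psiVal f i a = MvPowerSeries.coeff a (MvPowerSeries.pderiv ℂ_[p] i (c.hVal f)) := by
  rw [psiVal, MvPowerSeries.coeff_pderiv, MvPowerSeries.coeff_pderiv, coeff_hVal]
  ring

variable [Finite F]

theorem map_subtype_psi (f : Fin r → MvPolynomial (Fin (n + 1)) F) (i : Var n r) :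
    MvPowerSeries.map c.integers.subtype (c.psi f i) = MvPowerSeries.pderiv ℂ_[p] i (c.hVal f) := by
  ext a
  rw [MvPowerSeries.coeff_map, ← psiVal_eq]
  rfl

theorem map_subtype_injective {V : Type*} :
    Function.Injective (MvPowerSeries.map (σ := V) c.integers.subtype) := by
  intro g g' h
  ext m
  have := congrArg (MvPowerSeries.coeff m) h
  rw [MvPowerSeries.coeff_map, MvPowerSeries.coeff_map] at this
  exact this

theorem map_pderiv {V R R' : Type*} [CommRing R] [CommRing R'] (φ : R →+* R') (i : V)
    (g : MvPowerSeries V R) : MvPowerSeries.map φ (MvPowerSeries.pderiv R i g) =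
      MvPowerSeries.pderiv R' i (MvPowerSeries.map φ g) := by
  ext m
  simp [MvPowerSeries.coeff_map, MvPowerSeries.coeff_pderiv]

theorem pderiv_psi (f : Fin r → MvPolynomial (Fin (n + 1)) F) (i j : Var n r) :
    MvPowerSeries.pderiv c.integers i (c.psi f j) = MvPowerSeries.pderiv c.integers j (c.psi f i) := by
  apply c.map_subtype_injective
  rw [map_pderiv, map_pderiv, map_subtype_psi, map_subtype_psi, pderiv_comm]

theorem coeff_X_mul_psi (f : Fin r → MvPolynomial (Fin (n + 1)) F) (i : Var n r)
    (m : Var n r →₀ ℕ) :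
    ((MvPowerSeries.coeff m (c.psi f i * MvPowerSeries.X i) : c.integers) : ℂ_[p]) =
      m i * MvPowerSeries.coeff m (c.hVal f) := by
  have h := congrArg (MvPowerSeries.coeff m) (congrArg (MvPowerSeries.X i * ·) (c.map_subtype_psi f i))
  simp only [coeff_X_mul_pderiv] at h
  rw [← h, ← MvPowerSeries.map_X (R := c.integers) c.integers.subtype, ← map_mul,
    MvPowerSeries.coeff_map, mul_comm]
  rfl

/-- Euler's relation for `H`, all of whose monomials have weight zero. -/
theorem sum_psi_mul_X {f : Fin r → MvPolynomial (Fin (n + 1)) F} {d : Fin r → ℕ}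
    (hf : ∀ j, (f j).IsHomogeneous (d j)) : ∑ i, c.psi f i * (wt d i • MvPowerSeries.X i) = 0 := by
  ext m
  rw [map_sum, map_zero, ZeroMemClass.coe_zero, AddSubmonoidClass.coe_finsetSum]
  have h1 : ∀ i, ((MvPowerSeries.coeff m (c.psi f i * (wt d i • MvPowerSeries.X i)) : c.integers) : ℂ_[p]) =
      (((m i : ℤ) * wt d i : ℤ) : ℂ_[p]) * MvPowerSeries.coeff m (c.hVal f) := by
    intro i
    rw [mul_smul_comm, map_zsmul, zsmul_eq_mul]
    push_cast
    rw [coeff_X_mul_psi]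
    ring
  rw [Finset.sum_congr rfl fun i _ => h1 i, ← Finset.sum_mul, ← Int.cast_sum]
  by_cases h : MvPowerSeries.coeff m (c.hVal f) = 0
  · rw [h, mul_zero]
  · rw [c.weight_of_coeff_hSeries_ne_zero hf (c.coeff_hSeries_ne_zero h), Int.cast_zero, zero_mul]

/-- The coefficients of the 1-forms `β_j` with `dH = ∑ (y_j β_j + H_j dy_j)`. -/
def beta (f : Fin r → MvPolynomial (Fin (n + 1)) F) (j : Fin r) :
    Var n r → MvPowerSeries (Var n r) c.integers :=
  Sum.elim (fun i => divY j (c.psi f (.inl i))) 0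

theorem coeff_psi_ne_zero {f : Fin r → MvPolynomial (Fin (n + 1)) F} {i : Var n r}
    {m : Var n r →₀ ℕ} (h : MvPowerSeries.coeff m (c.psi f i) ≠ 0) :
    MvPowerSeries.coeff (m + Finsupp.single i 1) (c.hSeries f) ≠ 0 := by
  intro h0
  refine h (Subtype.ext ?_)
  rw [coeff_psi, psiVal, MvPowerSeries.coeff_pderiv, h0]; simp

/-- A monomial of `∂H/∂x_i` contains exactly one of the `y_j`, and is recovered as `y_j` times its
quotient by `y_j` for this `j` only. The `dy_j`-components agree by inspection. -/
theorem sum_kappaForm (f : Fin r → MvPolynomial (Fin (n + 1)) F) :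
    ((List.finRange r).map fun j => kappaForm (MvPowerSeries.X (.inr j)) (c.psi f (.inr j))
      (c.beta f j) j).sum = c.psi f := by
  classical
  rw [← List.ofFn_eq_map, List.sum_ofFn]
  funext i
  rw [Finset.sum_apply]
  rcases i with i | j
  · ext m
    rw [map_sum]
    have h1 : ∀ j, MvPowerSeries.coeff m (kappaForm (MvPowerSeries.X (.inr j)) (c.psi f (.inr j))
        (c.beta f j) j (.inl i)) = if m (.inr j) = 0 then 0 else MvPowerSeries.coeff m (c.psi f (.inl i)) := by
      intro j
      rw [kappaForm, Pi.add_apply, Pi.smul_apply, Pi.smul_apply, Pi.single_eq_of_ne (by simp),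
        smul_zero, add_zero, smul_eq_mul, MvPowerSeries.X, MvPowerSeries.coeff_monomial_mul]
      simp only [Finsupp.single_le_iff]
      by_cases h : m (.inr j) = 0
      · rw [if_neg (by omega), if_pos h]
      · rw [if_pos (by omega), if_neg h, one_mul, beta, Sum.elim_inl, coeff_divY, tsub_add_cancel_of_le]
        rw [Finsupp.single_le_iff]; omega
    rw [Finset.sum_congr rfl fun j _ => h1 j]
    by_cases h : MvPowerSeries.coeff m (c.psi f (.inl i)) = 0
    · rw [h]; simp
    · obtain ⟨j, hj, hj'⟩ := c.exists_y_of_coeff_hSeries_ne_zero (c.coeff_psi_ne_zero h)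
      simp only [Finsupp.add_apply, Finsupp.single_apply, reduceCtorEq, if_false, add_zero] at hj hj'
      rw [Finset.sum_eq_single j, if_neg hj]
      · intro j' _ h'; rw [if_pos (hj' j' h')]
      · simp
  · rw [Finset.sum_eq_single j]
    · simp [kappaForm, beta]
    · intro j' _ h'
      have : (Sum.inr j : Var n r) ≠ .inr j' := by simpa using h'.symm
      simp [kappaForm, beta, this, Pi.single_eq_of_ne]
    · simp

/-- Euler's relation for the monomials containing `y_j`: weight zero says that the degree in `x` is
`d_j` times the exponent of `y_j`. -/
theorem sum_beta_mul {f : Fin r → MvPolynomial (Fin (n + 1)) F} {d : Fin r → ℕ}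
    (hf : ∀ j, (f j).IsHomogeneous (d j)) (j : Fin r) :
    ∑ i, c.beta f j i * (wt d i • MvPowerSeries.X i) = d j • c.psi f (.inr j) := by
  classical
  rw [Fintype.sum_sum_type]
  simp only [beta, Sum.elim_inl, Sum.elim_inr, Pi.zero_apply, zero_mul, Finset.sum_const_zero, add_zero,
    wt, one_smul]
  ext m
  rw [map_sum, AddSubmonoidClass.coe_finsetSum]
  set e := m + Finsupp.single (.inr j) 1 with he
  have h1 : ∀ i : Fin (n + 1), ((MvPowerSeries.coeff m (divY j (c.psi f (.inl i)) * MvPowerSeries.X (.inl i)) : c.integers) : ℂ_[p]) =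
      (e (.inl i) : ℂ_[p]) * MvPowerSeries.coeff e (c.hVal f) := by
    intro i
    rw [← coeff_X_mul_psi]
    congr 1
    rw [mul_comm, mul_comm _ (MvPowerSeries.X _), MvPowerSeries.X, MvPowerSeries.coeff_monomial_mul,
      MvPowerSeries.coeff_monomial_mul]
    simp only [Finsupp.single_le_iff, he, Finsupp.add_apply]
    rw [Finsupp.single_eq_of_ne (by simp), add_zero]
    split_ifs with h
    · rw [coeff_divY, tsub_add_eq_add_tsub]
      rwa [Finsupp.single_le_iff]
    · rfl
  rw [Finset.sum_congr rfl fun i _ => h1 i, ← Finset.sum_mul, map_nsmul, nsmul_eq_mul]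
  have h2 : (((d j : c.integers) * MvPowerSeries.coeff m (c.psi f (.inr j)) : c.integers) : ℂ_[p]) =
      (d j : ℂ_[p]) * (e (.inr j) * MvPowerSeries.coeff e (c.hVal f)) := by
    rw [Subring.coe_mul, coeff_psi, psiVal_eq, MvPowerSeries.coeff_pderiv, he]
    simp only [Finsupp.add_apply, Finsupp.single_eq_same]
    push_cast
    ring
  rw [h2]
  by_cases h : MvPowerSeries.coeff e (c.hVal f) = 0
  · rw [h]; simp
  · have h3 := c.weight_of_coeff_hSeries_ne_zero hf (c.coeff_hSeries_ne_zero h)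
    obtain ⟨j', hj, hj'⟩ := c.exists_y_of_coeff_hSeries_ne_zero (c.coeff_hSeries_ne_zero h)
    have h4 : j = j' := by
      by_contra h5
      have := hj' j h5
      simp [he] at this
    subst h4
    rw [Fintype.sum_sum_type, Finset.sum_eq_single (s := (Finset.univ : Finset (Fin r))) j
      (fun i _ hi => by rw [hj' i hi]; simp) (by simp)] at h3
    simp only [wt, Sum.elim_inl, Sum.elim_inr, mul_one] at h3
    have h5 : (∑ i, (e (.inl i) : ℤ)) = d j * e (.inr j) := by linarith
    have h6 := congrArg (Int.cast : ℤ → ℂ_[p]) h5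
    push_cast at h6
    rw [h6]; ring

theorem beta_mem_tateRing (f : Fin r → MvPolynomial (Fin (n + 1)) F) (j : Fin r) (i : Var n r) :
    c.beta f j i ∈ tateRing (Var n r) c.ϖ := by
  rcases i with i | i
  · exact divY_mem_tateRing (c.psi_mem_tateRing f _) j
  · exact zero_mem _

theorem map_beta [CharP F p] (f : Fin r → MvPolynomial (Fin (n + 1)) F) (j : Fin r) (i : Fin (n + 1)) :
    MvPowerSeries.map (Ideal.Quotient.mk (Ideal.span {c.ϖ})) (c.beta f j (.inl i)) =
      (MvPolynomial.map c.residueHom (MvPolynomial.rename Sum.inl (MvPolynomial.pderiv i (f j))) :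
        MvPolynomial (Var n r) c.Res) := by
  ext m
  have h := congrArg (MvPowerSeries.coeff (m + Finsupp.single (.inr j) 1)) (c.map_psi f (.inl i))
  rw [MvPowerSeries.coeff_map, MvPolynomial.coeff_coe, polyGrad, MvPolynomial.coeff_map] at h
  rw [MvPowerSeries.coeff_map, MvPolynomial.coeff_coe, MvPolynomial.coeff_map, beta, Sum.elim_inl,
    coeff_divY, h, pderiv_inl_totalPoly]
  congr 1
  exact coeff_totalPoly_add_single (fun j => MvPolynomial.pderiv i (f j)) j m

/-- The form `β_j` depends on no `y` other than `y_j`, and its components in the `dx_i` inherit the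
symmetry of the second derivatives of `H`. Derivatives along `y_j` are excluded because `β_j` has no
`dy_j`-component to match them. -/
theorem pderiv_beta (f : Fin r → MvPolynomial (Fin (n + 1)) F) (j : Fin r) (i i' : Var n r)
    (hi : i ≠ .inr j) (hi' : i' ≠ .inr j) : MvPowerSeries.pderiv c.integers i (c.beta f j i') =
      MvPowerSeries.pderiv c.integers i' (c.beta f j i) := by
  have h0 : ∀ j' ≠ j, ∀ i : Fin (n + 1),
      MvPowerSeries.pderiv c.integers (.inr j') (c.beta f j (.inl i)) = 0 := by
    intro j' hj i
    ext m
    rw [MvPowerSeries.coeff_pderiv, beta, Sum.elim_inl, coeff_divY]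
    suffices h : MvPowerSeries.coeff (m + Finsupp.single (.inr j') 1 + Finsupp.single (.inr j) 1)
        (c.psi f (.inl i)) = 0 by rw [h]; simp
    by_contra h
    obtain ⟨k, -, hk⟩ := c.exists_y_of_coeff_hSeries_ne_zero (c.coeff_psi_ne_zero h)
    have h1 : j = k := by
      by_contra h2
      have := hk j h2
      simp at this
    have h2 : j' = k := by
      by_contra h2
      have := hk j' h2
      simp at this
    exact hj (h2.trans h1.symm)
  rcases i with i | i <;> rcases i' with i' | i'
  · simp only [beta, Sum.elim_inl, pderiv_divY]
    rw [pderiv_psi]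
  · rw [h0 i' (by simpa using hi')]; simp [beta]
  · rw [h0 i (by simpa using hi)]; simp [beta]
  · simp [beta]

theorem weight_of_coeff_beta {f : Fin r → MvPolynomial (Fin (n + 1)) F} {d : Fin r → ℕ}
    (hf : ∀ j, (f j).IsHomogeneous (d j)) (j : Fin r) (i : Var n r) (a : Var n r →₀ ℕ)
    (h : MvPowerSeries.coeff a (c.beta f j i) ≠ 0) :
    ∑ z, (a z : ℤ) * wt d z = - wt d i - wt d (.inr j : Var n r) := by
  rcases i with i | i
  · rw [beta, Sum.elim_inl, coeff_divY] at h
    have h6 := c.weight_of_coeff_psi hf (.inl i) _ h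
    simp only [Finsupp.add_apply, Nat.cast_add, add_mul, Finset.sum_add_distrib] at h6
    rw [sum_wt_single] at h6
    linarith
  · rw [beta, Sum.elim_inr, Pi.zero_apply, map_zero] at h
    exact absurd rfl h

/-- The forms `∑ ∏_{j ∉ J} d_j ∏_{j ∈ J} β_j dy_j`, the sum over the sets `J` with `m` elements. -/
def bSeq (f : Fin r → MvPolynomial (Fin (n + 1)) F) (d : Fin r → ℕ) (m : ℕ) :
    Finset (Var n r) → MvPowerSeries (Var n r) c.integers := bForm (c.beta f) d (List.finRange r) m

theorem bSeq_zero (f : Fin r → MvPolynomial (Fin (n + 1)) F) (d : Fin r → ℕ) :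
    c.bSeq f d 0 = ((∏ j, d j : ℕ) : c.integers) • unitForm := by
  rw [bSeq, bForm_zero, ← List.ofFn_eq_map, List.prod_ofFn, Nat.cast_smul_eq_nsmul]

theorem bSeq_of_lt (f : Fin r → MvPolynomial (Fin (n + 1)) F) (d : Fin r → ℕ) {m : ℕ} (h : r < m) :
    c.bSeq f d m = 0 := bForm_of_lt _ _ (by simpa using h)

theorem bSeq_mem_tateForms {f : Fin r → MvPolynomial (Fin (n + 1)) F} {d : Fin r → ℕ}
    (hf : ∀ j, (f j).IsHomogeneous (d j)) (m : ℕ) : c.bSeq f d m ∈ tateForms n d c.ϖ (2 * m) := by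
  have h1 : (∀ S, c.bSeq f d m S ∈ tateRing _ c.ϖ) ∧ FormWtZero d (c.bSeq f d m) := by
    refine bForm_induction (P := fun ω => (∀ S, ω S ∈ tateRing _ c.ϖ) ∧ FormWtZero d ω) _ _ ?_ ?_ ?_ ?_ ?_ _ _
    · exact ⟨fun _ => zero_mem _, fun S m h => by simp at h⟩
    · exact ⟨unitForm_mem_tateForms (d := d) |>.1, unitForm_mem_tateForms (ϖ := c.ϖ) |>.2.1⟩
    · intro e ω h
      rw [← Nat.cast_smul_eq_nsmul c.integers]
      exact ⟨fun S => smul_mem_tateRing (h.1 S) _, h.2.smul _⟩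
    · exact fun ω ω' h h' => ⟨fun S => add_mem (h.1 S) (h'.1 S), h.2.add h'.2⟩
    · intro j ω h
      refine ⟨fun S => ?_, h.2.twoMul (c.weight_of_coeff_beta hf j)⟩
      rw [twoMul_apply]
      refine extMul_mem_tateRing (c.beta_mem_tateRing f j)
        (extMul_mem_tateRing (fun i => ?_) h.1) S
      by_cases hi : i = .inr j
      · rw [hi, Pi.single_eq_same]; exact one_mem _
      · rw [Pi.single_eq_of_ne hi]; exact zero_mem _
  exact ⟨h1.1, h1.2, hasDeg_bForm _ _ _ _⟩

/-- The relation that locates the torsion. The forms `B_m` are closed under `d`, so only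
multiplication by `ψ = ∑ κ_j` remains, and `extMul_bForm` applies. -/
theorem twistedD_bSeq {f : Fin r → MvPolynomial (Fin (n + 1)) F} {d : Fin r → ℕ}
    (hf : ∀ j, (f j).IsHomogeneous (d j)) (m : ℕ) :
    twistedD c.factorInt (c.psi f) (c.bSeq f d m) = formTheta d (c.bSeq f d (m + 1)) := by
  have h1 : formDeriv (c.bSeq f d m) = 0 := by
    refine bForm_induction (P := fun ω => formDeriv ω = 0) _ _ ?_ ?_ ?_ ?_ ?_ _ _
    · exact map_zero _
    · funext S
      rw [formDeriv_apply]
      refine Finset.sum_eq_zero fun i _ => ?_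
      rw [unitForm]
      split_ifs
      · rw [MvPowerSeries.pderiv_one, smul_zero]
      · rw [map_zero, smul_zero]
    · intro e ω h; rw [map_nsmul, h, smul_zero]
    · intro ω ω' h h'; rw [map_add, h, h', add_zero]
    · intro j ω h
      exact formDeriv_twoMul (c.pderiv_beta f j) h
  have h2 := extMul_bForm (β := c.beta f) (d := d)
    (τ := fun i => wt d i • (MvPowerSeries.X i : MvPowerSeries (Var n r) c.integers))
    (x := fun j => MvPowerSeries.X (.inr j)) (g := fun j => c.psi f (.inr j))
    (c.sum_beta_mul hf) (fun j => by simp [wt]) (List.finRange r) m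
  rw [c.sum_kappaForm f] at h2
  rw [twistedD_apply, h1, smul_zero, zero_add]
  exact h2

/-- In `B_r` no factor `d_j` is left: it is the product of all `β_j dy_j`, and `β_j` reduces to
`df_j`. It thus lifts the Koszul generator to a cocycle. -/
theorem map_bSeq [CharP F p] (f : Fin r → MvPolynomial (Fin (n + 1)) F) (d : Fin r → ℕ)
    (S : Finset (Var n r)) :
    MvPowerSeries.map (Ideal.Quotient.mk (Ideal.span {c.ϖ})) (c.bSeq f d r S) =
      (polyTop c.residueHom f (List.finRange r) S : MvPolynomial (Var n r) c.Res) := by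
  have h0 : c.bSeq f d r = (List.finRange r).foldr (fun j ω => twoMul (c.beta f j) j ω) unitForm := by
    rw [← bForm_length, List.length_finRange]; rfl
  rw [h0, polyTop]
  generalize List.finRange r = l
  induction l generalizing S with
  | nil =>
    simp only [List.foldr_nil, unitForm]
    split_ifs <;> simp
  | cons j l ih =>
    simp only [List.foldr_cons]
    set ω := l.foldr (fun j ω => twoMul (c.beta f j) j ω) unitForm with hω
    rw [twoMul, LinearMap.comp_apply, map_extMul]
    have h1 := map_extMul (rk := vrk) (MvPolynomial.coeToMvPowerSeries.ringHom (σ := Var n r) (R := c.Res))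
      (Sum.elim (fun i => MvPolynomial.map c.residueHom
        (MvPolynomial.rename Sum.inl (MvPolynomial.pderiv i (f j)))) 0)
      (crea vrk (.inr j) (polyTop c.residueHom f l)) S
    simp only [MvPolynomial.coeToMvPowerSeries.ringHom_apply] at h1
    refine Eq.trans ?_ h1.symm
    refine congrFun (congrArg₂ (fun (a : Var n r → MvPowerSeries (Var n r) c.Res) b => extMul vrk a b) ?_ ?_) S
    · funext i
      rcases i with i | i
      · rw [map_beta]; rfl
      · simp [beta]
    · funext U
      rw [crea_apply, crea_apply]
      split_ifs
      · rw [map_zsmul, ih]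
        exact (map_zsmul (MvPolynomial.coeToMvPowerSeries.ringHom (σ := Var n r) (R := c.Res)) _ _).symm
      · simp

/-- The cocycles of weight zero in the integral complex in degrees less than `n + r`. -/
theorem exists_tateForms_primitive [CharP F p] (f : Fin r → MvPolynomial (Fin (n + 1)) F) (d : Fin r → ℕ)
    (hr : r < n) (hd : ∀ j, 0 < d j) (hf : ∀ j, (f j).IsHomogeneous (d j))
    (hsmooth : IsSmoothCompleteIntersection f) {k : ℕ} (hk : k < n + r)
    {z : Finset (Var n r) → MvPowerSeries (Var n r) c.integers} (hz : z ∈ tateForms n d c.ϖ k)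
    (hz0 : twistedD c.factorInt (c.psi f) z = 0) :
    ∃ (a : c.integers) (ξ : Finset (Var n r) → MvPowerSeries (Var n r) c.integers),
      (∀ S, ξ S ∈ tateRing _ c.ϖ) ∧ FormWtZero d ξ ∧ (∀ S, S.card + 1 ≠ k → ξ S = 0) ∧
      (k ≠ 2 * r → a = 0) ∧ z = a • c.bSeq f d r + twistedD c.factorInt (c.psi f) ξ := by
  have hb := c.bSeq_mem_tateForms hf r
  refine exists_restricted_primitive c.ϖ_regular c.ϖ_separated c.exists_adic_sum c.residueHom f d hr hd
    hf hsmooth c.ϖ_dvd_factorInt (c.psi_mem_tateRing f) (c.weight_of_coeff_psi hf) (c.map_psi f)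
    (twistedD_twistedD (c.pderiv_psi f)) hb.1 hb.2.1 hb.2.2 ?_ (c.map_bSeq f d) hk z hz.1 hz.2.1 hz.2.2 hz0
  rw [c.twistedD_bSeq hf, c.bSeq_of_lt f d (Nat.lt_succ_self r), map_zero]

end Constants

/-! ### Comparison of the integral complex with Dwork's complex -/

section

variable {n r : ℕ}

theorem ydeg_chi (S : Finset (Var n r)) : ydeg (chi S) = dyCount S := by
  rw [ydeg, dyCount]
  simp only [chi_apply]
  have h : S.filter (fun i => i.isRight = true) = (Finset.univ.filter fun j : Fin r => Sum.inr j ∈ S).map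
      ⟨Sum.inr, Sum.inr_injective⟩ := by
    ext i
    rcases i with i | i <;> simp
  rw [h, Finset.card_map, Finset.card_filter]

theorem ydeg_add_dyCount (m : Var n r →₀ ℕ) (S : Finset (Var n r)) :
    ydeg m + dyCount S = ydeg (m + chi S) := by
  rw [ydeg_add, ydeg_chi]

end

namespace Constants

variable {p : ℕ} [hp : Fact p.Prime] {F : Type*} [Field F] (c : Constants p F) {n r : ℕ}

/-- The substitution `y ↦ π^(Mb) y` on forms with integral coefficients. -/
def scale : (Finset (Var n r) → MvPowerSeries (Var n r) c.integers) →ₗ[c.integers] Form n r ℂ_[p] where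
  toFun ω S := fun m => (MvPowerSeries.coeff m (ω S) : c.integers) * c.π ^ (c.Mb * ydeg (m + chi S))
  map_add' ω ω' := by
    funext S
    ext m
    exact add_mul _ _ _
  map_smul' a ω := by
    funext S
    ext m
    exact mul_assoc _ _ _

theorem coeff_scale (ω : Finset (Var n r) → MvPowerSeries (Var n r) c.integers) (S : Finset (Var n r))
    (m : Var n r →₀ ℕ) : MvPowerSeries.coeff m (c.scale ω S) =
      (MvPowerSeries.coeff m (ω S) : c.integers) * c.π ^ (c.Mb * ydeg (m + chi S)) := rfl

theorem scale_injective : Function.Injective (c.scale (n := n) (r := r)) := by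
  intro ω ω' h
  funext S
  ext m
  have h1 := congrArg (MvPowerSeries.coeff m) (congrFun h S)
  rw [coeff_scale, coeff_scale] at h1
  exact mul_right_cancel₀ (pow_ne_zero _ c.π_ne_zero) h1

theorem thetaInt_apply (d : Fin r → ℕ) (ω : Form n r ℂ_[p]) : c.thetaInt d ω = theta d ω := rfl

theorem theta_eq (d : Fin r → ℕ) (ω : Form n r ℂ_[p]) : theta d ω = formTheta d ω := by
  funext S
  rw [formTheta_apply, extContr_apply]
  refine Finset.sum_congr rfl fun i _ => ?_
  rw [sgn_eq_esgn, smul_mul_assoc]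

theorem D_apply (f : Fin r → MvPolynomial (Fin (n + 1)) F) (ω : Form n r ℂ_[p]) :
    c.D f ω = c.factor • (formDeriv ω +
      extMul vrk (fun i => MvPowerSeries.pderiv ℂ_[p] i (c.hSeries f)) ω) := by
  change c.factor • (extDeriv ω + wedge _ ω) = _
  congr 2
  · funext S
    rw [formDeriv_apply]
    exact Finset.sum_congr rfl fun i _ => by rw [sgn_eq_esgn]
  · funext S
    rw [extMul_apply]
    exact Finset.sum_congr rfl fun i _ => by rw [sgn_eq_esgn]

theorem thetaInt_scale (d : Fin r → ℕ) (ω : Finset (Var n r) → MvPowerSeries (Var n r) c.integers) :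
    c.thetaInt d (c.scale ω) = c.scale (formTheta d ω) := by
  classical
  rw [thetaInt_apply, theta_eq]
  funext S
  ext m
  rw [coeff_scale, formTheta_apply, formTheta_apply, extContr_apply, extContr_apply, map_sum, map_sum,
    AddSubmonoidClass.coe_finsetSum, Finset.sum_mul]
  refine Finset.sum_congr rfl fun i hi => ?_
  rw [Finset.mem_compl] at hi
  rw [map_zsmul, map_zsmul, smul_mul_assoc, smul_mul_assoc, map_zsmul, map_zsmul, MvPowerSeries.X,
    MvPowerSeries.X, MvPowerSeries.coeff_monomial_mul, MvPowerSeries.coeff_monomial_mul]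
  push_cast
  simp only [smul_mul_assoc]
  congr 2
  split_ifs with h
  · rw [one_mul, one_mul, coeff_scale, chi_insert hi, ← add_assoc, tsub_add_cancel_of_le h]
  · simp

theorem formDeriv_scale (ω : Finset (Var n r) → MvPowerSeries (Var n r) c.integers) :
    formDeriv (c.scale ω) = c.scale (formDeriv ω) := by
  funext S
  ext m
  rw [coeff_scale, formDeriv_apply, formDeriv_apply, map_sum, map_sum,
    AddSubmonoidClass.coe_finsetSum, Finset.sum_mul]
  refine Finset.sum_congr rfl fun i hi => ?_
  rw [map_zsmul, map_zsmul, MvPowerSeries.coeff_pderiv, MvPowerSeries.coeff_pderiv, coeff_scale,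
    add_assoc, chi_erase hi]
  push_cast
  rw [smul_mul_assoc]
  congr 1
  ring

variable [Finite F]

theorem extMul_scale (f : Fin r → MvPolynomial (Fin (n + 1)) F)
    (ω : Finset (Var n r) → MvPowerSeries (Var n r) c.integers) :
    c.factor • extMul vrk (fun i => MvPowerSeries.pderiv ℂ_[p] i (c.hSeries f)) (c.scale ω) =
      c.scale (extMul vrk (c.psi f) ω) := by
  classical
  funext S
  ext m
  rw [coeff_scale, Pi.smul_apply, map_smul, extMul_apply, extMul_apply, map_sum, map_sum,
    AddSubmonoidClass.coe_finsetSum, Finset.sum_mul, Finset.smul_sum]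
  refine Finset.sum_congr rfl fun i hi => ?_
  rw [map_zsmul, map_zsmul, smul_comm]
  push_cast
  rw [smul_mul_assoc]
  congr 1
  rw [MvPowerSeries.coeff_mul, MvPowerSeries.coeff_mul, AddSubmonoidClass.coe_finsetSum, Finset.sum_mul,
    Finset.smul_sum]
  refine Finset.sum_congr rfl fun ⟨a, b⟩ hab => ?_
  rw [Subring.coe_mul, coeff_scale, coeff_psi, psiVal, smul_eq_mul]
  have h1 : c.Mb * ydeg (m + chi S) = c.Mb * ydeg (a + Finsupp.single i 1) +
      c.Mb * ydeg (b + chi (S.erase i)) := by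
    rw [← mul_add, ← ydeg_add, ← Finset.HasAntidiagonal.mem_antidiagonal.1 hab, ← chi_erase hi,
      add_add_add_comm]
  have h2 := pow_ne_zero (c.Mb * ydeg (a + Finsupp.single i 1)) c.π_ne_zero
  rw [h1, pow_add]
  field_simp

/-- The power of `π` in `scale` depends only on the `y`-degree of the multidegree. This is unchanged
by `d` and additive under multiplication, which turns `dH` into `ψ`. -/
theorem D_scale (f : Fin r → MvPolynomial (Fin (n + 1)) F)
    (ω : Finset (Var n r) → MvPowerSeries (Var n r) c.integers) :
    c.D f (c.scale ω) = c.scale (twistedD c.factorInt (c.psi f) ω) := by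
  rw [D_apply, twistedD_apply, smul_add, extMul_scale, formDeriv_scale, map_add, map_smul]
  rfl

/-- The condition that the coefficients tend to zero in `ℂ_p` is the `π`-adic one defining
`tateRing`, as an integer is divisible by `π^N` exactly when its norm is at most that of `π^N`. -/
theorem mem_filt {d : Fin r → ℕ} {s : ℤ} {k : ℕ} {ω : Form n r ℂ_[p]} :
    ω ∈ c.filt n d s k ↔ ∃ ω' ∈ tateForms n d c.ϖ k, ω = c.π ^ s • c.scale ω' := by
  have hs : c.π ^ s ≠ 0 := zpow_ne_zero _ c.π_ne_zero
  constructor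
  · intro h
    choose a ha hae using fun S m => (h S).2.1 m
    set ω' : Finset (Var n r) → MvPowerSeries (Var n r) c.integers := fun S m => ⟨a S m, ha S m⟩ with hω'
    have hc : ∀ S m, ((MvPowerSeries.coeff m (ω' S) : c.integers) : ℂ_[p]) = a S m := fun S m => rfl
    have h0 : ∀ S m, MvPowerSeries.coeff m (ω S) = 0 → MvPowerSeries.coeff m (ω' S) = 0 := by
      intro S m h0
      apply Subtype.ext
      rw [hae] at h0
      rw [hc]
      exact ((mul_eq_zero.1 ((mul_eq_zero.1 h0).resolve_right (pow_ne_zero _ c.π_ne_zero))).resolve_right hs)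
    refine ⟨ω', ⟨fun S N => ?_, fun S m hm => (h S).2.2.2 m fun h1 => hm (h0 S m h1), fun S hS => ?_⟩, ?_⟩
    · have h1 := (h S).2.2.1
      have h2 : 0 < ‖c.π‖ ^ N * ‖c.π ^ s‖ := mul_pos (pow_pos c.norm_π_pos _) (norm_pos_iff.2 hs)
      have h3 := (Metric.tendsto_nhds.1 h1 _ h2)
      rw [Filter.eventually_cofinite] at h3
      refine h3.subset fun m hm h4 => hm ?_
      rw [dist_zero_right, hae, mul_div_assoc, div_self (pow_ne_zero _ c.π_ne_zero), mul_one, norm_mul] at h4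
      rw [dvd_iff, hc]
      exact (lt_of_mul_lt_mul_right h4 (norm_nonneg _)).le
    · ext m
      exact congrArg _ (h0 S m (by rw [(h S).1 hS, map_zero]))
    · funext S
      ext m
      rw [Pi.smul_apply, map_smul, coeff_scale, hc, smul_eq_mul, hae, ydeg_add_dyCount]
      ring
  · rintro ⟨ω', ⟨h1, h2, h3⟩, rfl⟩ S
    have hc : ∀ m, MvPowerSeries.coeff m ((c.π ^ s • c.scale ω') S) =
        (MvPowerSeries.coeff m (ω' S) : c.integers) * c.π ^ s * c.π ^ (c.Mb * (ydeg m + dyCount S)) := by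
      intro m
      rw [Pi.smul_apply, map_smul, coeff_scale, smul_eq_mul, ydeg_add_dyCount]
      ring
    refine ⟨fun hS => ?_, fun m => ⟨_, (MvPowerSeries.coeff m (ω' S)).2, hc m⟩, ?_, fun m hm => h2 S m fun h0 => hm ?_⟩
    · ext m
      rw [hc, h3 S hS]
      simp
    · simp only [hc, mul_div_assoc, div_self (pow_ne_zero _ c.π_ne_zero), mul_one]
      rw [Metric.tendsto_nhds]
      intro ε hε
      obtain ⟨N, hN⟩ := exists_pow_lt_of_lt_one (div_pos hε (norm_pos_iff.2 hs)) c.norm_π_lt_one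
      rw [Filter.eventually_cofinite]
      refine (h1 S N).subset fun m hm h4 => hm ?_
      rw [dist_zero_right, norm_mul]
      rw [dvd_iff] at h4
      rw [lt_div_iff₀ (norm_pos_iff.2 hs)] at hN
      exact (mul_le_mul_of_nonneg_right h4 (norm_nonneg _)).trans_lt hN
    · rw [hc, h0]; simp

end Constants

/-! ### Iterating the connecting homomorphism -/

/-- A short exact sequence `0 → U → T → Q → 0` of complexes in which `Q` is, in positive degrees,
the shift of `U`, together with the data that determine the cohomology of `U`: the cohomology of `T`
in degrees less than `N` is generated by the class of `B r` in degree `2 r`. -/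
structure ShiftedSequence (O V V' : Type*) [CommRing O] [AddCommGroup V] [Module O V]
    [AddCommGroup V'] [Module O V'] where
  /-- the boundary map of `T` and `U` -/
  δ : V →ₗ[O] V
  /-- the boundary map of `Q` -/
  δ' : V' →ₗ[O] V'
  /-- the subcomplex -/
  U : ℕ → Submodule O V
  /-- the complex in the middle -/
  T : ℕ → Submodule O V
  /-- the quotient complex -/
  Q : ℕ → Submodule O V'
  /-- the projection to the quotient -/
  q : ℕ → V →ₗ[O] V'
  /-- the shift -/
  ι : V →ₗ[O] V'
  /-- a generator of the quotient in degree zero -/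
  e : V'
  /-- the annihilator of the torsion -/
  P : O
  /-- forms that compute the iterated connecting homomorphism -/
  B : ℕ → V
  /-- half of the degree of the cohomology of `T` -/
  r : ℕ
  /-- a bound for the degrees -/
  N : ℕ
  δ_δ : ∀ {k v}, v ∈ T k → δ (δ v) = 0
  δ_mem : ∀ {k v}, v ∈ T k → δ v ∈ T (k + 1)
  mem_U : ∀ {k v}, v ∈ U k ↔ v ∈ T k ∧ q k v = 0
  q_mem : ∀ {k v}, v ∈ T k → q k v ∈ Q k
  q_surj : ∀ {k w}, w ∈ Q k → ∃ v ∈ T k, q k v = w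
  q_δ : ∀ {k v}, v ∈ T k → q (k + 1) (δ v) = δ' (q k v)
  ι_inj : Function.Injective ι
  mem_Q : ∀ {k w}, w ∈ Q (k + 1) ↔ ∃ u ∈ U k, ι u = w
  δ'_ι : ∀ u, δ' (ι u) = -ι (δ u)
  mem_Q_zero : ∀ {w}, w ∈ Q 0 ↔ ∃ a : O, a • e = w
  δ'_e : δ' e = 0
  e_free : ∀ {a : O}, a • e = 0 → a = 0
  exact : ∀ {k v}, k < N → v ∈ T k → δ v = 0 →
    ∃ a : O, (k ≠ 2 * r → a = 0) ∧ v - a • B r ∈ coboundaries δ T k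
  B_mem : ∀ m, B m ∈ T (2 * m)
  q_B_zero : q 0 (B 0) = P • e
  q_B_succ : ∀ m, q (2 * (m + 1)) (B (m + 1)) = ι (δ (B m))
  B_of_lt : ∀ {m}, r < m → B m = 0
  P_regular : ∀ {a : O}, a * P = 0 → a = 0

namespace ShiftedSequence

variable {O V V' : Type*} [CommRing O] [AddCommGroup V] [Module O V] [AddCommGroup V'] [Module O V']
  (X : ShiftedSequence O V V')

/-- Sequences in which each term is the image of the preceding one under the connecting
homomorphism. -/
def IsEta (η : ℕ → V') : Prop :=
  η 0 = X.e ∧ ∀ i, ∃ w ∈ X.U (2 * i + 1), η (i + 1) = X.ι w ∧ ∃ τ ∈ X.T (2 * i), X.q (2 * i) τ = η i ∧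
    w - X.δ τ ∈ (X.U (2 * i)).map X.δ

variable {X} {η : ℕ → V'}

theorem ι_mem_coboundaries {k : ℕ} {u : V} (h : u ∈ coboundaries X.δ X.U k) :
    X.ι u ∈ coboundaries X.δ' X.Q (k + 1) := by
  cases k with
  | zero =>
    rw [coboundaries, Submodule.mem_bot] at h
    rw [h, map_zero]
    exact zero_mem _
  | succ k =>
    obtain ⟨u', hu', rfl⟩ := h
    exact ⟨X.ι (-u'), X.mem_Q.2 ⟨_, neg_mem hu', rfl⟩, by rw [X.δ'_ι, map_neg, map_neg, neg_neg]⟩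

theorem exists_of_mem_coboundaries {k : ℕ} {w : V'} (h : w ∈ coboundaries X.δ' X.Q k) :
    ∃ y ∈ X.T k, X.δ y = 0 ∧ y ∈ coboundaries X.δ X.T k ∧ X.q k y = w := by
  cases k with
  | zero =>
    rw [coboundaries, Submodule.mem_bot] at h
    exact ⟨0, zero_mem _, map_zero _, zero_mem _, by rw [h, map_zero]⟩
  | succ k =>
    obtain ⟨w', hw', rfl⟩ := h
    obtain ⟨v, hv, rfl⟩ := X.q_surj hw'
    exact ⟨X.δ v, X.δ_mem hv, X.δ_δ hv, ⟨v, hv, rfl⟩, X.q_δ hv⟩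

theorem q_mem_coboundaries {k : ℕ} {y : V} (h : y ∈ coboundaries X.δ X.T k) :
    X.q k y ∈ coboundaries X.δ' X.Q k := by
  cases k with
  | zero =>
    rw [coboundaries, Submodule.mem_bot] at h
    rw [h, map_zero]; exact zero_mem _
  | succ k =>
    obtain ⟨v, hv, rfl⟩ := h
    exact ⟨X.q k v, X.q_mem hv, (X.q_δ hv).symm⟩

/-- A cocycle of `T` whose image in `Q` is a coboundary comes from `U` up to a cocycle. -/
theorem exists_mem_U {k : ℕ} {v : V} (hv : v ∈ X.T k) (h : X.q k v ∈ coboundaries X.δ' X.Q k) :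
    ∃ u ∈ X.U k, X.δ u = X.δ v := by
  obtain ⟨y, hy, hy0, -, hyq⟩ := exists_of_mem_coboundaries h
  exact ⟨v - y, X.mem_U.2 ⟨sub_mem hv hy, by rw [map_sub, hyq, sub_self]⟩, by rw [map_sub, hy0, sub_zero]⟩

/-- The relation for `q (B (m + 1))` says that the connecting homomorphism sends the class of `q (B
m)` to that of `q (B (m + 1))`. Since `q (B 0) = P • e`, the class of `q (B m)` is `P` times that of
`η m`. -/
theorem IsEta.q_B_sub (hη : X.IsEta η) (m : ℕ) :
    X.q (2 * m) (X.B m) - X.P • η m ∈ coboundaries X.δ' X.Q (2 * m) := by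
  induction m with
  | zero => rw [hη.1, mul_zero, X.q_B_zero, sub_self]; exact zero_mem _
  | succ m ih =>
    obtain ⟨w, hw, hwη, τ, hτ, hτη, hwτ⟩ := hη.2 m
    obtain ⟨u, hu, hu'⟩ := exists_mem_U (sub_mem (X.B_mem m) (Submodule.smul_mem _ X.P hτ))
      (by rw [map_sub, map_smul, hτη]; exact ih)
    rw [X.q_B_succ, hwη, ← map_smul, ← map_sub]
    refine ι_mem_coboundaries (k := 2 * m + 1) ?_
    have h1 : X.δ (X.B m) - X.P • w = X.δ u - X.P • (w - X.δ τ) := by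
      rw [hu', map_sub, map_smul, smul_sub]; abel
    rw [h1]
    exact sub_mem ⟨u, hu, rfl⟩ (Submodule.smul_mem _ _ hwτ)

/-- If `a` kills `η (i + 1)`, then `a` times a lift of `η i`, corrected by elements of `U`, is a
cocycle of `T`. It is a multiple `b` of `B r` up to a coboundary, and its image in `Q` gives the
relation one step lower. -/
theorem IsEta.exists_of_smul_mem (hη : X.IsEta η) {i : ℕ} (hi : 2 * i < X.N) {a : O}
    (h : a • η (i + 1) ∈ coboundaries X.δ' X.Q (2 * (i + 1))) :
    ∃ b : O, (i ≠ X.r → b = 0) ∧ (a - b * X.P) • η i ∈ coboundaries X.δ' X.Q (2 * i) := by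
  obtain ⟨w, hw, hwη, τ, hτ, hτη, ⟨u', hu', hwτ⟩⟩ := hη.2 i
  obtain ⟨w', hw', hw''⟩ := h
  obtain ⟨u, hu, rfl⟩ := (X.mem_Q (k := 2 * i)).1 hw'
  rw [hwη, X.δ'_ι, ← map_smul, ← map_neg] at hw''
  have h1 := X.ι_inj hw''
  have hT : a • τ + a • u' + u ∈ X.T (2 * i) :=
    add_mem (add_mem (Submodule.smul_mem _ _ hτ) (Submodule.smul_mem _ _ (X.mem_U.1 hu').1)) (X.mem_U.1 hu).1
  have h2 : X.δ (a • τ + a • u' + u) = 0 := by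
    rw [map_add, map_add, map_smul, map_smul, hwτ, smul_sub, ← h1]; abel
  obtain ⟨b, hb, hcob⟩ := X.exact hi hT h2
  refine ⟨b, fun h => hb (by omega), ?_⟩
  have h3 := q_mem_coboundaries hcob
  rw [map_sub, map_add, map_add, map_smul, map_smul, map_smul, (X.mem_U.1 hu).2, (X.mem_U.1 hu').2,
    smul_zero, add_zero, add_zero, hτη] at h3
  by_cases hir : i = X.r
  · have h4 := Submodule.smul_mem _ b (hη.q_B_sub i)
    have h5 := add_mem h3 h4
    have h6 : a • η i - b • X.q (2 * i) (X.B X.r) + b • (X.q (2 * i) (X.B i) - X.P • η i) =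
        (a - b * X.P) • η i := by
      rw [hir]; module
    rwa [h6] at h5
  · rw [hb (by omega)] at h3 ⊢
    simpa using h3

/-- The iterated image of the generator in degree zero has no annihilator up to degree `2 r`. -/
theorem IsEta.eq_zero_of_smul_mem (hη : X.IsEta η) {i : ℕ} (hi : i ≤ X.r) (hN : 2 * i < X.N + 2) {a : O}
    (h : a • η i ∈ coboundaries X.δ' X.Q (2 * i)) : a = 0 := by
  induction i generalizing a with
  | zero =>
    rw [mul_zero, coboundaries, Submodule.mem_bot, hη.1] at h
    exact X.e_free h
  | succ i ih =>
    obtain ⟨b, hb, h1⟩ := hη.exists_of_smul_mem (by omega) h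
    rw [hb (by omega), zero_mul, sub_zero] at h1
    exact ih (by omega) (by omega) h1

/-- Beyond degree `2 r` the annihilator is generated by `P`. -/
theorem IsEta.smul_mem_iff (hη : X.IsEta η) {i : ℕ} (hi : X.r < i) (hN : 2 * i < X.N + 2) {a : O} :
    a • η i ∈ coboundaries X.δ' X.Q (2 * i) ↔ X.P ∣ a := by
  constructor
  · intro h
    obtain ⟨j, rfl⟩ := Nat.exists_eq_add_of_lt hi
    induction j generalizing a with
    | zero =>
      -- Here `i = r + 1`, the only step at which `b` can be nonzero: `a - b P` annihilates the
      -- torsion-free class `η r`, so `a = b P`.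
      obtain ⟨b, hb, h1⟩ := hη.exists_of_smul_mem (by omega) h
      have h2 := hη.eq_zero_of_smul_mem (by omega) (by omega) h1
      exact ⟨b, by rw [sub_eq_zero.1 h2, mul_comm]⟩
    | succ j ih =>
      obtain ⟨b, hb, h1⟩ := hη.exists_of_smul_mem (by omega) h
      rw [hb (by omega), zero_mul, sub_zero] at h1
      exact ih (by omega) (by omega) h1
  · rintro ⟨b, rfl⟩
    -- Past `r` the form `B i` is zero, and its comparison with `P • η i` shows that `P` annihilates
    -- the class.
    have h := hη.q_B_sub i
    rw [X.B_of_lt hi, map_zero, zero_sub] at h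
    have h1 := Submodule.smul_mem _ (-b) h
    rwa [smul_neg, neg_smul, neg_neg, smul_smul, mul_comm b] at h1

/-- As `T` has no cohomology in odd degrees below `N`, the connecting homomorphism into odd degrees
of `U` is surjective, and generators are carried to generators. -/
theorem IsEta.exists_sub_mem (hη : X.IsEta η) {i : ℕ} (hN : 2 * i < X.N + 1) {z : V'}
    (hz : z ∈ X.Q (2 * i)) (hz0 : X.δ' z = 0) :
    ∃ a : O, z - a • η i ∈ coboundaries X.δ' X.Q (2 * i) := by
  induction i generalizing z with
  | zero =>
    obtain ⟨a, rfl⟩ := X.mem_Q_zero.1 hz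
    exact ⟨a, by rw [hη.1, sub_self]; exact zero_mem _⟩
  | succ i ih =>
    obtain ⟨w, hw, hwη, τ, hτ, hτη, hwτ⟩ := hη.2 i
    obtain ⟨u, hu, rfl⟩ := X.mem_Q.1 hz
    rw [X.δ'_ι, neg_eq_zero, ← map_zero X.ι] at hz0
    obtain ⟨b, hb, ⟨τ', hτ', h1⟩⟩ := X.exact (k := 2 * i + 1) (by omega) (X.mem_U.1 hu).1 (X.ι_inj hz0)
    rw [hb (by omega), zero_smul, sub_zero] at h1
    have h2 : X.δ' (X.q (2 * i) τ') = 0 := by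
      rw [← X.q_δ hτ', h1]
      exact (X.mem_U.1 hu).2
    obtain ⟨a, ha⟩ := ih (by omega) (X.q_mem hτ') h2
    obtain ⟨u', hu', h3⟩ := exists_mem_U (sub_mem hτ' (Submodule.smul_mem _ a hτ))
      (by rw [map_sub, map_smul, hτη]; exact ha)
    refine ⟨a, ?_⟩
    rw [hwη, ← map_smul, ← map_sub]
    refine ι_mem_coboundaries (k := 2 * i + 1) ?_
    have h4 : u - a • w = X.δ u' - a • (w - X.δ τ) := by
      rw [h3, map_sub, map_smul, h1, smul_sub]; abel
    rw [h4]
    exact sub_mem ⟨u', hu', rfl⟩ (Submodule.smul_mem _ _ hwτ)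

/-- The cohomology of `U` in even degrees vanishes. -/
theorem IsEta.mem_coboundaries (hη : X.IsEta η) {i : ℕ} (hN : 2 * i < X.N) {u : V}
    (hu : u ∈ X.U (2 * i)) (hu0 : X.δ u = 0) : u ∈ coboundaries X.δ X.U (2 * i) := by
  induction i generalizing u with
  | zero =>
    obtain ⟨b, hb, h1⟩ := X.exact hN (X.mem_U.1 hu).1 hu0
    have hb0 : b = 0 := by
      by_cases hr : 0 = X.r
      · have h2 := q_mem_coboundaries h1
        rw [mul_zero, map_sub, map_smul, ← hr] at h2
        have h3 : X.q 0 u = 0 := (X.mem_U.1 hu).2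
        rw [h3, X.q_B_zero, zero_sub, coboundaries, Submodule.mem_bot, neg_eq_zero, smul_smul] at h2
        exact X.P_regular (X.e_free h2)
      · exact hb (by omega)
    rw [hb0, zero_smul, sub_zero] at h1
    exact h1
  | succ i ih =>
    obtain ⟨b, hb, h1⟩ := X.exact hN (X.mem_U.1 hu).1 hu0
    -- In degree `2 r` the image of `u` in `Q` is zero, so `b P` annihilates `η r`, which has no
    -- annihilator. Since `P` is regular, `b = 0`.
    have hb0 : b = 0 := by
      by_cases hr : i + 1 = X.r
      · have h2 := q_mem_coboundaries h1
        rw [map_sub, map_smul, ← hr, (X.mem_U.1 hu).2, zero_sub] at h2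
        have h3 := add_mem h2 (Submodule.smul_mem _ b (hη.q_B_sub (i + 1)))
        have h4 : -(b • X.q (2 * (i + 1)) (X.B (i + 1))) +
            b • (X.q (2 * (i + 1)) (X.B (i + 1)) - X.P • η (i + 1)) = (-(b * X.P)) • η (i + 1) := by module
        rw [h4] at h3
        have h5 := hη.eq_zero_of_smul_mem (by omega) (by omega) h3
        exact X.P_regular (neg_eq_zero.1 h5)
      · exact hb (by omega)
    rw [hb0, zero_smul, sub_zero] at h1
    obtain ⟨ξ, hξ, rfl⟩ := h1
    have hξ' : ξ ∈ X.T (2 * i + 1) := hξ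
    -- The image of `ξ` is the shift of a cocycle of `U` of degree `2 i`, a coboundary by induction.
    -- So `ξ` can be moved into `U` without changing its boundary.
    have h2 : X.q (2 * i + 1) ξ ∈ coboundaries X.δ' X.Q (2 * i + 1) := by
      obtain ⟨u₁, hu₁, h3⟩ := X.mem_Q.1 (X.q_mem hξ')
      rw [← h3]
      refine ι_mem_coboundaries (ih (by omega) hu₁ ?_)
      have h4 := X.δ'_ι u₁
      rw [h3, ← X.q_δ hξ'] at h4
      have h5 : X.q (2 * i + 1 + 1) (X.δ ξ) = 0 := (X.mem_U.1 hu).2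
      rw [h5, zero_eq_neg, ← map_zero X.ι] at h4
      exact X.ι_inj h4
    obtain ⟨u', hu', h6⟩ := exists_mem_U hξ' h2
    exact ⟨u', hu', h6⟩

variable (X) in
theorem exists_isEta : ∃ η, X.IsEta η := by
  have step : ∀ (i : ℕ) (w : {w // w ∈ X.Q (2 * i) ∧ X.δ' w = 0}), ∃ w' : {w // w ∈ X.Q (2 * (i + 1)) ∧ X.δ' w = 0},
      ∃ u ∈ X.U (2 * i + 1), w'.1 = X.ι u ∧ ∃ τ ∈ X.T (2 * i), X.q (2 * i) τ = w.1 ∧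
        u - X.δ τ ∈ (X.U (2 * i)).map X.δ := by
    rintro i ⟨w, hw, hw0⟩
    obtain ⟨τ, hτ, hτw⟩ := X.q_surj hw
    have hU : X.δ τ ∈ X.U (2 * i + 1) :=
      X.mem_U.2 ⟨X.δ_mem hτ, by rw [X.q_δ hτ, hτw, hw0]⟩
    refine ⟨⟨X.ι (X.δ τ), X.mem_Q.2 ⟨_, hU, rfl⟩, by rw [X.δ'_ι, X.δ_δ hτ, map_zero, neg_zero]⟩,
      X.δ τ, hU, rfl, τ, hτ, hτw, ?_⟩
    rw [sub_self]; exact zero_mem _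
  choose g hg using step
  have he : X.e ∈ X.Q (2 * 0) := X.mem_Q_zero.2 ⟨1, one_smul _ _⟩
  let η : (i : ℕ) → {w // w ∈ X.Q (2 * i) ∧ X.δ' w = 0} := fun i => Nat.rec ⟨X.e, he, X.δ'_e⟩ (fun i w => g i w) i
  exact ⟨fun i => (η i).1, rfl, fun i => hg i (η i)⟩

end ShiftedSequence

/-! ### Dwork's complex -/

namespace Constants

variable {p : ℕ} [hp : Fact p.Prime] {F : Type*} [Field F] (c : Constants p F) {n r : ℕ}

theorem D_smul (f : Fin r → MvPolynomial (Fin (n + 1)) F) (a : ℂ_[p]) (ω : Form n r ℂ_[p]) :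
    c.D f (a • ω) = a • c.D f ω :=
  ((c.π ^ c.Mb * c.γ⁻¹) • (extDeriv + wedge (fun i => MvPowerSeries.pderiv ℂ_[p] i (c.hSeries f)))).map_smul a ω

theorem thetaInt_smul (d : Fin r → ℕ) (a : ℂ_[p]) (ω : Form n r ℂ_[p]) :
    c.thetaInt d (a • ω) = a • c.thetaInt d ω := (theta d).map_smul a ω

theorem hatD_apply (f : Fin r → MvPolynomial (Fin (n + 1)) F) (w : ℂ_[p] × Form n r ℂ_[p]) :
    c.hatD f w = (0, -c.D f w.2) := rfl

theorem integers_smul_eq (a : c.integers) (ω : Form n r ℂ_[p]) : a • ω = (a : ℂ_[p]) • ω := rfl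

/-- The linear map underlying `toHat`. -/
def toHatLinear (n : ℕ) (d : Fin r → ℕ) (k : ℕ) :
    Form n r ℂ_[p] →ₗ[c.integers] ℂ_[p] × Form n r ℂ_[p] where
  toFun := c.toHat n d k
  map_add' ω ω' := by
    unfold toHat
    split_ifs
    · rw [Pi.add_apply, map_add, Prod.mk_add_mk, add_zero]
    · rw [map_add, Prod.mk_add_mk, add_zero]
  map_smul' a ω := by
    unfold toHat
    split_ifs
    · refine Prod.ext rfl (smul_zero a).symm
    · rw [map_smul]
      exact Prod.ext (smul_zero a).symm rfl

theorem toHatLinear_zero (d : Fin r → ℕ) (τ : Form n r ℂ_[p]) :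
    c.toHatLinear n d 0 τ = (MvPowerSeries.constantCoeff (τ ∅), 0) := rfl

theorem toHatLinear_succ (d : Fin r → ℕ) (k : ℕ) (τ : Form n r ℂ_[p]) :
    c.toHatLinear n d (k + 1) τ = (0, c.thetaInt d τ) := rfl

theorem mem_tilde {d : Fin r → ℕ} {s : ℤ} {k : ℕ} {ω : Form n r ℂ_[p]} :
    ω ∈ c.tilde n d s k ↔ ∃ τ ∈ c.filt n d s (k + 1), c.thetaInt d τ = ω := Iff.rfl

theorem mem_hat_succ {d : Fin r → ℕ} {s : ℤ} {k : ℕ} {w : ℂ_[p] × Form n r ℂ_[p]} :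
    w ∈ c.hat n d s (k + 1) ↔ ∃ u ∈ c.tilde n d s k, ((0, u) : ℂ_[p] × Form n r ℂ_[p]) = w := Iff.rfl

theorem mem_hat_zero {d : Fin r → ℕ} {w : ℂ_[p] × Form n r ℂ_[p]} :
    w ∈ c.hat n d 0 0 ↔ ∃ a : c.integers, a • ((1, 0) : ℂ_[p] × Form n r ℂ_[p]) = w := by
  constructor
  · rintro ⟨x, hx, rfl⟩
    obtain ⟨a, rfl⟩ := Submodule.mem_span_singleton.1 hx
    exact ⟨a, Prod.ext (by rw [zpow_zero]; rfl) (smul_zero a)⟩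
  · rintro ⟨a, rfl⟩
    exact ⟨a • c.π ^ (0 : ℤ), Submodule.smul_mem _ _ (Submodule.mem_span_singleton_self _),
      Prod.ext (by rw [zpow_zero]; rfl) (smul_zero a).symm⟩

variable [Finite F]

theorem mem_filt_zero {d : Fin r → ℕ} {k : ℕ} {ω : Form n r ℂ_[p]} :
    ω ∈ c.filt n d 0 k ↔ ∃ ω' ∈ tateForms n d c.ϖ k, c.scale ω' = ω := by
  rw [mem_filt]
  simp only [zpow_zero, one_smul, eq_comm]

theorem formTheta_of_hasDeg_zero (d : Fin r → ℕ)
    {ω : Finset (Var n r) → MvPowerSeries (Var n r) c.integers} (h : HasDeg 0 ω) :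
    formTheta d ω = 0 := by
  funext S
  rw [formTheta_apply, extContr_apply]
  refine Finset.sum_eq_zero fun i hi => ?_
  rw [h _ (Finset.card_ne_zero_of_mem (Finset.mem_insert_self i S)), mul_zero, smul_zero]

theorem coeff_zero_formTheta (d : Fin r → ℕ)
    (ω : Finset (Var n r) → MvPowerSeries (Var n r) c.integers) (S : Finset (Var n r)) :
    MvPowerSeries.coeff 0 (formTheta d ω S) = 0 := by
  rw [formTheta_apply, extContr_apply, map_sum]
  refine Finset.sum_eq_zero fun i _ => ?_
  rw [map_zsmul, smul_mul_assoc, map_zsmul, MvPowerSeries.coeff_zero_X_mul, smul_zero, smul_zero]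

theorem constantCoeff_scale (ω : Finset (Var n r) → MvPowerSeries (Var n r) c.integers) :
    MvPowerSeries.constantCoeff (c.scale ω ∅) = ((MvPowerSeries.coeff 0 (ω ∅) : c.integers) : ℂ_[p]) := by
  rw [← MvPowerSeries.coeff_zero_eq_constantCoeff_apply, coeff_scale]
  simp [chi, ydeg]

/-- Exactness in the middle of the short sequence. In positive degrees it is exactness of `θ`; in
degree `0`, where `θ` vanishes, the constant term is the only obstruction. -/
theorem mem_tilde_zero_iff {d : Fin r → ℕ} (hd : ∀ j, 0 < d j) {k : ℕ} {v : Form n r ℂ_[p]} :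
    v ∈ c.tilde n d 0 k ↔ v ∈ c.filt n d 0 k ∧ c.toHatLinear n d k v = 0 := by
  constructor
  · rw [mem_tilde]
    rintro ⟨τ, hτ, rfl⟩
    obtain ⟨ω, hω, rfl⟩ := c.mem_filt_zero.1 hτ
    rw [thetaInt_scale]
    refine ⟨c.mem_filt_zero.2 ⟨_, formTheta_mem_tateForms hω, rfl⟩, ?_⟩
    cases k with
    | zero =>
      rw [toHatLinear_zero, constantCoeff_scale, coeff_zero_formTheta]; rfl
    | succ k =>
      rw [toHatLinear_succ, thetaInt_scale, formTheta_formTheta, map_zero]; rfl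
  · rintro ⟨hv, h0⟩
    obtain ⟨ω, hω, rfl⟩ := c.mem_filt_zero.1 hv
    have h1 : formTheta d ω = 0 ∧ MvPowerSeries.coeff 0 (ω ∅) = 0 := by
      cases k with
      | zero =>
        refine ⟨c.formTheta_of_hasDeg_zero d hω.2.2, ?_⟩
        have := congrArg Prod.fst h0
        rw [toHatLinear_zero, constantCoeff_scale] at this
        exact Subtype.ext this
      | succ k =>
        constructor
        · have := congrArg Prod.snd h0
          rw [toHatLinear_succ, thetaInt_scale] at this
          exact c.scale_injective (this.trans (map_zero _).symm)
        · rw [hω.2.2 ∅ (by simp), map_zero]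
    obtain ⟨ξ, hξ, h2⟩ := exists_formTheta_eq hd hω h1.1 h1.2
    exact c.mem_tilde.2 ⟨c.scale ξ, c.mem_filt_zero.2 ⟨ξ, hξ, rfl⟩, by rw [thetaInt_scale, h2]⟩

theorem hatD_toHatLinear (f : Fin r → MvPolynomial (Fin (n + 1)) F) {d : Fin r → ℕ}
    (hf : ∀ j, (f j).IsHomogeneous (d j)) {k : ℕ} {v : Form n r ℂ_[p]} (hv : v ∈ c.filt n d 0 k) :
    c.toHatLinear n d (k + 1) (c.D f v) = c.hatD f (c.toHatLinear n d k v) := by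
  obtain ⟨ω, hω, rfl⟩ := c.mem_filt_zero.1 hv
  have h1 := hω.2.1.twistedD_formTheta (c := c.factorInt) (c.sum_psi_mul_X hf)
  rw [toHatLinear_succ, D_scale, thetaInt_scale, hatD_apply]
  cases k with
  | zero =>
    rw [c.formTheta_of_hasDeg_zero d hω.2.2, map_zero, zero_eq_neg] at h1
    rw [h1, toHatLinear_zero, map_zero, map_zero, neg_zero]
  | succ k =>
    rw [toHatLinear_succ, thetaInt_scale, D_scale, h1, map_neg, neg_neg]

theorem prod_ne_zero {d : Fin r → ℕ} (hd : ∀ j, 0 < d j) : ((∏ j, d j : ℕ) : c.integers) ≠ 0 := by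
  intro h
  have h1 := congrArg Subtype.val h
  have h2 : ((∏ j, d j : ℕ) : ℂ_[p]) = 0 := h1
  rw [Nat.cast_eq_zero] at h2
  exact (Finset.prod_pos fun j _ => hd j).ne' h2

/-- Dwork's complex of level zero, with its subcomplex and quotient complex. -/
def shiftedSequence [CharP F p] (f : Fin r → MvPolynomial (Fin (n + 1)) F) (d : Fin r → ℕ)
    (hr : r < n) (hd : ∀ j, 0 < d j) (hf : ∀ j, (f j).IsHomogeneous (d j))
    (hsmooth : IsSmoothCompleteIntersection f) :
    ShiftedSequence c.integers (Form n r ℂ_[p]) (ℂ_[p] × Form n r ℂ_[p]) where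
  δ := c.D f
  δ' := c.hatD f
  U := c.tilde n d 0
  T := c.filt n d 0
  Q := c.hat n d 0
  q := c.toHatLinear n d
  ι := LinearMap.inr c.integers ℂ_[p] (Form n r ℂ_[p])
  e := (1, 0)
  P := ((∏ j, d j : ℕ) : c.integers)
  B m := c.scale (c.bSeq f d m)
  r := r
  N := n + r
  δ_δ h := by
    obtain ⟨ω, hω, rfl⟩ := c.mem_filt_zero.1 h
    rw [D_scale, D_scale, twistedD_twistedD (c.pderiv_psi f), map_zero]
  δ_mem h := by
    obtain ⟨ω, hω, rfl⟩ := c.mem_filt_zero.1 h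
    rw [D_scale]
    exact c.mem_filt_zero.2 ⟨_, twistedD_mem_tateForms (c.psi_mem_tateRing f) (c.weight_of_coeff_psi hf) hω, rfl⟩
  mem_U := c.mem_tilde_zero_iff hd
  q_mem {k v} h := by
    cases k with
    | zero =>
      obtain ⟨ω, hω, rfl⟩ := c.mem_filt_zero.1 h
      rw [toHatLinear_zero, constantCoeff_scale]
      exact c.mem_hat_zero.2 ⟨MvPowerSeries.coeff 0 (ω ∅), Prod.ext (mul_one _) (smul_zero _)⟩
    | succ k => exact c.mem_hat_succ.2 ⟨_, c.mem_tilde.2 ⟨v, h, rfl⟩, rfl⟩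
  q_surj {k w} h := by
    cases k with
    | zero =>
      obtain ⟨a, rfl⟩ := c.mem_hat_zero.1 h
      refine ⟨c.scale (a • unitForm), c.mem_filt_zero.2
        ⟨_, Submodule.smul_mem _ _ unitForm_mem_tateForms, rfl⟩, ?_⟩
      rw [toHatLinear_zero, constantCoeff_scale]
      refine Prod.ext ?_ (smul_zero a).symm
      simp [unitForm]
      exact (mul_one (a : ℂ_[p])).symm
    | succ k =>
      obtain ⟨u, hu, rfl⟩ := c.mem_hat_succ.1 h
      obtain ⟨τ, hτ, rfl⟩ := c.mem_tilde.1 hu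
      exact ⟨τ, hτ, rfl⟩
  q_δ h := c.hatD_toHatLinear f hf h
  ι_inj := LinearMap.inr_injective
  mem_Q := c.mem_hat_succ
  δ'_ι u := by
    rw [hatD_apply]
    exact Prod.ext neg_zero.symm rfl
  mem_Q_zero := c.mem_hat_zero
  δ'_e := by
    rw [hatD_apply, map_zero, neg_zero]; rfl
  e_free {a} h := by
    have h1 := congrArg Prod.fst h
    exact Subtype.ext ((mul_one (a : ℂ_[p])).symm.trans h1)
  exact {k v} hk hv h0 := by
    obtain ⟨ω, hω, rfl⟩ := c.mem_filt_zero.1 hv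
    rw [D_scale] at h0
    obtain ⟨a, ξ, h1, h2, h3, h4, h5⟩ := c.exists_tateForms_primitive f d hr hd hf hsmooth hk hω
      (c.scale_injective (h0.trans (map_zero _).symm))
    refine ⟨a, h4, ?_⟩
    rw [h5, map_add, map_smul, add_sub_cancel_left, ← D_scale]
    cases k with
    | zero =>
      -- For `k = 0` the condition `S.card + 1 ≠ k` always holds, so there is no primitive to speak
      -- of.
      have h6 : ξ = 0 := funext fun S => h3 S (by omega)
      rw [h6, map_zero, map_zero]
      exact zero_mem _
    | succ k =>
      exact ⟨c.scale ξ, c.mem_filt_zero.2 ⟨ξ, ⟨h1, h2, fun S hS => h3 S (by omega)⟩, rfl⟩, rfl⟩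
  B_mem m := c.mem_filt_zero.2 ⟨_, c.bSeq_mem_tateForms hf m, rfl⟩
  q_B_zero := by
    rw [toHatLinear_zero, constantCoeff_scale, bSeq_zero]
    generalize ((∏ j, d j : ℕ) : c.integers) = a
    refine Prod.ext ?_ (smul_zero a).symm
    simp [unitForm]
    exact (mul_one (a : ℂ_[p])).symm
  q_B_succ m := by
    rw [Nat.mul_succ, toHatLinear_succ, thetaInt_scale, D_scale, c.twistedD_bSeq hf]; rfl
  B_of_lt h := by rw [c.bSeq_of_lt f d h, map_zero]
  P_regular h := (mul_eq_zero.1 h).resolve_right (c.prod_ne_zero hd)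

theorem isEta_iff [CharP F p] (f : Fin r → MvPolynomial (Fin (n + 1)) F) (d : Fin r → ℕ)
    (hr : r < n) (hd : ∀ j, 0 < d j) (hf : ∀ j, (f j).IsHomogeneous (d j))
    (hsmooth : IsSmoothCompleteIntersection f) (η : ℕ → ℂ_[p] × Form n r ℂ_[p]) :
    (c.shiftedSequence f d hr hd hf hsmooth).IsEta η ↔ c.IsEtaSeq f d η := by
  constructor
  · rintro ⟨h0, h1⟩
    refine ⟨h0, fun i => ?_⟩
    obtain ⟨w, hw, hwη, τ, hτ, hτη, hwτ⟩ := h1 i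
    rw [hwη]
    exact ⟨rfl, hw, τ, hτ, hτη, hwτ⟩
  · rintro ⟨h0, h1⟩
    refine ⟨h0, fun i => ?_⟩
    obtain ⟨h2, hw, τ, hτ, hτη, hwτ⟩ := h1 i
    exact ⟨(η (i + 1)).2, hw, Prod.ext h2 rfl, τ, hτ, hτη, hwτ⟩

end Constants

theorem nonempty_equiv_quotient_span_singleton {R H : Type*} [CommRing R] [AddCommGroup H]
    [Module R H] {x : H} {P : R} (hx : ∀ y, ∃ a : R, a • x = y) (hP : ∀ a : R, a • x = 0 ↔ P ∣ a) :
    Nonempty (H ≃ₗ[R] R ⧸ Ideal.span {P}) := by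
  have hker : LinearMap.ker (LinearMap.toSpanSingleton R H x) = Ideal.span {P} := by
    ext a
    rw [LinearMap.mem_ker, Ideal.mem_span_singleton, ← hP]
    rfl
  exact ⟨((Submodule.quotEquivOfEq _ _ hker).symm.trans
    ((LinearMap.toSpanSingleton R H x).quotKerEquivOfSurjective hx)).symm⟩

/-! ### Comparison of `tilde` with `hat`, and reduction to level zero -/

namespace Constants

variable {p : ℕ} [hp : Fact p.Prime] {F : Type*} [Field F] (c : Constants p F) {n r : ℕ}

theorem inr_mem_cocycles_iff (f : Fin r → MvPolynomial (Fin (n + 1)) F) (d : Fin r → ℕ) (s : ℤ)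
    (k : ℕ) (ω : Form n r ℂ_[p]) :
    ((0, ω) : ℂ_[p] × Form n r ℂ_[p]) ∈ cocycles (c.hatD f) (c.hat n d s) (k + 1) ↔
      ω ∈ cocycles (c.D f) (c.tilde n d s) k := by
  refine and_congr ⟨?_, fun h => ⟨ω, h, rfl⟩⟩ ?_
  · rintro ⟨u, hu, h⟩
    have h1 : u = ω := (Prod.ext_iff.1 h).2
    exact h1 ▸ hu
  · constructor
    · intro h
      exact neg_eq_zero.1 (Prod.ext_iff.1 h).2
    · intro h
      exact Prod.ext rfl (neg_eq_zero.2 h)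

theorem inr_mem_coboundaries_iff (f : Fin r → MvPolynomial (Fin (n + 1)) F) (d : Fin r → ℕ) (s : ℤ)
    (k : ℕ) (ω : Form n r ℂ_[p]) :
    ((0, ω) : ℂ_[p] × Form n r ℂ_[p]) ∈ coboundaries (c.hatD f) (c.hat n d s) (k + 1) ↔
      ω ∈ coboundaries (c.D f) (c.tilde n d s) k := by
  cases k with
  | zero =>
    constructor
    · rintro ⟨z, ⟨x, hx, rfl⟩, h⟩
      have h1 : -c.D f 0 = ω := (Prod.ext_iff.1 h).2
      rw [map_zero, neg_zero] at h1
      exact h1.symm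
    · intro h
      have h1 : ω = 0 := h
      rw [h1]
      exact zero_mem _
  | succ k =>
    constructor
    · rintro ⟨z, ⟨u, hu, rfl⟩, h⟩
      have h1 : -c.D f u = ω := (Prod.ext_iff.1 h).2
      exact ⟨-u, neg_mem hu, (map_neg _ _).trans h1⟩
    · rintro ⟨u, hu, rfl⟩
      exact ⟨(0, -u), ⟨-u, neg_mem hu, rfl⟩,
        Prod.ext rfl ((congrArg Neg.neg (map_neg (c.D f) u)).trans (neg_neg _))⟩

/-- The cocycles of `tilde` are the cocycles of `hat` one degree higher. -/
def cocyclesEquiv (f : Fin r → MvPolynomial (Fin (n + 1)) F) (d : Fin r → ℕ) (s : ℤ) (k : ℕ) :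
    cocycles (c.D f) (c.tilde n d s) k ≃ₗ[c.integers]
      cocycles (c.hatD f) (c.hat n d s) (k + 1) where
  toFun ω := ⟨(0, ω), (c.inr_mem_cocycles_iff f d s k _).2 ω.2⟩
  map_add' ω ω' := Subtype.ext (Prod.ext (add_zero 0).symm rfl)
  map_smul' a ω := Subtype.ext (Prod.ext (smul_zero a).symm rfl)
  invFun z := ⟨z.1.2, by
    obtain ⟨u, hu, h⟩ := z.2.1
    rw [← c.inr_mem_cocycles_iff]
    have h1 : z.1 = (0, z.1.2) := Prod.ext (Prod.ext_iff.1 h).1.symm rfl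
    exact h1 ▸ z.2⟩
  left_inv ω := rfl
  right_inv z := by
    obtain ⟨u, hu, h⟩ := z.2.1
    exact Subtype.ext (Prod.ext (Prod.ext_iff.1 h).1 rfl)

/-- The cohomology of `tilde` is the cohomology of `hat` one degree higher. -/
def cohomologyEquiv (f : Fin r → MvPolynomial (Fin (n + 1)) F) (d : Fin r → ℕ) (s : ℤ) (k : ℕ) :
    c.HTilde f d s k ≃ₗ[c.integers] c.HHat f d s (k + 1) :=
  Submodule.Quotient.equiv _ _ (c.cocyclesEquiv f d s k) (by
    ext z
    obtain ⟨ω, rfl⟩ := (c.cocyclesEquiv f d s k).surjective z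
    rw [Submodule.mem_map_equiv, LinearEquiv.symm_apply_apply]
    exact (c.inr_mem_coboundaries_iff f d s k ω).symm)

theorem cohomologyEquiv_cls (f : Fin r → MvPolynomial (Fin (n + 1)) F) (d : Fin r → ℕ) (s : ℤ)
    (k : ℕ) (ω : Form n r ℂ_[p]) (h : ω ∈ cocycles (c.D f) (c.tilde n d s) k) :
    c.cohomologyEquiv f d s k (cls _ _ k ω h) =
      cls _ _ (k + 1) (0, ω) ((c.inr_mem_cocycles_iff f d s k ω).2 h) := rfl

variable [Finite F]

/-- Multiplication by `π^s` identifies level `0` with level `s`, and it commutes with `θ` and `D`.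
-/
theorem mem_tilde_iff {d : Fin r → ℕ} {s : ℤ} {k : ℕ} {v : Form n r ℂ_[p]} :
    v ∈ c.tilde n d s k ↔ ∃ u ∈ c.tilde n d 0 k, c.π ^ s • u = v := by
  simp only [mem_tilde, mem_filt_zero]
  simp only [mem_filt]
  constructor
  · rintro ⟨τ, ⟨ω, hω, rfl⟩, rfl⟩
    exact ⟨_, ⟨_, ⟨ω, hω, rfl⟩, rfl⟩, (c.thetaInt_smul d _ _).symm⟩
  · rintro ⟨u, ⟨_, ⟨ω, hω, rfl⟩, rfl⟩, rfl⟩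
    exact ⟨_, ⟨ω, hω, rfl⟩, c.thetaInt_smul d _ _⟩

theorem zpow_smul_injective (s : ℤ) :
    Function.Injective fun ω : Form n r ℂ_[p] => c.π ^ s • ω :=
  smul_right_injective _ (zpow_ne_zero s c.π_ne_zero)

theorem zpow_smul_mem_tilde {d : Fin r → ℕ} {s : ℤ} {k : ℕ} {u : Form n r ℂ_[p]} :
    c.π ^ s • u ∈ c.tilde n d s k ↔ u ∈ c.tilde n d 0 k := by
  rw [mem_tilde_iff]
  refine ⟨?_, fun h => ⟨u, h, rfl⟩⟩
  rintro ⟨v, hv, h⟩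
  rwa [← c.zpow_smul_injective s h]

theorem zpow_smul_mem_cocycles (f : Fin r → MvPolynomial (Fin (n + 1)) F) {d : Fin r → ℕ} {s : ℤ}
    {k : ℕ} {u : Form n r ℂ_[p]} :
    c.π ^ s • u ∈ cocycles (c.D f) (c.tilde n d s) k ↔
      u ∈ cocycles (c.D f) (c.tilde n d 0) k := by
  refine and_congr c.zpow_smul_mem_tilde ?_
  change c.D f _ = 0 ↔ c.D f u = 0
  rw [D_smul, smul_eq_zero_iff_right (zpow_ne_zero s c.π_ne_zero)]

theorem zpow_smul_mem_coboundaries (f : Fin r → MvPolynomial (Fin (n + 1)) F) {d : Fin r → ℕ}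
    {s : ℤ} {k : ℕ} {u : Form n r ℂ_[p]} :
    c.π ^ s • u ∈ coboundaries (c.D f) (c.tilde n d s) k ↔
      u ∈ coboundaries (c.D f) (c.tilde n d 0) k := by
  cases k with
  | zero => exact smul_eq_zero_iff_right (zpow_ne_zero s c.π_ne_zero)
  | succ k =>
    constructor
    · rintro ⟨v, hv, h⟩
      obtain ⟨w, hw, rfl⟩ := c.mem_tilde_iff.1 hv
      rw [D_smul] at h
      exact ⟨w, hw, c.zpow_smul_injective s h⟩
    · rintro ⟨w, hw, rfl⟩
      exact ⟨c.π ^ s • w, c.zpow_smul_mem_tilde.2 hw, c.D_smul f _ _⟩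

theorem subsingleton_HTilde (f : Fin r → MvPolynomial (Fin (n + 1)) F) {d : Fin r → ℕ} {k : ℕ}
    (h : cocycles (c.D f) (c.tilde n d 0) k ≤ coboundaries (c.D f) (c.tilde n d 0) k) (s : ℤ) :
    Subsingleton (c.HTilde f d s k) := by
  refine Submodule.Quotient.subsingleton_iff.2 (eq_top_iff.2 fun z _ => ?_)
  obtain ⟨u, hu, h1⟩ := c.mem_tilde_iff.1 z.2.1
  have h2 := z.2
  rw [← h1, zpow_smul_mem_cocycles] at h2
  change z.1 ∈ coboundaries (c.D f) (c.tilde n d s) k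
  rw [← h1, zpow_smul_mem_coboundaries]
  exact h h2

theorem exists_cls_eq_smul (f : Fin r → MvPolynomial (Fin (n + 1)) F) {d : Fin r → ℕ} {k : ℕ}
    {w : Form n r ℂ_[p]} (hw : ∀ u ∈ cocycles (c.D f) (c.tilde n d 0) k,
      ∃ a : c.integers, u - a • w ∈ coboundaries (c.D f) (c.tilde n d 0) k) {s : ℤ}
    (hw' : c.π ^ s • w ∈ cocycles (c.D f) (c.tilde n d s) k) (x : c.HTilde f d s k) :
    ∃ a : c.integers, a • cls _ _ k _ hw' = x := by
  obtain ⟨⟨v, hv⟩, rfl⟩ := Submodule.Quotient.mk_surjective _ x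
  obtain ⟨u, hu, rfl⟩ := c.mem_tilde_iff.1 hv.1
  obtain ⟨a, ha⟩ := hw u ((c.zpow_smul_mem_cocycles f).1 hv)
  refine ⟨a, ((Submodule.Quotient.eq _).2 ?_).symm⟩
  change c.π ^ s • u - a • c.π ^ s • w ∈ coboundaries (c.D f) (c.tilde n d s) k
  have h1 : c.π ^ s • (u - a • w) = c.π ^ s • u - a • c.π ^ s • w := by
    rw [smul_sub, integers_smul_eq, integers_smul_eq, smul_comm]
  exact h1 ▸ (c.zpow_smul_mem_coboundaries f).2 ha

theorem smul_cls_eq_zero_iff (f : Fin r → MvPolynomial (Fin (n + 1)) F) {d : Fin r → ℕ} {k : ℕ}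
    {w : Form n r ℂ_[p]} {s : ℤ} (hw : c.π ^ s • w ∈ cocycles (c.D f) (c.tilde n d s) k)
    (a : c.integers) :
    a • cls _ _ k _ hw = 0 ↔ a • w ∈ coboundaries (c.D f) (c.tilde n d 0) k := by
  have h1 : c.π ^ s • a • w = a • c.π ^ s • w := by
    rw [integers_smul_eq, integers_smul_eq, smul_comm]
  rw [← c.zpow_smul_mem_coboundaries (s := s), h1]
  exact (Submodule.Quotient.mk_eq_zero _)

variable [CharP F p] (f : Fin r → MvPolynomial (Fin (n + 1)) F) (d : Fin r → ℕ)

theorem cocycles_le_coboundaries_of_even (hr : r < n) (hd : ∀ j, 0 < d j) (hf : ∀ j, (f j).IsHomogeneous (d j))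
    (hsmooth : IsSmoothCompleteIntersection f)
    {k : ℕ} (hk : k < n + r) (hk' : Even k) :
    cocycles (c.D f) (c.tilde n d 0) k ≤ coboundaries (c.D f) (c.tilde n d 0) k := by
  intro u hu
  obtain ⟨η, hη⟩ := (c.shiftedSequence f d hr hd hf hsmooth).exists_isEta
  obtain ⟨i, rfl⟩ := hk'
  rw [← two_mul] at *
  exact hη.mem_coboundaries hk hu.1 hu.2

variable {f d} in
theorem IsEtaSeq.eq_mk {η : ℕ → ℂ_[p] × Form n r ℂ_[p]} (hη : c.IsEtaSeq f d η) {i : ℕ}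
    (hi : 0 < i) : η i = (0, (η i).2) := by
  obtain ⟨i, rfl⟩ := Nat.exists_eq_succ_of_ne_zero hi.ne'
  exact Prod.ext (hη.2 i).1 rfl


theorem IsEtaSeq.snd_mem_cocycles (hr : r < n) (hd : ∀ j, 0 < d j) (hf : ∀ j, (f j).IsHomogeneous (d j))
    (hsmooth : IsSmoothCompleteIntersection f)
    {η : ℕ → ℂ_[p] × Form n r ℂ_[p]} (hη : c.IsEtaSeq f d η) {i : ℕ}
    (hi : 0 < i) : (η i).2 ∈ cocycles (c.D f) (c.tilde n d 0) (2 * i - 1) := by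
  obtain ⟨i, rfl⟩ := Nat.exists_eq_succ_of_ne_zero hi.ne'
  obtain ⟨-, hw, τ, hτ, -, hwτ⟩ := hη.2 i
  refine ⟨hw, ?_⟩
  obtain ⟨v, hv, h1⟩ := hwτ
  let X := c.shiftedSequence f d hr hd hf hsmooth
  have h2 : c.D f (c.D f v) = 0 := X.δ_δ (X.mem_U.1 hv).1
  have h3 : c.D f (c.D f τ) = 0 := X.δ_δ hτ
  rw [h1, map_sub, h3, sub_zero] at h2
  exact h2

theorem IsEtaSeq.exists_sub_smul_mem (hr : r < n) (hd : ∀ j, 0 < d j) (hf : ∀ j, (f j).IsHomogeneous (d j))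
    (hsmooth : IsSmoothCompleteIntersection f)
    {η : ℕ → ℂ_[p] × Form n r ℂ_[p]} (hη : c.IsEtaSeq f d η)
    {i : ℕ} (hi : 0 < i) (hN : 2 * i < n + r + 1) {u : Form n r ℂ_[p]}
    (hu : u ∈ cocycles (c.D f) (c.tilde n d 0) (2 * i - 1)) :
    ∃ a : c.integers, u - a • (η i).2 ∈ coboundaries (c.D f) (c.tilde n d 0) (2 * i - 1) := by
  have h1 := (c.inr_mem_cocycles_iff f d 0 _ u).2 hu
  rw [Nat.sub_add_cancel (by omega)] at h1
  obtain ⟨a, ha⟩ := ((c.isEta_iff f d hr hd hf hsmooth η).2 hη).exists_sub_mem hN h1.1 h1.2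
  refine ⟨a, ?_⟩
  rw [← c.inr_mem_coboundaries_iff, Nat.sub_add_cancel (by omega)]
  rw [hη.eq_mk c hi] at ha
  have h2 : ((0, u) : ℂ_[p] × Form n r ℂ_[p]) - a • ((0, (η i).2) : ℂ_[p] × Form n r ℂ_[p]) =
      (0, u - a • (η i).2) := Prod.ext ((congrArg _ (smul_zero a)).trans (sub_zero 0)) rfl
  exact h2 ▸ ha

theorem IsEtaSeq.smul_mem_coboundaries_iff (hr : r < n) (hd : ∀ j, 0 < d j) (hf : ∀ j, (f j).IsHomogeneous (d j))
    (hsmooth : IsSmoothCompleteIntersection f)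
    {η : ℕ → ℂ_[p] × Form n r ℂ_[p]}
    (hη : c.IsEtaSeq f d η) {i : ℕ} (hi : r < i) (hN : 2 * i < n + r + 1) (a : c.integers) :
    a • (η i).2 ∈ coboundaries (c.D f) (c.tilde n d 0) (2 * i - 1) ↔
      ((∏ j, d j : ℕ) : c.integers) ∣ a := by
  refine Iff.trans ?_ (((c.isEta_iff f d hr hd hf hsmooth η).2 hη).smul_mem_iff hi
    (hN.trans (Nat.lt_succ_self _)) (a := a))
  rw [← c.inr_mem_coboundaries_iff, Nat.sub_add_cancel (by omega)]
  have h2 : ((0, a • (η i).2) : ℂ_[p] × Form n r ℂ_[p]) = a • η i := by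
    rw [hη.eq_mk c (by omega)]
    exact Prod.ext (smul_zero a).symm rfl
  rw [h2]
  rfl

theorem exists_isEtaSeq (hr : r < n) (hd : ∀ j, 0 < d j) (hf : ∀ j, (f j).IsHomogeneous (d j))
    (hsmooth : IsSmoothCompleteIntersection f) : ∃ η, c.IsEtaSeq f d η := by
  obtain ⟨η, hη⟩ := (c.shiftedSequence f d hr hd hf hsmooth).exists_isEta
  exact ⟨η, (c.isEta_iff f d hr hd hf hsmooth η).1 hη⟩

/-- In odd degrees the cohomology is generated by a class annihilated by `∏ d_j`, which is a unit of
the integers when `p` does not divide it. -/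
theorem cocycles_le_coboundaries_of_not_dvd (hr : r < n) (hd : ∀ j, 0 < d j) (hf : ∀ j, (f j).IsHomogeneous (d j))
    (hsmooth : IsSmoothCompleteIntersection f)
    {k : ℕ} (hrk : 2 * r ≤ k) (hk : k < n + r)
    (hp : ¬ p ∣ ∏ j, d j) :
    cocycles (c.D f) (c.tilde n d 0) k ≤ coboundaries (c.D f) (c.tilde n d 0) k := by
  rcases Nat.even_or_odd k with h | h
  · exact c.cocycles_le_coboundaries_of_even f d hr hd hf hsmooth hk h
  intro u hu
  obtain ⟨m, rfl⟩ := h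
  obtain ⟨η, hη⟩ := c.exists_isEtaSeq f d hr hd hf hsmooth
  obtain ⟨a, ha⟩ := hη.exists_sub_smul_mem c f d hr hd hf hsmooth m.succ_pos (by omega) hu
  have h1 := (hη.smul_mem_coboundaries_iff c f d hr hd hf hsmooth (i := m + 1) (by omega)
    (by omega) a).2 (c.isUnit_natCast hp).dvd
  have h2 := add_mem ha h1
  rwa [sub_add_cancel] at h2

/-- The class of `π^s η_i` generates the cohomology. -/
theorem IsEtaSeq.span_cls_eq_top (hr : r < n) (hd : ∀ j, 0 < d j) (hf : ∀ j, (f j).IsHomogeneous (d j))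
    (hsmooth : IsSmoothCompleteIntersection f)
    {η : ℕ → ℂ_[p] × Form n r ℂ_[p]} (hη : c.IsEtaSeq f d η)
    {i k : ℕ} (hk : k + 1 = 2 * i) (hN : k < n + r) {s : ℤ}
    (h : c.π ^ s • (η i).2 ∈ cocycles (c.D f) (c.tilde n d s) k) :
    Submodule.span c.integers {cls _ _ k _ h} = ⊤ := by
  obtain rfl : k = 2 * i - 1 := by omega
  refine eq_top_iff.2 fun x _ => Submodule.mem_span_singleton.2 ?_
  exact c.exists_cls_eq_smul f
    (fun u hu => hη.exists_sub_smul_mem c f d hr hd hf hsmooth (by omega) (by omega) hu) h x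

theorem nonempty_HTilde_equiv (hr : r < n) (hd : ∀ j, 0 < d j) (hf : ∀ j, (f j).IsHomogeneous (d j))
    (hsmooth : IsSmoothCompleteIntersection f)
    {k : ℕ} (hrk : 2 * r ≤ k) (hk : k < n + r) (hodd : Odd k) (s : ℤ) :
    Nonempty (c.HTilde f d s k ≃ₗ[c.integers]
      c.integers ⧸ Ideal.span {((∏ j, d j : ℕ) : c.integers)}) := by
  obtain ⟨i, hi⟩ : ∃ i, k = 2 * i - 1 ∧ r < i ∧ 2 * i < n + r + 1 := by
    obtain ⟨m, rfl⟩ := hodd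
    exact ⟨m + 1, by omega, by omega, by omega⟩
  obtain ⟨rfl, hri, hin⟩ := hi
  obtain ⟨η, hη⟩ := c.exists_isEtaSeq f d hr hd hf hsmooth
  have hz : c.π ^ s • (η i).2 ∈ cocycles (c.D f) (c.tilde n d s) (2 * i - 1) :=
    (c.zpow_smul_mem_cocycles f).2
      (hη.snd_mem_cocycles c f d hr hd hf hsmooth (by omega))
  have h1 : ∀ x, ∃ a : c.integers, a • cls (c.D f) (c.tilde n d s) _ _ hz = x :=
    c.exists_cls_eq_smul f
      (fun u hu => hη.exists_sub_smul_mem c f d hr hd hf hsmooth (by omega) hin hu) hz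
  have h2 (a : c.integers) : a • cls (c.D f) (c.tilde n d s) _ _ hz = 0 ↔
      ((∏ j, d j : ℕ) : c.integers) ∣ a :=
    (c.smul_cls_eq_zero_iff f hz a).trans
      (hη.smul_mem_coboundaries_iff c f d hr hd hf hsmooth hri hin a)
  exact nonempty_equiv_quotient_span_singleton h1 h2

end Constants

end DworkCI

end

open DworkCI

theorem proposition4p23 (p : ℕ) [Fact p.Prime] (F : Type*) [Field F] [Finite F] [CharP F p]
    (n r : ℕ) (f : Fin r → MvPolynomial (Fin (n + 1)) F) (d : Fin r → ℕ)
    (hd : ∀ j, 0 < d j) (hf : ∀ j, (f j).IsHomogeneous (d j))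
    (hsmooth : IsSmoothCompleteIntersection f)
    (c : Constants p F) (s : ℤ) (k : ℕ) (hk : 2 * r ≤ k) (hk' : k < n + r) :
    -- the identification of the two cohomology modules
    (∃ e : c.HTilde f d s k ≃ₗ[c.integers] c.HHat f d s (k + 1),
      ∀ ω (h : ω ∈ cocycles (c.D f) (c.tilde n d s) k),
        ∃ h' : ((0, ω) : ℂ_[p] × Form n r ℂ_[p]) ∈ cocycles (c.hatD f) (c.hat n d s) (k + 1),
          e (cls _ _ k ω h) = cls _ _ (k + 1) (0, ω) h') ∧
    -- the case where `p` does not divide the product of the degrees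
    (¬ p ∣ ∏ j, d j → Subsingleton (c.HTilde f d s k) ∧ Subsingleton (c.HHat f d s (k + 1))) ∧
    -- the case where `p` divides the product of the degrees
    (p ∣ ∏ j, d j →
      (Even k → Subsingleton (c.HTilde f d s k) ∧ Subsingleton (c.HHat f d s (k + 1))) ∧
      (Odd k →
        Nonempty (c.HTilde f d s k ≃ₗ[c.integers]
          c.integers ⧸ Ideal.span {((∏ j, d j : ℕ) : c.integers)}) ∧
        Nonempty (c.HHat f d s (k + 1) ≃ₗ[c.integers]
          c.integers ⧸ Ideal.span {((∏ j, d j : ℕ) : c.integers)}) ∧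
        -- generators
        (∃ η, c.IsEtaSeq f d η) ∧
        ∀ η, c.IsEtaSeq f d η →
          (∃ h : c.π ^ s • (η ((k + 1) / 2)).2 ∈ cocycles (c.D f) (c.tilde n d s) k,
            Submodule.span c.integers {cls _ _ k _ h} = ⊤) ∧
          (∃ h : c.π ^ s • η ((k + 1) / 2) ∈ cocycles (c.hatD f) (c.hat n d s) (k + 1),
            Submodule.span c.integers {cls _ _ (k + 1) _ h} = ⊤))) := by
  -- The range `2 r ≤ k < n + r` is empty otherwise. This inequality keeps the local cohomology
  -- along `x = 0` out of the range.
  have hr : r < n := by omega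
  have hE (h : Subsingleton (c.HTilde f d s k)) :
      Subsingleton (c.HTilde f d s k) ∧ Subsingleton (c.HHat f d s (k + 1)) :=
    ⟨h, (c.cohomologyEquiv f d s k).symm.toEquiv.subsingleton⟩
  refine ⟨⟨c.cohomologyEquiv f d s k, fun ω h => ⟨_, c.cohomologyEquiv_cls f d s k ω h⟩⟩,
    fun hp => hE (c.subsingleton_HTilde f
      (c.cocycles_le_coboundaries_of_not_dvd f d hr hd hf hsmooth hk hk' hp) s),
    fun _ => ⟨fun hev => hE (c.subsingleton_HTilde f
      (c.cocycles_le_coboundaries_of_even f d hr hd hf hsmooth hk' hev) s), fun hodd => ?_⟩⟩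
  obtain ⟨e⟩ := c.nonempty_HTilde_equiv f d hr hd hf hsmooth hk hk' hodd s
  refine ⟨⟨e⟩, ⟨(c.cohomologyEquiv f d s k).symm.trans e⟩,
    c.exists_isEtaSeq f d hr hd hf hsmooth, fun η hη => ?_⟩
  obtain ⟨i, hi, hki⟩ : ∃ i, 0 < i ∧ k = 2 * i - 1 := by
    obtain ⟨m, rfl⟩ := hodd
    exact ⟨m + 1, by omega, by omega⟩
  have hm : (k + 1) / 2 = i := by omega
  rw [hm]
  have hz : c.π ^ s • (η i).2 ∈ cocycles (c.D f) (c.tilde n d s) k := by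
    rw [hki]
    exact (c.zpow_smul_mem_cocycles f).2 (hη.snd_mem_cocycles c f d hr hd hf hsmooth hi)
  have hspan := hη.span_cls_eq_top c f d hr hd hf hsmooth (i := i) (by omega) hk' hz
  refine ⟨⟨hz, hspan⟩, ?_⟩
  have h1 : c.π ^ s • η i = (0, c.π ^ s • (η i).2) := by
    conv_lhs => rw [hη.eq_mk c hi]
    exact Prod.ext (smul_zero _) rfl
  rw [h1]
  refine ⟨(c.inr_mem_cocycles_iff f d s _ _).2 hz, ?_⟩
  have h2 := Submodule.map_span (c.cohomologyEquiv f d s k).toLinearMap {cls _ _ _ _ hz}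
  rw [hspan, Submodule.map_top, LinearEquiv.range, Set.image_singleton] at h2
  exact h2.symm
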